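/- **Theorem (quantitative mode stability on the real axis).** For real parameters with $M>0$ and $a^2+Q^2<M^2$ put $r_\pm=M\pm\sqrt{M^2-a^2-Q^2}$ and $\Delta(r)=r^2-2Mr+a^2+Q^2=(r-r_+)(r-r_-)$, and let $r^*$ be a coordinate on $(r_+,\infty)$ with $\frac{dr^*}{dr}=\frac{r^2+a^2}{\Delta}$ (determined up to an additive constant, with range $\mathbb R$); primes on functions of $r^*$ denote $d/dr^*$. For $\omega\in\mathbb R$ and $m,\ell\in\mathbb Z$ with $\ell\ge|m|$ let $\lambda_{m\ell}=\lambda_{m\ell}^{(a\omega)}$, $\ell=|m|,|m|+1,\dots$, be the eigenvalues, in increasing order, of the problem $$\frac1{\sin\theta}\frac{d}{d\theta}\Big(\sin\theta\,\frac{dS}{d\theta}\Big)-\Big(\frac{m^2}{\sin^2\theta}-a^2\omega^2\cos^2\theta\Big)S+\lambda S=0\quad\text{on }(0,\pi),$$ where $S\not\equiv0$ and $e^{im\phi}S(\theta)$ extends smoothly to $\mathbb S^2$. The radial Carter ODE is $$u''+(\omega^2-V)u=0,\qquad V=\frac{2am\omega(r^2+a^2-\Delta)-a^2m^2+\Delta(\lambda_{m\ell}+a^2\omega^2)}{(r^2+a^2)^2}+\frac{\Delta(2r^2+\Delta-2Mr)}{(r^2+a^2)^3}-\frac{3\Delta^2r^2}{(r^2+a^2)^4}.$$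 Let $\xi=\frac{i(am-(2Mr_+-Q^2)\omega)}{r_+-r_-}$. For $\omega\neq0$, let $u_{hor}$ be a solution such that $(r-r_+)^{-\xi}u_{hor}$, as a function of $r$, extends smoothly to $r=r_+$, with $\big|\big((r-r_+)^{-\xi}u_{hor}\big)(r_+)\big|^2=1$. Let $u_{out}$ be a solution for which there are constants $C_0,C_1,\dots\in\mathbb C$ such that, for every $N$, $u_{out}=e^{i\omega r^*}\sum_{k=0}^N C_kr^{-k}+O(r^{-N-1})$ as $r\to\infty$, with $\lim_{r\to\infty}|u_{out}e^{-i\omega r^*}|^2=1$. These functions are unique up to constant factors of modulus one. Let $W(\omega,m,\ell)=u_{hor}u_{out}'-u_{hor}'u_{out}$, which does not depend on $r^*$; $|W|$ does not depend on the choices made. Then there is a function $G$ of four real variables such that the following holds for all such $a,Q,M$. Let $\mathcal F\subset\{(\omega,m,\ell)\in\mathbb R\times\mathbb Z\times\mathbb Z:\ \ell\ge|m|\}$ be any set with $\omega\ne0$ on $\mathcal F$ and $$C_{\mathcal F}:=\sup_{(\omega,m,\ell)\in\mathcal F}\big(|\omega|+|\omega|^{-1}+|m|+|\lambda_{m\ell}|\big)<\infty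 .$$ Then $W(\omega,m,\ell)\neq0$ for all $(\omega,m,\ell)\in\mathcal F$, and $$\sup_{(\omega,m,\ell)\in\mathcal F}|W^{-1}|\le G(C_{\mathcal F},a,Q,M).$$ -/

import Mathlib

open scoped Manifold

namespace KerrNewman

noncomputable section

/-- Subextremal Kerr–Newman black hole parameters: mass `M > 0` and `a² + Q² < M²`. -/
def Subextremal (a Q M : ℝ) : Prop := 0 < M ∧ a ^ 2 + Q ^ 2 < M ^ 2

/-- The outer root `r₊` of `Δ` (event horizon). -/
def rPlus (a Q M : ℝ) : ℝ := M + √(M ^ 2 - a ^ 2 - Q ^ 2)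

/-- The inner root `r₋` of `Δ`. -/
def rMinus (a Q M : ℝ) : ℝ := M - √(M ^ 2 - a ^ 2 - Q ^ 2)

/-- `Δ(r) = r² - 2Mr + a² + Q²`. -/
def Delta (a Q M r : ℝ) : ℝ := r ^ 2 - 2 * M * r + a ^ 2 + Q ^ 2

/-- `rs` is a tortoise coordinate `r ↦ r*` on `(r₊, ∞)`: `dr*/dr = (r² + a²) / Δ`. This fixes `rs`
on `(r₊, ∞)` up to an additive constant. -/
def IsTortoise (a Q M : ℝ) (rs : ℝ → ℝ) : Prop :=
  ∀ r : ℝ, rPlus a Q M < r → HasDerivAt rs ((r ^ 2 + a ^ 2) / Delta a Q M r) r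

/-! ### The angular Sturm–Liouville problem -/

/-- The point of the unit sphere `𝕊² ⊆ ℝ³` with polar angle `θ` and azimuth `φ`. -/
def spherePoint (θ φ : ℝ) : Metric.sphere (0 : EuclideanSpace ℝ (Fin 3)) 1 :=
  ⟨!₂[Real.sin θ * Real.cos φ, Real.sin θ * Real.sin φ, Real.cos θ], by
    rw [mem_sphere_zero_iff_norm, EuclideanSpace.norm_eq, Real.sqrt_eq_one]
    simp only [Fin.sum_univ_three, Real.norm_eq_abs, sq_abs]
    simp only [Matrix.cons_val_zero, Matrix.cons_val_one, Matrix.cons_val]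
    nlinarith [Real.sin_sq_add_cos_sq θ, Real.sin_sq_add_cos_sq φ]⟩

/-- `S` is an oblate spheroidal eigenfunction with azimuthal number `m`, frequency `ω` and
eigenvalue `lam`: it does not vanish identically on `(0, π)`, `e^{imφ} S(θ)` extends smoothly to the
sphere, and
`(1 / sin θ) (sin θ S')' - (m² / sin² θ - a² ω² cos² θ) S + lam S = 0` on `(0, π)`. -/
structure IsAngularEigenfunction (a ω : ℝ) (m : ℤ) (lam : ℝ) (S : ℝ → ℂ) : Prop where
  ne_zero : ∃ θ ∈ Set.Ioo 0 Real.pi, S θ ≠ 0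
  smooth : ∃ f : Metric.sphere (0 : EuclideanSpace ℝ (Fin 3)) 1 → ℂ,
    ContMDiff (𝓡 2) 𝓘(ℝ, ℂ) ((⊤ : ℕ∞) : WithTop ℕ∞) f ∧
      ∀ θ ∈ Set.Ioo 0 Real.pi, ∀ φ : ℝ,
        f (spherePoint θ φ) = Complex.exp (Complex.I * m * φ) * S θ
  ode : ∀ θ ∈ Set.Ioo 0 Real.pi,
    ((1 / Real.sin θ : ℝ) : ℂ) * deriv (fun t => (Real.sin t : ℂ) * deriv S t) θ
      - (((m : ℝ) ^ 2 / Real.sin θ ^ 2 - a ^ 2 * ω ^ 2 * Real.cos θ ^ 2 : ℝ) : ℂ) * S θ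
      + (lam : ℂ) * S θ = 0

/-- The (real) eigenvalues of the angular problem with parameters `aω` and `m`. -/
def angularSpectrum (a ω : ℝ) (m : ℤ) : Set ℝ :=
  {lam | ∃ S : ℝ → ℂ, IsAngularEigenfunction a ω m lam S}

/-- The eigenvalue `λ_{mℓ}^{(aω)}`, `ℓ ≥ |m|`. For fixed `aω` and `m` the eigenvalues are simple,
bounded below and discrete, and they are listed in increasing order by `ℓ = |m|, |m| + 1, …`; so
`λ_{mℓ}` is the least eigenvalue having at least `ℓ - |m|` eigenvalues below it. -/
def angularEigenvalue (a ω : ℝ) (m ℓ : ℤ) : ℝ :=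
  sInf {lam | lam ∈ angularSpectrum a ω m ∧
    (((ℓ - |m|).toNat : ℕ) : ℕ∞) ≤ {μ | μ ∈ angularSpectrum a ω m ∧ μ < lam}.encard}

/-! ### The radial Carter ODE -/

/-- The potential `V(r)` for which `u = (r² + a²)^{1/2} R` satisfies `u'' + (ω² - V) u = 0`
(prime `= d/dr*`) when `R` solves the separated radial equation
`(Δ R')' + (-ω² (a² - (r² + a²)² / Δ) + a² m² / Δ - 2 a m ω (2Mr - Q²) / Δ - lam) R = 0`. -/
def potential (a Q M ω : ℝ) (m : ℤ) (lam r : ℝ) : ℝ :=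
  (2 * a * m * ω * (r ^ 2 + a ^ 2 - Delta a Q M r) - a ^ 2 * (m : ℝ) ^ 2
      + Delta a Q M r * (lam + a ^ 2 * ω ^ 2)) / (r ^ 2 + a ^ 2) ^ 2
    + Delta a Q M r * (2 * r ^ 2 + Delta a Q M r - 2 * M * r) / (r ^ 2 + a ^ 2) ^ 3
    - 3 * Delta a Q M r ^ 2 * r ^ 2 / (r ^ 2 + a ^ 2) ^ 4

/-- `u`, a function of `r* ∈ ℝ`, solves `u'' + (ω² - V) u = 0`. As `r` runs over `(r₊, ∞)`, `rs r`
runs over all of `ℝ`. -/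
def IsCarterSolution (a Q M ω : ℝ) (m : ℤ) (lam : ℝ) (rs : ℝ → ℝ) (u : ℝ → ℂ) : Prop :=
  ContDiff ℝ 2 u ∧
    ∀ r : ℝ, rPlus a Q M < r →
      deriv (deriv u) (rs r) + ((ω ^ 2 - potential a Q M ω m lam r : ℝ) : ℂ) * u (rs r) = 0

/-- The horizon exponent `ξ = i (am - (2Mr₊ - Q²) ω) / (r₊ - r₋)`. -/
def xi (a Q M ω : ℝ) (m : ℤ) : ℂ :=
  Complex.I * (((a * m - (2 * M * rPlus a Q M - Q ^ 2) * ω)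
    / (rPlus a Q M - rMinus a Q M) : ℝ) : ℂ)

/-- `u` is a function `u_hor`: a solution with `u ~ (r - r₊)^ξ` as `r* → -∞`, in the sense that
`(r - r₊)^{-ξ} u` is smooth up to `r = r₊`, and with `|((r - r₊)^{-ξ} u)(-∞)|² = 1`. -/
structure IsHor (a Q M ω : ℝ) (m : ℤ) (lam : ℝ) (rs : ℝ → ℝ) (u : ℝ → ℂ) : Prop where
  solution : IsCarterSolution a Q M ω m lam rs u
  asymp : ∃ h : ℝ → ℂ, ContDiffOn ℝ ((⊤ : ℕ∞) : WithTop ℕ∞) h (Set.Ici (rPlus a Q M)) ∧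
    ∀ r : ℝ, rPlus a Q M < r →
      h r = ((r - rPlus a Q M : ℝ) : ℂ) ^ (-xi a Q M ω m) * u (rs r)
  normalized : Filter.Tendsto
    (fun r : ℝ => ‖((r - rPlus a Q M : ℝ) : ℂ) ^ (-xi a Q M ω m) * u (rs r)‖ ^ 2)
    (nhdsWithin (rPlus a Q M) (Set.Ioi (rPlus a Q M))) (nhds 1)

/-- `u` is a function `u_out`: a solution with `u ~ e^{iωr*}` as `r* → ∞`, in the sense of a full
asymptotic expansion `u = e^{iωr*} ∑_{k ≤ N} C_k r^{-k} + O(r^{-N-1})`, and with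
`|(u e^{-iωr*})(∞)|² = 1`. -/
structure IsOut (a Q M ω : ℝ) (m : ℤ) (lam : ℝ) (rs : ℝ → ℝ) (u : ℝ → ℂ) : Prop where
  solution : IsCarterSolution a Q M ω m lam rs u
  asymp : ∃ C : ℕ → ℂ, ∀ N : ℕ,
    (fun r : ℝ => u (rs r) - Complex.exp (Complex.I * ω * rs r) *
        ∑ k ∈ Finset.range (N + 1), C k * ((r : ℂ) ^ k)⁻¹)
      =O[Filter.atTop] (fun r : ℝ => (r ^ (N + 1))⁻¹)
  normalized : Filter.Tendsto
    (fun r : ℝ => ‖u (rs r) * Complex.exp (-(Complex.I * ω * rs r))‖ ^ 2)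
    Filter.atTop (nhds 1)

/-- The Wronskian `W = u_hor u_out' - u_hor' u_out`, evaluated at `r* = x`. -/
def wronskian (uHor uOut : ℝ → ℂ) (x : ℝ) : ℂ :=
  uHor x * deriv uOut x - deriv uHor x * uOut x

/-! ### Frequency ranges -/

/-- Real frequency triples `(ω, m, ℓ)` with `ω ≠ 0` and `ℓ ≥ |m|`. -/
def admissibleFreq : Set (ℝ × ℤ × ℤ) := {p | p.1 ≠ 0 ∧ |p.2.1| ≤ p.2.2}

/-- `|ω| + |ω|⁻¹ + |m| + |λ_{mℓ}|`. -/
def freqSize (a : ℝ) (p : ℝ × ℤ × ℤ) : ℝ :=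
  |p.1| + |p.1|⁻¹ + |(p.2.1 : ℝ)| + |angularEigenvalue a p.1 p.2.1 p.2.2|

/-- `C_F = sup_F (|ω| + |ω|⁻¹ + |m| + |λ_{mℓ}|)`. -/
def freqBound (a : ℝ) (F : Set (ℝ × ℤ × ℤ)) : ℝ := sSup (freqSize a '' F)

end

end KerrNewman

/-!
In the variable `x = r - r₊`, `u_hor / √(r² + a²)` is, up to a unimodular factor, a solution `f` of
a confluent Heun equation on `(0, ∞)` that is regular at `x = 0` and `O(1 / x)` at infinity, where
`|W|` is the size of its incoming part. So Green's identity, weighted by the phase of the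
self-adjoint form, makes the pairing of `f` with `L K` at most a multiple of `|W|` for every
admissible test function `K`, where `L` is the Heun operator.

Two families of test functions suffice; put `δ = r₊ - r₋`. Up to phases, the kernels
`(x + δ + z)^{-1}` define an integral transform of Whiting's type, which solves a second order
equation in `z ≥ 0` up to `O(|W|)`. It has a current, conserved up to `O(|W|)`, of opposite signs at
`z = 0` and for large `z`; hence the transform at `z = 0`, the zeroth moment of `f`, is small with
`|W|`. The functions `x^n (x + δ)^{-1-n}` yield a three-term recurrence for the moments, so all of
them are small, and by Weierstrass so are the pairings of `f` with continuous functions of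
`x / (x + δ)`. This contradicts `|f(0)| = 1 / √(r₊² + a²)`, provided `f` stays close to `f(0)` on an
interval that does not depend on the frequency. That uniformity, and the uniform bound for `f`, come
from energy estimates and Grönwall's inequality.
-/

namespace KerrNewman

open Set Filter Topology MeasureTheory

noncomputable section

/-! ### Calculus on the half-line -/

/-- The unimodular number `e^{it}`. -/
def phase (t : ℝ) : ℂ := Complex.exp (Complex.I * t)

lemma norm_phase (t : ℝ) : ‖phase t‖ = 1 := Complex.norm_exp_I_mul_ofReal t

lemma phase_add (s t : ℝ) : phase (s + t) = phase s * phase t := by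
  rw [phase, phase, phase, ← Complex.exp_add]
  push_cast
  ring_nf

lemma hasDerivAt_phase_comp {φ : ℝ → ℝ} {φ' x : ℝ} (h : HasDerivAt φ φ' x) :
    HasDerivAt (fun y => phase (φ y)) (Complex.I * φ' * phase (φ x)) x :=
  (h.ofReal_comp.const_mul Complex.I).cexp.congr_deriv (mul_comm _ _)

lemma hasDerivAt_ofReal (x : ℝ) : HasDerivAt (fun y : ℝ => (y : ℂ)) 1 x := by
  simpa using (hasDerivAt_id x).ofReal_comp

lemma norm_ofReal_of_pos {x : ℝ} (hx : 0 < x) : ‖(x : ℂ)‖ = x := by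
  rw [Complex.norm_real, Real.norm_of_nonneg hx.le]

lemma ofReal_add_ne_zero {x δ : ℝ} (hδ : 0 < δ) (hx : 0 < x) : (x : ℂ) + δ ≠ 0 := by
  exact_mod_cast (add_pos hx hδ).ne'

lemma integrableOn_inv_sq {δ : ℝ} (hδ : 0 < δ) (C : ℝ) :
    IntegrableOn (fun x : ℝ => C / (x + δ) ^ 2) (Ioi 0) := by
  have h := (integrableOn_add_rpow_Ioi_of_lt (a := -2) (c := 0) (m := δ) (by norm_num)
    (by linarith)).const_mul C
  refine IntegrableOn.congr_fun h (fun x hx => ?_) measurableSet_Ioi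
  have : 0 < x + δ := add_pos hx hδ
  rw [Real.rpow_neg this.le, div_eq_mul_inv]
  norm_num

lemma integrableOn_of_norm_le_inv_sq {E : Type*} [NormedAddCommGroup E] {δ C : ℝ} {g : ℝ → E}
    (hδ : 0 < δ) (hg : ContinuousOn g (Ioi 0)) (hC : ∀ x, 0 < x → ‖g x‖ ≤ C / (x + δ) ^ 2) :
    IntegrableOn g (Ioi 0) :=
  (integrableOn_inv_sq hδ C).mono' (hg.aestronglyMeasurable measurableSet_Ioi)
    ((ae_restrict_iff' measurableSet_Ioi).2 (Eventually.of_forall hC))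

lemma norm_integral_Ioi_le_of_hasDerivAt {E : Type*} [NormedAddCommGroup E] [NormedSpace ℝ E]
    [CompleteSpace E] {β g : ℝ → E} {a W : ℝ} (hβ : ∀ x ∈ Ioi a, HasDerivAt β (g x) x)
    (hg : IntegrableOn g (Ioi a)) (ha : Tendsto β (𝓝[>] a) (𝓝 0))
    (htop : ∀ e, 0 < e → ∀ᶠ x in atTop, ‖β x‖ ≤ W + e) :
    ‖∫ x in Ioi a, g x‖ ≤ W := by
  have hupdate : ∀ x ∈ Ioi a, Function.update β a 0 =ᶠ[𝓝 x] β := fun x hx =>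
    (eventually_ne_nhds (ne_of_gt hx)).mono fun y hy => Function.update_of_ne hy _ _
  have hcont : ContinuousWithinAt (Function.update β a 0) (Ici a) a := by
    rw [continuousWithinAt_update_same]
    simpa only [Ici_sdiff_left] using ha
  have hlim := tendsto_limUnder_of_hasDerivAt_of_integrableOn_Ioi hβ hg
  have hlim' : Tendsto (Function.update β a 0) atTop (𝓝 (limUnder atTop β)) :=
    hlim.congr' ((eventually_ne_atTop a).mono fun y hy => (Function.update_of_ne hy _ _).symm)
  have hintegral : ∫ x in Ioi a, g x = limUnder atTop β := by
    simpa using integral_Ioi_of_hasDerivAt_of_tendsto hcont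
      (fun x hx => (hβ x hx).congr_of_eventuallyEq (hupdate x hx)) hg hlim'
  rw [hintegral]
  exact le_of_forall_pos_le_add fun e he => le_of_tendsto hlim.norm (htop e he)

/-! ### The confluent Heun equation -/

/-- `heunDrift / (x (x + δ))` is the derivative of `heunAngle`. -/
def heunDrift (δ M ω c x : ℝ) : ℝ := 2 * (ω * x * (x + δ) - 2 * M * ω * x - c * δ / 2)

/-- The coefficient of order zero in the confluent Heun equation; `b` is the accessory
parameter. -/
def heunPotential (δ M ω b x : ℝ) : ℂ :=
  2 * Complex.I * ω * x + 8 * M * ω ^ 2 * x + b + Complex.I * ω * (δ - 2 * M)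

/-- The angle whose phase is the factor putting the confluent Heun equation in self-adjoint
form. -/
def heunAngle (δ M ω c x : ℝ) : ℝ :=
  2 * ω * x - c * Real.log x + (c - 4 * M * ω) * Real.log (x + δ)

/-- A solution `f`, with derivative `f'`, of the confluent Heun equation
`(x (x + δ) f')' + i drift f' + potential f = 0` on `(0, ∞)`, belonging to the exponent `0` at
`x = 0`. In the application `x = r - r₊`. -/
structure RegularHeunSolution (δ M ω c b : ℝ) (f f' : ℝ → ℂ) : Prop where
  hasDerivAt : ∀ x, 0 < x → HasDerivAt f (f' x) x
  ode : ∀ x, 0 < x → HasDerivAt (fun y : ℝ => ((y * (y + δ) : ℝ) : ℂ) * f' y)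
    (-(Complex.I * heunDrift δ M ω c x * f' x) - heunPotential δ M ω b x * f x) x
  at_zero : Tendsto (fun x : ℝ => (x : ℂ) * f' x) (𝓝[>] 0) (𝓝 0)

/-- A regular solution that is `O(1 / x)` at infinity; `W` bounds `x |f'|` there, that is, the size
of the incoming part of the solution. -/
structure ModeProfile (δ M ω c b : ℝ) (f f' : ℝ → ℂ) (B W : ℝ) : Prop extends
    RegularHeunSolution δ M ω c b f f' where
  bound : ∀ x, 0 < x → ‖f x‖ ≤ B / (x + δ)
  at_top : ∀ e, 0 < e → ∀ᶠ x in atTop, x * ‖f' x‖ ≤ W + e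

/-- A function `K`, with derivative `K'`, that may be paired with a `ModeProfile`: `LK` is the
image of `K` under the Heun operator. -/
structure HeunTestFunction (δ M ω c b : ℝ) (K K' LK : ℝ → ℂ) : Prop where
  hasDerivAt : ∀ x, 0 < x → HasDerivAt K (K' x) x
  flux : ∀ x, 0 < x → HasDerivAt (fun y : ℝ => ((y * (y + δ) : ℝ) : ℂ) * K' y)
    (LK x - Complex.I * heunDrift δ M ω c x * K' x - heunPotential δ M ω b x * K x) x
  norm_le : ∀ x, 0 < x → ‖K x‖ ≤ 1 / (x + δ)
  norm_deriv_le : ∃ C, ∀ x, 0 < x → ‖K' x‖ ≤ C / (x + δ) ^ 2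
  continuousOn_image : ContinuousOn LK (Ioi 0)
  norm_image_le : ∃ C, ∀ x, 0 < x → ‖LK x‖ ≤ C / (x + δ)

lemma hasDerivAt_log_add {δ x : ℝ} (hδ : 0 < δ) (hx : 0 < x) :
    HasDerivAt (fun y => Real.log (y + δ)) (1 / (x + δ)) x :=
  ((hasDerivAt_id x).add_const δ).log (add_pos hx hδ).ne'

lemma hasDerivAt_heunAngle {δ x : ℝ} (M ω c : ℝ) (hδ : 0 < δ) (hx : 0 < x) :
    HasDerivAt (heunAngle δ M ω c) (heunDrift δ M ω c x / (x * (x + δ))) x := by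
  have h := (((hasDerivAt_id x).const_mul (2 * ω)).sub
    ((Real.hasDerivAt_log hx.ne').const_mul c)).add
    ((hasDerivAt_log_add hδ hx).const_mul (c - 4 * M * ω))
  refine h.congr_deriv ?_
  have := (add_pos hx hδ).ne'
  unfold heunDrift
  field_simp
  ring

section Green

variable {δ M ω c b : ℝ} {f f' K K' LK : ℝ → ℂ} {B W : ℝ}

lemma RegularHeunSolution.continuousOn (h : RegularHeunSolution δ M ω c b f f') :
    ContinuousOn f (Ioi 0) :=
  fun x hx => (h.hasDerivAt x hx).continuousAt.continuousWithinAt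

lemma continuousOn_phase_heunAngle (M ω c : ℝ) (hδ : 0 < δ) :
    ContinuousOn (fun x => phase (heunAngle δ M ω c x)) (Ioi 0) := fun _ hx =>
  (hasDerivAt_phase_comp (hasDerivAt_heunAngle M ω c hδ hx)).continuousAt.continuousWithinAt

lemma ModeProfile.bound_nonneg (hδ : 0 < δ) (h : ModeProfile δ M ω c b f f' B W) : 0 ≤ B := by
  have := (norm_nonneg _).trans (h.bound 1 one_pos)
  simpa using (le_div_iff₀ (by positivity)).1 this

lemma ModeProfile.integrableOn_mul (hδ : 0 < δ) (h : ModeProfile δ M ω c b f f' B W)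
    {g : ℝ → ℂ} {C : ℝ} (hg : ContinuousOn g (Ioi 0)) (hC : ∀ x, 0 < x → ‖g x‖ ≤ C / (x + δ)) :
    IntegrableOn (fun x => phase (heunAngle δ M ω c x) * f x * g x) (Ioi 0) := by
  refine integrableOn_of_norm_le_inv_sq (C := B * C) hδ
    (((continuousOn_phase_heunAngle M ω c hδ).mul h.continuousOn).mul hg) fun x hx => ?_
  have hB := h.bound_nonneg hδ
  rw [norm_mul, norm_mul, norm_phase, one_mul]
  calc ‖f x‖ * ‖g x‖ ≤ B / (x + δ) * (C / (x + δ)) := by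
        gcongr
        exacts [h.bound x hx, hC x hx]
    _ = B * C / (x + δ) ^ 2 := by rw [div_mul_div_comm, sq]

/-- The bilinear concomitant of Green's identity for the Heun operator. -/
def concomitant (δ M ω c : ℝ) (f f' K K' : ℝ → ℂ) (x : ℝ) : ℂ :=
  phase (heunAngle δ M ω c x) *
    (K x * (((x * (x + δ) : ℝ) : ℂ) * f' x) - f x * (((x * (x + δ) : ℝ) : ℂ) * K' x))

lemma hasDerivAt_concomitant (hδ : 0 < δ) (h : RegularHeunSolution δ M ω c b f f')
    (hK : HeunTestFunction δ M ω c b K K' LK) {x : ℝ} (hx : 0 < x) :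
    HasDerivAt (concomitant δ M ω c f f' K K')
      (-(phase (heunAngle δ M ω c x) * f x * LK x)) x := by
  have hx0 : (x : ℂ) ≠ 0 := by exact_mod_cast hx.ne'
  have hxδ := ofReal_add_ne_zero hδ hx
  refine ((hasDerivAt_phase_comp (hasDerivAt_heunAngle M ω c hδ hx)).mul
    (((hK.hasDerivAt x hx).mul (h.ode x hx)).sub
      ((h.hasDerivAt x hx).mul (hK.flux x hx)))).congr_deriv ?_
  simp only [Pi.mul_apply, Pi.sub_apply]
  push_cast
  field_simp
  ring

lemma ModeProfile.norm_concomitant_le (hδ : 0 < δ) (h : ModeProfile δ M ω c b f f' B W)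
    (hK : HeunTestFunction δ M ω c b K K' LK) :
    ∃ C, 0 ≤ C ∧ ∀ x, 0 < x →
      ‖concomitant δ M ω c f f' K K' x‖ ≤ x * ‖f' x‖ + C * (x / (x + δ) ^ 2) := by
  obtain ⟨C, hC⟩ := hK.norm_deriv_le
  have hB := h.bound_nonneg hδ
  have hC0 : 0 ≤ C := by
    simpa using (le_div_iff₀ (by positivity)).1 ((norm_nonneg _).trans (hC 1 one_pos))
  refine ⟨B * C, by positivity, fun x hx => ?_⟩
  have hxp : ‖((x * (x + δ) : ℝ) : ℂ)‖ = x * (x + δ) := norm_ofReal_of_pos (by positivity)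
  calc ‖concomitant δ M ω c f f' K K' x‖
      ≤ ‖K x‖ * (x * (x + δ) * ‖f' x‖) + ‖f x‖ * (x * (x + δ) * ‖K' x‖) := by
        rw [concomitant, norm_mul, norm_phase, one_mul]
        refine (norm_sub_le _ _).trans_eq ?_
        rw [norm_mul, norm_mul, norm_mul, norm_mul, hxp]
    _ ≤ 1 / (x + δ) * (x * (x + δ) * ‖f' x‖)
          + B / (x + δ) * (x * (x + δ) * (C / (x + δ) ^ 2)) := by
        gcongr
        exacts [hK.norm_le x hx, h.bound x hx, hC x hx]
    _ = x * ‖f' x‖ + B * C * (x / (x + δ) ^ 2) := by field_simp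

lemma ModeProfile.norm_integral_image_le (hδ : 0 < δ) (h : ModeProfile δ M ω c b f f' B W)
    (hK : HeunTestFunction δ M ω c b K K' LK) :
    ‖∫ x in Ioi 0, phase (heunAngle δ M ω c x) * f x * LK x‖ ≤ W := by
  obtain ⟨C, hC0, hC⟩ := h.norm_concomitant_le hδ hK
  obtain ⟨C', hC'⟩ := hK.norm_image_le
  rw [← norm_neg, ← integral_neg]
  refine norm_integral_Ioi_le_of_hasDerivAt (fun x hx => hasDerivAt_concomitant hδ
    h.toRegularHeunSolution hK hx) (h.integrableOn_mul hδ hK.continuousOn_image hC').neg ?_ ?_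
  · have hlim : Tendsto (fun x : ℝ => ‖(x : ℂ) * f' x‖ + C * (x / (x + δ) ^ 2))
        (𝓝[>] 0) (𝓝 0) := by
      have hcont : ContinuousAt (fun x : ℝ => C * (x / (x + δ) ^ 2)) 0 := by
        refine continuousAt_const.mul (continuousAt_id.div (by fun_prop) ?_)
        simpa using hδ.ne'
      simpa using h.at_zero.norm.add (hcont.tendsto.mono_left nhdsWithin_le_nhds)
    refine squeeze_zero_norm' (eventually_mem_nhdsWithin.mono fun x hx => ?_) hlim
    rw [norm_mul, norm_ofReal_of_pos hx]
    exact hC x hx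
  · intro e he
    have hlim : Tendsto (fun x : ℝ => C / (x + δ)) atTop (𝓝 0) :=
      tendsto_const_nhds.div_atTop (tendsto_atTop_add_const_right _ _ tendsto_id)
    filter_upwards [h.at_top (e / 2) (by positivity), eventually_gt_atTop 0,
      hlim.eventually (gt_mem_nhds (half_pos he))] with x hx_top hx hx_small
    have hle : C * (x / (x + δ) ^ 2) ≤ C / (x + δ) := by
      rw [mul_div_assoc', div_le_div_iff₀ (by positivity) (by positivity)]
      nlinarith [mul_nonneg (mul_nonneg hC0 hδ.le) (add_pos hx hδ).le]
    linarith [hC x hx]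

lemma ModeProfile.incoming_nonneg (h : ModeProfile δ M ω c b f f' B W) : 0 ≤ W := by
  refine le_of_forall_pos_le_add fun e he => ?_
  obtain ⟨x, hx_top, hx⟩ := ((h.at_top e he).and (eventually_gt_atTop 0)).exists
  exact (by positivity : 0 ≤ x * ‖f' x‖).trans hx_top

end Green

/-! ### The moment recurrence -/

/-- The test functions `x ^ n (x + δ) ^ (-s - n)` with `s = 1 - 4 i M ω`. -/
def testFn (δ M ω : ℝ) (n : ℕ) (x : ℝ) : ℂ :=
  phase (4 * M * ω * Real.log (x + δ)) * ((x : ℂ) ^ n / ((x : ℂ) + δ) ^ (n + 1))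

/-- The derivative of `testFn`. -/
def testFnDeriv (δ M ω : ℝ) (n : ℕ) (x : ℝ) : ℂ :=
  (n * δ - (1 - 4 * Complex.I * M * ω) * x) * testFn δ M ω n x / ((x * (x + δ) : ℝ) : ℂ)

/-- The middle coefficient of the three-term recurrence satisfied by the moments. -/
def momentCoeff (δ M : ℝ) (n : ℕ) (ω c b : ℝ) : ℂ :=
  b + Complex.I * ω * (δ - 2 * M) - 2 * n * (1 - 4 * Complex.I * M * ω + n)
    - (1 - Complex.I * c) * (1 - 4 * Complex.I * M * ω + n)
    + (1 - 4 * Complex.I * M * ω + Complex.I * c) * n + 2 * Complex.I * ω * n * δ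

/-- The image of `testFn δ M ω n` under the Heun operator. -/
def testFnImage (δ M ω c b : ℝ) (n : ℕ) (x : ℝ) : ℂ :=
  (n - Complex.I * c) * n * testFn δ M ω (n - 1) x + momentCoeff δ M n ω c b * testFn δ M ω n x
    + (1 - 4 * Complex.I * M * ω + n) * (1 - Complex.I * c + n) * testFn δ M ω (n + 1) x

/-- The moments of a profile with respect to the test functions. -/
def moment (δ M ω c : ℝ) (f : ℝ → ℂ) (n : ℕ) : ℂ :=
  ∫ x in Ioi 0, phase (heunAngle δ M ω c x) * f x * testFn δ M ω n x

section Moments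

variable {δ M ω c b x : ℝ}

lemma norm_testFn (hδ : 0 < δ) (M ω : ℝ) (n : ℕ) (hx : 0 < x) :
    ‖testFn δ M ω n x‖ = (x / (x + δ)) ^ n / (x + δ) := by
  rw [testFn, norm_mul, norm_phase, one_mul, norm_div, norm_pow, norm_pow, ← Complex.ofReal_add,
    norm_ofReal_of_pos hx, norm_ofReal_of_pos (add_pos hx hδ), div_pow, pow_succ,
    div_mul_eq_div_div]

lemma div_add_le_one (hδ : 0 < δ) (hx : 0 < x) : x / (x + δ) ≤ 1 :=
  (div_le_one (add_pos hx hδ)).2 (le_add_of_nonneg_right hδ.le)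

lemma norm_testFn_le (hδ : 0 < δ) (M ω : ℝ) (n : ℕ) (hx : 0 < x) :
    ‖testFn δ M ω n x‖ ≤ 1 / (x + δ) := by
  rw [norm_testFn hδ M ω n hx]
  gcongr
  exact pow_le_one₀ (by positivity) (div_add_le_one hδ hx)

lemma natCast_mul_norm_testFn_le (hδ : 0 < δ) (M ω : ℝ) (n : ℕ) (hx : 0 < x) :
    n * ‖testFn δ M ω n x‖ ≤ n * (x / (x + δ) ^ 2) := by
  rcases n with - | n
  · simp
  · rw [norm_testFn hδ M ω _ hx, sq, div_mul_eq_div_div]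
    gcongr
    exact pow_le_of_le_one (by positivity) (div_add_le_one hδ hx) n.succ_ne_zero

lemma hasDerivAt_testFn (hδ : 0 < δ) (M ω : ℝ) (n : ℕ) (hx : 0 < x) :
    HasDerivAt (testFn δ M ω n) (testFnDeriv δ M ω n x) x := by
  have hx0 : (x : ℂ) ≠ 0 := by exact_mod_cast hx.ne'
  have hxδ := ofReal_add_ne_zero hδ hx
  have h := (hasDerivAt_phase_comp ((hasDerivAt_log_add hδ hx).const_mul (4 * M * ω))).mul
    (((hasDerivAt_ofReal x).pow n).div (((hasDerivAt_ofReal x).add_const (δ : ℂ)).pow (n + 1))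
      (pow_ne_zero _ hxδ))
  refine h.congr_deriv ?_
  have hpow : (n : ℂ) * (x : ℂ) ^ (n - 1) = n * (x : ℂ) ^ n / x := by
    rcases n with - | n
    · simp
    · rw [Nat.add_sub_cancel, pow_succ]; field_simp
  simp only [testFnDeriv, testFn, Pi.div_apply, Pi.pow_apply, Nat.add_sub_cancel, mul_one, hpow]
  push_cast
  field_simp
  ring

lemma continuousOn_testFn (hδ : 0 < δ) (M ω : ℝ) (n : ℕ) :
    ContinuousOn (testFn δ M ω n) (Ioi 0) := fun _ hx =>
  (hasDerivAt_testFn hδ M ω n hx).continuousAt.continuousWithinAt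

lemma testFn_succ (hδ : 0 < δ) (M ω : ℝ) (n : ℕ) (hx : 0 < x) :
    testFn δ M ω (n + 1) x = testFn δ M ω n x * (x / (x + δ)) := by
  have hxδ := ofReal_add_ne_zero hδ hx
  simp only [testFn]
  field_simp
  ring

lemma natCast_mul_testFn_pred (hδ : 0 < δ) (M ω : ℝ) (n : ℕ) (hx : 0 < x) :
    (n : ℂ) * testFn δ M ω (n - 1) x = n * testFn δ M ω n x * ((x + δ) / x) := by
  have hx0 : (x : ℂ) ≠ 0 := by exact_mod_cast hx.ne'
  have hxδ := ofReal_add_ne_zero hδ hx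
  rcases n with - | n
  · simp
  · rw [Nat.add_sub_cancel, testFn_succ hδ M ω n hx]
    field_simp

lemma norm_testFnDeriv_le (hδ : 0 < δ) (M ω : ℝ) (n : ℕ) (hx : 0 < x) :
    ‖testFnDeriv δ M ω n x‖ ≤ (n + ‖1 - 4 * Complex.I * M * ω‖) / (x + δ) ^ 2 := by
  set s : ℂ := 1 - 4 * Complex.I * M * ω with hs
  have hp : 0 < x * (x + δ) := by positivity
  rw [testFnDeriv, norm_div, norm_mul, norm_ofReal_of_pos hp, ← hs, div_le_iff₀ hp]
  calc ‖n * δ - s * x‖ * ‖testFn δ M ω n x‖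
      ≤ (n * δ + ‖s‖ * x) * ‖testFn δ M ω n x‖ := by
        gcongr
        refine (norm_sub_le _ _).trans_eq ?_
        rw [norm_mul, norm_mul, norm_ofReal_of_pos hδ, norm_ofReal_of_pos hx, Complex.norm_natCast]
    _ = δ * (n * ‖testFn δ M ω n x‖) + ‖s‖ * x * ‖testFn δ M ω n x‖ := by ring
    _ ≤ (x + δ) * (n * (x / (x + δ) ^ 2)) + ‖s‖ * x * (1 / (x + δ)) := by
        gcongr ?_ + _ * ?_
        · exact mul_le_mul (le_add_of_nonneg_left hx.le) (natCast_mul_norm_testFn_le hδ M ω n hx)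
            (by positivity) (by positivity)
        · exact norm_testFn_le hδ M ω n hx
    _ = (n + ‖s‖) / (x + δ) ^ 2 * (x * (x + δ)) := by field_simp

lemma hasDerivAt_testFn_flux (hδ : 0 < δ) (M ω c b : ℝ) (n : ℕ) (hx : 0 < x) :
    HasDerivAt (fun y : ℝ => ((y * (y + δ) : ℝ) : ℂ) * testFnDeriv δ M ω n y)
      (testFnImage δ M ω c b n x - Complex.I * heunDrift δ M ω c x * testFnDeriv δ M ω n x
        - heunPotential δ M ω b x * testFn δ M ω n x) x := by
  have hx0 : (x : ℂ) ≠ 0 := by exact_mod_cast hx.ne'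
  have hxδ := ofReal_add_ne_zero hδ hx
  have hflux : (fun y : ℝ => ((y * (y + δ) : ℝ) : ℂ) * testFnDeriv δ M ω n y) =ᶠ[𝓝 x]
      fun y => (n * δ - (1 - 4 * Complex.I * M * ω) * y) * testFn δ M ω n y := by
    filter_upwards [lt_mem_nhds hx] with y hy
    have hy0 : ((y * (y + δ) : ℝ) : ℂ) ≠ 0 := by
      exact_mod_cast (mul_pos hy (add_pos hy hδ)).ne'
    rw [testFnDeriv]
    field_simp
  refine (((((hasDerivAt_ofReal x).const_mul (1 - 4 * Complex.I * M * ω)).const_sub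
    ((n : ℂ) * δ)).mul (hasDerivAt_testFn hδ M ω n hx)).congr_of_eventuallyEq hflux).congr_deriv ?_
  rw [testFnImage, mul_assoc ((n : ℂ) - _), natCast_mul_testFn_pred hδ M ω n hx,
    testFn_succ hδ M ω n hx]
  simp only [testFnDeriv, momentCoeff, heunDrift, heunPotential]
  push_cast
  field_simp
  ring_nf
  rw [Complex.I_sq]
  ring

lemma norm_testFnImage_le (hδ : 0 < δ) (M ω c b : ℝ) (n : ℕ) (hx : 0 < x) :
    ‖testFnImage δ M ω c b n x‖ ≤ (‖((n : ℂ) - Complex.I * c) * n‖ + ‖momentCoeff δ M n ω c b‖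
      + ‖(1 - 4 * Complex.I * M * ω + n) * (1 - Complex.I * c + n)‖) / (x + δ) := by
  refine norm_add₃_le.trans ?_
  rw [norm_mul _ (testFn δ M ω (n - 1) x), norm_mul _ (testFn δ M ω n x),
    norm_mul _ (testFn δ M ω (n + 1) x)]
  refine (add_le_add_three (mul_le_mul_of_nonneg_left (norm_testFn_le hδ M ω _ hx) (norm_nonneg _))
    (mul_le_mul_of_nonneg_left (norm_testFn_le hδ M ω _ hx) (norm_nonneg _))
    (mul_le_mul_of_nonneg_left (norm_testFn_le hδ M ω _ hx) (norm_nonneg _))).trans_eq ?_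
  ring

lemma heunTestFunction_testFn (hδ : 0 < δ) (M ω c b : ℝ) (n : ℕ) :
    HeunTestFunction δ M ω c b (testFn δ M ω n) (testFnDeriv δ M ω n)
      (testFnImage δ M ω c b n) where
  hasDerivAt _ := hasDerivAt_testFn hδ M ω n
  flux _ := hasDerivAt_testFn_flux hδ M ω c b n
  norm_le _ := norm_testFn_le hδ M ω n
  norm_deriv_le := ⟨_, fun _ => norm_testFnDeriv_le hδ M ω n⟩
  continuousOn_image := (((continuousOn_testFn hδ M ω _).const_mul _).add
    ((continuousOn_testFn hδ M ω _).const_mul _)).add ((continuousOn_testFn hδ M ω _).const_mul _)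
  norm_image_le := ⟨_, fun _ => norm_testFnImage_le hδ M ω c b n⟩

variable {f f' : ℝ → ℂ} {B W : ℝ}

lemma ModeProfile.integrableOn_testFn (hδ : 0 < δ) (h : ModeProfile δ M ω c b f f' B W) (n : ℕ) :
    IntegrableOn (fun x => phase (heunAngle δ M ω c x) * f x * testFn δ M ω n x) (Ioi 0) :=
  h.integrableOn_mul hδ (continuousOn_testFn hδ M ω n) fun _ => norm_testFn_le hδ M ω n

lemma ModeProfile.norm_moment_recurrence_le (hδ : 0 < δ) (h : ModeProfile δ M ω c b f f' B W)
    (n : ℕ) :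
    ‖(n - Complex.I * c) * n * moment δ M ω c f (n - 1)
      + momentCoeff δ M n ω c b * moment δ M ω c f n
      + (1 - 4 * Complex.I * M * ω + n) * (1 - Complex.I * c + n) * moment δ M ω c f (n + 1)‖
      ≤ W := by
  refine le_of_eq_of_le ?_ (h.norm_integral_image_le hδ (heunTestFunction_testFn hδ M ω c b n))
  have hint (k : ℕ) (a : ℂ) := (h.integrableOn_testFn hδ k).const_mul a
  simp only [moment]
  rw [← integral_const_mul, ← integral_const_mul, ← integral_const_mul,
    ← integral_add (hint _ _) (hint _ _)]
  congr 1
  refine (integral_add ((hint _ _).add (hint _ _)) (hint _ _)).symm.trans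
    (integral_congr_ae (Eventually.of_forall fun x => ?_))
  simp only [testFnImage, Pi.add_apply]
  ring

lemma exists_norm_le_on_box {g : ℝ → ℝ → ℝ → ℂ}
    (hg : Continuous fun p : ℝ × ℝ × ℝ => g p.1 p.2.1 p.2.2) (K : ℝ) :
    ∃ D, 0 ≤ D ∧ ∀ ω c b, |ω| ≤ K → |c| ≤ K → |b| ≤ K → ‖g ω c b‖ ≤ D := by
  have hI : IsCompact (Icc (-K) K) := isCompact_Icc
  obtain ⟨D, hD⟩ := (hI.prod (hI.prod hI)).exists_bound_of_continuousOn hg.continuousOn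
  exact ⟨max D 0, le_max_right _ _, fun ω c b hω hc hb =>
    (hD (ω, c, b) ⟨abs_le.1 hω, abs_le.1 hc, abs_le.1 hb⟩).trans (le_max_left _ _)⟩

lemma exists_norm_moment_succ_le (hδ : 0 < δ) (M K : ℝ) (n : ℕ) :
    ∃ D, 0 ≤ D ∧ ∀ ω c b B W (f f' : ℝ → ℂ), |ω| ≤ K → |c| ≤ K → |b| ≤ K →
      ModeProfile δ M ω c b f f' B W → ‖moment δ M ω c f (n + 1)‖ ≤
        W + D * (‖moment δ M ω c f n‖ + ‖moment δ M ω c f (n - 1)‖) := by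
  obtain ⟨D₁, hD₁, h₁⟩ := exists_norm_le_on_box (g := momentCoeff δ M n)
    (by unfold momentCoeff; fun_prop) K
  obtain ⟨D₀, -, h₀⟩ := exists_norm_le_on_box (g := fun _ c _ => ((n : ℂ) - Complex.I * c) * n)
    (by fun_prop) K
  refine ⟨max D₁ D₀, hD₁.trans (le_max_left _ _), fun ω c b B W f f' hω hc hb h => ?_⟩
  set m₀ := moment δ M ω c f (n - 1)
  set m₁ := moment δ M ω c f n
  set m₂ := moment δ M ω c f (n + 1)
  set A : ℂ := (1 - 4 * Complex.I * M * ω + n) * (1 - Complex.I * c + n) with hA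
  set T := (n - Complex.I * c) * n * m₀ + momentCoeff δ M n ω c b * m₁ + A * m₂ with hT
  have hA_one : 1 ≤ ‖A‖ := by
    rw [hA, norm_mul]
    refine one_le_mul_of_one_le_of_one_le ?_ ?_ <;>
      exact le_trans (by simp) (Complex.re_le_norm _)
  calc ‖m₂‖ ≤ ‖A * m₂‖ := by
        rw [norm_mul]; exact le_mul_of_one_le_left (norm_nonneg _) hA_one
    _ = ‖T - momentCoeff δ M n ω c b * m₁ - (n - Complex.I * c) * n * m₀‖ := by
        rw [hT]; congr 1; ring
    _ ≤ ‖T‖ + ‖momentCoeff δ M n ω c b‖ * ‖m₁‖ + ‖(n - Complex.I * c) * n‖ * ‖m₀‖ := by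
        rw [← norm_mul, ← norm_mul]
        exact (norm_sub_le _ _).trans (add_le_add_left (norm_sub_le _ _) _)
    _ ≤ W + max D₁ D₀ * ‖m₁‖ + max D₁ D₀ * ‖m₀‖ := by
        gcongr
        exacts [h.norm_moment_recurrence_le hδ n, (h₁ ω c b hω hc hb).trans (le_max_left _ _),
          (h₀ ω c b hω hc hb).trans (le_max_right _ _)]
    _ = W + max D₁ D₀ * (‖m₁‖ + ‖m₀‖) := by ring

lemma le_prod_of_two_step_recurrence {u D : ℕ → ℝ} {W : ℝ} (hu : 0 ≤ u 0) (hD : ∀ n, 0 ≤ D n)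
    (hW : 0 ≤ W) (hrec : ∀ n, u (n + 1) ≤ W + D n * (u n + u (n - 1))) (n : ℕ) :
    u n ≤ (∏ k ∈ Finset.range n, (1 + 2 * D k)) * (u 0 + W) := by
  set P : ℕ → ℝ := fun n => ∏ k ∈ Finset.range n, (1 + 2 * D k)
  have hsucc (n : ℕ) : P (n + 1) = P n * (1 + 2 * D n) := Finset.prod_range_succ _ _
  have hmono : Monotone P := monotone_nat_of_le_succ fun n => by
    rw [hsucc]
    exact le_mul_of_one_le_right (Finset.prod_nonneg fun k _ => by linarith [hD k])
      (by linarith [hD n])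
  induction n using Nat.strong_induction_on with
  | _ n ih =>
    rcases n with - | n
    · simpa using hW
    have hX : 0 ≤ u 0 + W := by positivity
    have hle : W ≤ P n * (u 0 + W) :=
      le_trans (by linarith) (le_mul_of_one_le_left hX (hmono n.zero_le))
    have hpred : u (n - 1) ≤ P n * (u 0 + W) :=
      (ih (n - 1) (by omega)).trans (mul_le_mul_of_nonneg_right (hmono (n.sub_le 1)) hX)
    calc u (n + 1) ≤ W + D n * (u n + u (n - 1)) := hrec n
      _ ≤ P n * (u 0 + W) + D n * (P n * (u 0 + W) + P n * (u 0 + W)) := by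
          gcongr
          exacts [hD n, ih n n.lt_succ_self]
      _ = P (n + 1) * (u 0 + W) := by rw [hsucc]; ring

lemma exists_moment_bound (hδ : 0 < δ) (M K : ℝ) (n : ℕ) :
    ∃ D, 0 ≤ D ∧ ∀ ω c b B W (f f' : ℝ → ℂ), |ω| ≤ K → |c| ≤ K → |b| ≤ K →
      ModeProfile δ M ω c b f f' B W →
      ‖moment δ M ω c f n‖ ≤ D * (‖moment δ M ω c f 0‖ + W) := by
  choose D hD hrec using exists_norm_moment_succ_le hδ M K
  refine ⟨∏ k ∈ Finset.range n, (1 + 2 * D k),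
    Finset.prod_nonneg fun k _ => by linarith [hD k], fun ω c b B W f f' hω hc hb h => ?_⟩
  exact le_prod_of_two_step_recurrence (u := fun n => ‖moment δ M ω c f n‖) (norm_nonneg _) hD
    h.incoming_nonneg (fun n => hrec n ω c b B W f f' hω hc hb h) n

end Moments

/-! ### The integral transform -/

/-- The kernel of the integral transform: up to the factor `(x + δ) ^ (i (4 M ω - c))` it is
`(x + δ + z) ^ (-s - j)` with `s = 1 - i c`. -/
def transformKernel (δ M ω c : ℝ) (j : ℕ) (z x : ℝ) : ℂ :=
  phase ((4 * M * ω - c) * Real.log (x + δ) + c * Real.log (x + δ + z)) /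
    ((x + δ + z : ℝ) : ℂ) ^ (j + 1)

/-- The derivative of `transformKernel δ M ω c 0 z`. -/
def transformKernelDeriv (δ M ω c z x : ℝ) : ℂ :=
  transformKernel δ M ω c 0 z x * (Complex.I * (4 * M * ω - c) / ((x + δ : ℝ) : ℂ)
    - (1 - Complex.I * c) / ((x + δ + z : ℝ) : ℂ))

/-- The integral transform of a profile. -/
def transform (δ M ω c : ℝ) (f : ℝ → ℂ) (j : ℕ) (z : ℝ) : ℂ :=
  ∫ x in Ioi 0, phase (heunAngle δ M ω c x) * f x * transformKernel δ M ω c j z x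

/-- The operator of the transformed equation, written in terms of the family
`T j = (x + δ + z) ^ (-s - j)`, `s = 1 - i c`, whose `z`-derivatives are `-(s + j) T (j + 1)`. -/
def transformedHeun (δ M ω c b z : ℝ) (T : ℕ → ℂ) : ℂ :=
  z * (z + δ) * ((1 - Complex.I * c) * (2 - Complex.I * c)) * T 2
    - ((1 - 4 * Complex.I * M * ω) * (z + δ) + z + 2 * Complex.I * ω * z * (z + δ))
      * (1 - Complex.I * c) * T 1
    + (2 * Complex.I * ω * (1 - Complex.I * c) * z + b + Complex.I * ω * (δ - 2 * M)) * T 0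

section Transform

variable {δ M ω c b x z : ℝ}

lemma norm_transformKernel (M ω c : ℝ) (j : ℕ) (h : 0 < x + δ + z) :
    ‖transformKernel δ M ω c j z x‖ = 1 / (x + δ + z) ^ (j + 1) := by
  rw [transformKernel, norm_div, norm_phase, norm_pow, norm_ofReal_of_pos h]

lemma transformKernel_succ (M ω c : ℝ) (j : ℕ) (h : 0 < x + δ + z) :
    transformKernel δ M ω c (j + 1) z x
      = transformKernel δ M ω c j z x / ((x + δ + z : ℝ) : ℂ) := by
  have : ((x + δ + z : ℝ) : ℂ) ≠ 0 := by exact_mod_cast h.ne'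
  simp only [transformKernel]
  field_simp
  ring

lemma hasDerivAt_transformKernel_param (M ω c : ℝ) (j : ℕ) (h : 0 < x + δ + z) :
    HasDerivAt (fun z => transformKernel δ M ω c j z x)
      (-(1 - Complex.I * c + j) * transformKernel δ M ω c (j + 1) z x) z := by
  have hne : ((x + δ + z : ℝ) : ℂ) ≠ 0 := by exact_mod_cast h.ne'
  have hadd : HasDerivAt (fun z => x + δ + z) 1 z := (hasDerivAt_id z).const_add (x + δ)
  refine ((hasDerivAt_phase_comp (((hadd.log h.ne').const_mul c).const_add
    ((4 * M * ω - c) * Real.log (x + δ)))).div (hadd.ofReal_comp.pow (j + 1))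
    (pow_ne_zero _ hne)).congr_deriv ?_
  simp only [transformKernel, Nat.add_sub_cancel, Pi.pow_apply]
  push_cast at hne ⊢
  field_simp
  ring

lemma hasDerivAt_transformKernel (M ω c : ℝ) (j : ℕ) (hδ : 0 < δ) (hx : 0 < x)
    (h : 0 < x + δ + z) :
    HasDerivAt (transformKernel δ M ω c j z) (transformKernel δ M ω c j z x *
      (Complex.I * (4 * M * ω - c) / ((x + δ : ℝ) : ℂ)
        - (1 - Complex.I * c + j) / ((x + δ + z : ℝ) : ℂ))) x := by
  have hne : ((x + δ + z : ℝ) : ℂ) ≠ 0 := by exact_mod_cast h.ne'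
  have hxδ := ofReal_add_ne_zero hδ hx
  have hadd : HasDerivAt (fun x => x + δ + z) 1 x := ((hasDerivAt_id x).add_const δ).add_const z
  refine ((hasDerivAt_phase_comp (((hasDerivAt_log_add hδ hx).const_mul (4 * M * ω - c)).add
    ((hadd.log h.ne').const_mul c))).div (hadd.ofReal_comp.pow (j + 1))
    (pow_ne_zero _ hne)).congr_deriv ?_
  simp only [transformKernel, Nat.add_sub_cancel, Pi.pow_apply, Pi.add_apply]
  push_cast at hne ⊢
  field_simp
  ring

lemma continuousOn_transformKernel (hδ : 0 < δ) (M ω c : ℝ) (j : ℕ) (hz : -(δ / 2) ≤ z) :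
    ContinuousOn (transformKernel δ M ω c j z) (Ioi 0) := fun x hx =>
  have hx : 0 < x := hx
  (hasDerivAt_transformKernel M ω c j hδ hx (by linarith)).continuousAt.continuousWithinAt

lemma norm_transformKernel_le (hδ : 0 < δ) (M ω c : ℝ) (j : ℕ) (hz : -(δ / 2) ≤ z) (hx : 0 < x) :
    ‖transformKernel δ M ω c j z x‖ ≤ (2 / δ) ^ j * 2 / (x + δ) := by
  have hz_half : (x + δ) / 2 ≤ x + δ + z := by linarith
  have hδ_half : δ / 2 ≤ x + δ + z := by linarith
  rw [norm_transformKernel M ω c j (by linarith)]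
  calc 1 / (x + δ + z) ^ (j + 1) ≤ 1 / ((δ / 2) ^ j * ((x + δ) / 2)) := by
        rw [pow_succ]
        exact one_div_le_one_div_of_le (by positivity)
          (mul_le_mul (pow_le_pow_left₀ (by positivity) hδ_half j) hz_half (by positivity)
            (pow_nonneg (by linarith) j))
    _ = (2 / δ) ^ j * 2 / (x + δ) := by
        rw [div_pow, div_pow]
        field_simp

lemma norm_transformKernelDeriv_le (hδ : 0 < δ) (M ω c : ℝ) (hz : 0 ≤ z) (hx : 0 < x) :
    ‖transformKernelDeriv δ M ω c z x‖
      ≤ (‖Complex.I * (4 * M * ω - c)‖ + ‖1 - Complex.I * c‖) / (x + δ) ^ 2 := by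
  have hxδ : 0 < x + δ := by positivity
  have hxδz : 0 < x + δ + z := by positivity
  rw [transformKernelDeriv, norm_mul, norm_transformKernel M ω c 0 hxδz, zero_add, pow_one]
  calc 1 / (x + δ + z) * _
      ≤ 1 / (x + δ) *
          (‖Complex.I * (4 * M * ω - c)‖ / (x + δ) + ‖1 - Complex.I * c‖ / (x + δ)) := by
        have hle : x + δ ≤ x + δ + z := by linarith
        refine mul_le_mul (one_div_le_one_div_of_le hxδ hle) ((norm_sub_le _ _).trans ?_)
          (norm_nonneg _) (by positivity)
        rw [norm_div, norm_div, norm_ofReal_of_pos hxδ, norm_ofReal_of_pos hxδz]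
        gcongr
    _ = _ := by field_simp

lemma hasDerivAt_transformKernel_flux (hδ : 0 < δ) (M ω c b : ℝ) (hz : 0 ≤ z) (hx : 0 < x) :
    HasDerivAt (fun y : ℝ => ((y * (y + δ) : ℝ) : ℂ) * transformKernelDeriv δ M ω c z y)
      (transformedHeun δ M ω c b z (fun j => transformKernel δ M ω c j z x)
        - Complex.I * heunDrift δ M ω c x * transformKernelDeriv δ M ω c z x
        - heunPotential δ M ω b x * transformKernel δ M ω c 0 z x) x := by
  have hxδz : 0 < x + δ + z := by positivity
  have hxδ := ofReal_add_ne_zero hδ hx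
  have hne : ((x + δ + z : ℝ) : ℂ) ≠ 0 := by exact_mod_cast hxδz.ne'
  have hadd : HasDerivAt (fun y : ℝ => ((y + δ : ℝ) : ℂ)) 1 x := by
    simpa using ((hasDerivAt_id x).add_const δ).ofReal_comp
  have haddz : HasDerivAt (fun y : ℝ => ((y + δ + z : ℝ) : ℂ)) 1 x := by
    simpa using (((hasDerivAt_id x).add_const δ).add_const z).ofReal_comp
  have hprod : HasDerivAt (fun y : ℝ => ((y * (y + δ) : ℝ) : ℂ)) ((2 * x + δ : ℝ) : ℂ) x :=
    ((((hasDerivAt_id x).mul ((hasDerivAt_id x).add_const δ)).ofReal_comp).congr_deriv (by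
      simp only [id_eq]; push_cast; ring))
  refine (hprod.mul ((hasDerivAt_transformKernel M ω c 0 hδ hx hxδz).mul
    (((hadd.inv (by exact_mod_cast hxδ)).const_mul (Complex.I * (4 * M * ω - c))).sub
      ((haddz.inv hne).const_mul (1 - Complex.I * c))))).congr_deriv ?_
  simp only [transformedHeun, transformKernelDeriv, heunDrift, heunPotential, Pi.sub_apply,
    Pi.mul_apply, Pi.inv_apply, transformKernel_succ M ω c 1 hxδz,
    transformKernel_succ M ω c 0 hxδz]
  push_cast at hne ⊢
  field_simp
  ring_nf
  rw [Complex.I_sq]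
  ring

lemma exists_norm_transformedHeun_le (δ M ω c b z : ℝ) (D : ℕ → ℝ) :
    ∃ C, ∀ (y : ℝ) (T : ℕ → ℂ), (∀ j, ‖T j‖ ≤ D j / y) →
      ‖transformedHeun δ M ω c b z T‖ ≤ C / y := by
  obtain ⟨a₂, a₁, a₀, ha⟩ : ∃ a₂ a₁ a₀ : ℂ, ∀ T, transformedHeun δ M ω c b z T =
    a₂ * T 2 - a₁ * T 1 + a₀ * T 0 := ⟨_, _, _, fun _ => rfl⟩
  refine ⟨‖a₂‖ * D 2 + ‖a₁‖ * D 1 + ‖a₀‖ * D 0, fun y T hT => ?_⟩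
  calc ‖transformedHeun δ M ω c b z T‖ ≤ ‖a₂‖ * ‖T 2‖ + ‖a₁‖ * ‖T 1‖ + ‖a₀‖ * ‖T 0‖ := by
        rw [ha, ← norm_mul, ← norm_mul, ← norm_mul]
        exact (norm_add_le _ _).trans (add_le_add_left (norm_sub_le _ _) _)
    _ ≤ ‖a₂‖ * (D 2 / y) + ‖a₁‖ * (D 1 / y) + ‖a₀‖ * (D 0 / y) := by
        gcongr
        exacts [hT 2, hT 1, hT 0]
    _ = _ := by ring

lemma heunTestFunction_transformKernel (hδ : 0 < δ) (M ω c b : ℝ) (hz : 0 ≤ z) :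
    HeunTestFunction δ M ω c b (transformKernel δ M ω c 0 z) (transformKernelDeriv δ M ω c z)
      (fun x => transformedHeun δ M ω c b z fun j => transformKernel δ M ω c j z x) where
  hasDerivAt x hx := by
    simpa only [transformKernelDeriv, Nat.cast_zero, add_zero] using
      hasDerivAt_transformKernel M ω c 0 hδ hx (by positivity : 0 < x + δ + z)
  flux _ := hasDerivAt_transformKernel_flux hδ M ω c b hz
  norm_le x hx := by
    rw [norm_transformKernel M ω c 0 (by positivity), zero_add, pow_one]
    exact one_div_le_one_div_of_le (by positivity) (by linarith)
  norm_deriv_le := ⟨_, fun _ => norm_transformKernelDeriv_le hδ M ω c hz⟩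
  continuousOn_image := by
    have hcont (j : ℕ) := continuousOn_transformKernel hδ M ω c j (by linarith : -(δ / 2) ≤ z)
    exact (((hcont 2).const_mul _).sub ((hcont 1).const_mul _)).add ((hcont 0).const_mul _)
  norm_image_le := by
    obtain ⟨C, hC⟩ := exists_norm_transformedHeun_le δ M ω c b z fun j => (2 / δ) ^ j * 2
    exact ⟨C, fun x hx => hC (x + δ) _ fun j =>
      norm_transformKernel_le hδ M ω c j (by linarith) hx⟩

variable {f f' : ℝ → ℂ} {B W : ℝ}

lemma ModeProfile.integrableOn_transformKernel (hδ : 0 < δ) (h : ModeProfile δ M ω c b f f' B W)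
    (j : ℕ) (hz : -(δ / 2) ≤ z) :
    IntegrableOn (fun x => phase (heunAngle δ M ω c x) * f x * transformKernel δ M ω c j z x)
      (Ioi 0) :=
  h.integrableOn_mul hδ (continuousOn_transformKernel hδ M ω c j hz)
    fun _ => norm_transformKernel_le hδ M ω c j hz

lemma ModeProfile.hasDerivAt_transform (hδ : 0 < δ) (h : ModeProfile δ M ω c b f f' B W) (j : ℕ)
    (hz : 0 ≤ z) :
    HasDerivAt (transform δ M ω c f j)
      (-(1 - Complex.I * c + j) * transform δ M ω c f (j + 1) z) z := by
  have hnhds : Ioi (-(δ / 2)) ∈ 𝓝 z := Ioi_mem_nhds (by linarith)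
  have hz_half : -(δ / 2) ≤ z := by linarith
  have key := hasDerivAt_integral_of_dominated_loc_of_deriv_le
    (μ := volume.restrict (Ioi (0 : ℝ)))
    (F := fun z x => phase (heunAngle δ M ω c x) * f x * transformKernel δ M ω c j z x)
    (F' := fun z x => phase (heunAngle δ M ω c x) * f x *
      (-(1 - Complex.I * c + j) * transformKernel δ M ω c (j + 1) z x))
    (bound := fun x =>
      B * (‖-(1 - Complex.I * c + j)‖ * ((2 / δ) ^ (j + 1) * 2)) / (x + δ) ^ 2)
    hnhds ?_ (h.integrableOn_transformKernel hδ j hz_half) ?_ ?_ (integrableOn_inv_sq hδ _) ?_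
  · refine key.2.congr_deriv ?_
    rw [transform, ← integral_const_mul]
    exact integral_congr_ae (Eventually.of_forall fun x => mul_left_comm _ _ _)
  · filter_upwards [hnhds] with y hy
    exact (h.integrableOn_transformKernel hδ j (le_of_lt hy)).aestronglyMeasurable
  · exact (((continuousOn_phase_heunAngle M ω c hδ).mul h.continuousOn).mul
      ((continuousOn_transformKernel hδ M ω c (j + 1) hz_half).const_mul
        _)).aestronglyMeasurable measurableSet_Ioi
  · refine (ae_restrict_iff' measurableSet_Ioi).2 (Eventually.of_forall fun x hx y hy => ?_)
    have hB := h.bound_nonneg hδ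
    have hx : 0 < x := hx
    rw [norm_mul, norm_mul, norm_phase, one_mul, norm_mul]
    calc _ ≤ B / (x + δ) *
          (‖-(1 - Complex.I * c + j)‖ * ((2 / δ) ^ (j + 1) * 2 / (x + δ))) := by
          gcongr
          exacts [h.bound x hx, norm_transformKernel_le hδ M ω c (j + 1) (le_of_lt hy) hx]
      _ = _ := by field_simp
  · refine (ae_restrict_iff' measurableSet_Ioi).2 (Eventually.of_forall fun x hx y hy => ?_)
    rw [mem_Ioi] at hy hx
    exact (hasDerivAt_transformKernel_param M ω c j (by linarith)).const_mul _

lemma ModeProfile.norm_transformedHeun_transform_le (hδ : 0 < δ)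
    (h : ModeProfile δ M ω c b f f' B W) (hz : 0 ≤ z) :
    ‖transformedHeun δ M ω c b z fun j => transform δ M ω c f j z‖ ≤ W := by
  refine le_of_eq_of_le ?_
    (h.norm_integral_image_le hδ (heunTestFunction_transformKernel hδ M ω c b hz))
  have hint (j : ℕ) (a : ℂ) :=
    (h.integrableOn_transformKernel hδ j (by linarith : -(δ / 2) ≤ z)).const_mul a
  simp only [transformedHeun, transform]
  rw [← integral_const_mul, ← integral_const_mul, ← integral_const_mul,
    ← integral_sub (hint _ _) (hint _ _)]
  congr 1
  refine (integral_add ((hint _ _).sub (hint _ _)) (hint _ _)).symm.trans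
    (integral_congr_ae (Eventually.of_forall fun x => ?_))
  simp only [Pi.sub_apply]
  ring

lemma transform_zero_eq_moment (δ M ω c : ℝ) (f : ℝ → ℂ) :
    transform δ M ω c f 0 0 = moment δ M ω c f 0 := by
  refine integral_congr_ae (Eventually.of_forall fun x => ?_)
  simp only [transformKernel, testFn, add_zero, pow_zero, mul_one_div, ← add_mul, sub_add_cancel]
  push_cast
  rfl

/-- The constant in the decay estimate for the transform. -/
def decayConst (δ : ℝ) : ℝ := ∫ x in Ioi 0, (x + δ) ^ (-(5 / 4) : ℝ)

lemma decayConst_nonneg (hδ : 0 < δ) : 0 ≤ decayConst δ :=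
  setIntegral_nonneg measurableSet_Ioi fun x hx => by
    have : 0 < x + δ := add_pos hx hδ
    positivity

lemma norm_transformKernel_zero_le_rpow (hδ : 0 < δ) (M ω c : ℝ) (hz : 0 ≤ z) (hx : 0 < x) :
    1 / (x + δ) * ‖transformKernel δ M ω c 0 z x‖
      ≤ (z + δ) ^ (-(3 / 4) : ℝ) * (x + δ) ^ (-(5 / 4) : ℝ) := by
  have hxδ : 0 < x + δ := by positivity
  have hzδ : 0 < z + δ := by positivity
  have hxδz : 0 < x + δ + z := by positivity
  rw [norm_transformKernel M ω c 0 hxδz, zero_add, pow_one, one_div, one_div]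
  calc (x + δ)⁻¹ * (x + δ + z)⁻¹
      = (x + δ)⁻¹ * ((x + δ + z) ^ (-(1 / 4) : ℝ) * (x + δ + z) ^ (-(3 / 4) : ℝ)) := by
        rw [← Real.rpow_add hxδz, ← Real.rpow_neg_one (x + δ + z)]
        norm_num
    _ ≤ (x + δ)⁻¹ * ((x + δ) ^ (-(1 / 4) : ℝ) * (z + δ) ^ (-(3 / 4) : ℝ)) := by
        gcongr (x + δ)⁻¹ * ?_
        exact mul_le_mul (Real.rpow_le_rpow_of_nonpos hxδ (by linarith) (by norm_num))
          (Real.rpow_le_rpow_of_nonpos hzδ (by linarith) (by norm_num)) (by positivity)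
          (by positivity)
    _ = (z + δ) ^ (-(3 / 4) : ℝ) * ((x + δ) ^ (-1 : ℝ) * (x + δ) ^ (-(1 / 4) : ℝ)) := by
        rw [Real.rpow_neg_one]; ring
    _ = _ := by
        rw [← Real.rpow_add hxδ]
        norm_num

lemma norm_transformKernel_le_zero (hδ : 0 < δ) (M ω c : ℝ) (j : ℕ) (hz : 0 ≤ z) (hx : 0 < x) :
    ‖transformKernel δ M ω c j z x‖ ≤ ‖transformKernel δ M ω c 0 z x‖ / (z + δ) ^ j := by
  have hxδz : 0 < x + δ + z := by positivity
  rw [norm_transformKernel M ω c j hxδz, norm_transformKernel M ω c 0 hxδz, zero_add, pow_one,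
    pow_succ', ← div_div]
  gcongr _ / ?_ ^ _
  linarith

lemma ModeProfile.norm_transform_le (hδ : 0 < δ) (h : ModeProfile δ M ω c b f f' B W) (j : ℕ)
    (hz : 0 ≤ z) :
    ‖transform δ M ω c f j z‖ ≤ B * decayConst δ * (z + δ) ^ (-(3 / 4) : ℝ) / (z + δ) ^ j := by
  have hB := h.bound_nonneg hδ
  have hint : IntegrableOn (fun x : ℝ => (B * (z + δ) ^ (-(3 / 4) : ℝ) / (z + δ) ^ j)
      * (x + δ) ^ (-(5 / 4) : ℝ)) (Ioi 0) :=
    (integrableOn_add_rpow_Ioi_of_lt (by norm_num) (by linarith)).const_mul _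
  refine (norm_integral_le_of_norm_le hint
    ((ae_restrict_iff' measurableSet_Ioi).2 (Eventually.of_forall fun x hx => ?_))).trans_eq ?_
  · have hx : 0 < x := hx
    rw [norm_mul, norm_mul, norm_phase, one_mul]
    calc ‖f x‖ * ‖transformKernel δ M ω c j z x‖
        ≤ B / (x + δ) * (‖transformKernel δ M ω c 0 z x‖ / (z + δ) ^ j) := by
          gcongr
          exacts [h.bound x hx, norm_transformKernel_le_zero hδ M ω c j hz hx]
      _ = B / (z + δ) ^ j * (1 / (x + δ) * ‖transformKernel δ M ω c 0 z x‖) := by ring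
      _ ≤ B / (z + δ) ^ j * ((z + δ) ^ (-(3 / 4) : ℝ) * (x + δ) ^ (-(5 / 4) : ℝ)) := by
          gcongr _ * ?_
          exact norm_transformKernel_zero_le_rpow hδ M ω c hz hx
      _ = _ := by ring
  · rw [integral_const_mul, decayConst]; ring

end Transform

/-- The current of the transformed equation. Its derivative is controlled by the incoming part of
the profile, and its values at `0` and at infinity have opposite signs. -/
def current (δ M ω c : ℝ) (f : ℝ → ℂ) (z : ℝ) : ℝ :=
  ((z + δ) * (Complex.I * ω * (z - 2 * M) * transform δ M ω c f 0 z
    - z * ((1 - Complex.I * c) * transform δ M ω c f 1 z)) * star (transform δ M ω c f 0 z) : ℂ).im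

section Current

variable {δ M ω c b z : ℝ} {f f' : ℝ → ℂ} {B W : ℝ}

lemma ModeProfile.hasDerivAt_current (hδ : 0 < δ) (h : ModeProfile δ M ω c b f f' B W)
    (hz : 0 ≤ z) :
    HasDerivAt (current δ M ω c f) (transformedHeun δ M ω c b z (fun j => transform δ M ω c f j z)
      * star (transform δ M ω c f 0 z)).im z := by
  have d₀ := h.hasDerivAt_transform hδ 0 hz
  have d₁ := (h.hasDerivAt_transform hδ 1 hz).const_mul (1 - Complex.I * c)
  have dz := hasDerivAt_ofReal z
  have hflux := ((dz.add_const (δ : ℂ)).mul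
    ((((dz.sub_const (2 * M : ℂ)).const_mul (Complex.I * ω)).mul d₀).sub (dz.mul d₁))).mul d₀.star
  refine (Complex.imCLM.hasFDerivAt.comp_hasDerivAt z hflux).congr_deriv ?_
  simp only [Complex.imCLM_apply, Pi.mul_apply, Pi.sub_apply, transformedHeun]
  generalize transform δ M ω c f 0 z = F₀
  generalize transform δ M ω c f (0 + 1) z = F₁
  generalize transform δ M ω c f (1 + 1) z = F₂
  simp
  ring

lemma current_eq (δ M ω c : ℝ) (f : ℝ → ℂ) (z : ℝ) :
    current δ M ω c f z = ω * ((z + δ) * (z - 2 * M) * ‖transform δ M ω c f 0 z‖ ^ 2)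
      - ((z + δ) * (z * ((1 - Complex.I * c) * transform δ M ω c f 1 z))
        * star (transform δ M ω c f 0 z)).im := by
  rw [current, mul_sub, sub_mul, Complex.sub_im, ← Complex.normSq_eq_norm_sq,
    Complex.normSq_apply]
  congr 1
  simp
  ring

lemma current_zero (δ M ω c : ℝ) (f : ℝ → ℂ) :
    current δ M ω c f 0 = -(ω * (2 * M * δ * ‖transform δ M ω c f 0 0‖ ^ 2)) := by
  simp only [current_eq, Complex.ofReal_zero, zero_mul, mul_zero, Complex.zero_im]
  ring

lemma ModeProfile.abs_current_sub_current_zero_le (hδ : 0 < δ)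
    (h : ModeProfile δ M ω c b f f' B W) (hz : 0 ≤ z) :
    |current δ M ω c f z - current δ M ω c f 0|
      ≤ W * (B * decayConst δ * δ ^ (-(3 / 4) : ℝ)) * z := by
  have hB := h.bound_nonneg hδ
  have hκ := decayConst_nonneg hδ
  have hmvt := norm_image_sub_le_of_norm_deriv_le_segment' (f := current δ M ω c f)
    (C := W * (B * decayConst δ * δ ^ (-(3 / 4) : ℝ)))
    (fun x hx => (h.hasDerivAt_current hδ hx.1).hasDerivWithinAt) (fun x hx => ?_) z ⟨hz, le_rfl⟩
  · rwa [sub_zero] at hmvt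
  · refine (Complex.abs_im_le_norm _).trans ?_
    rw [norm_mul, norm_star]
    refine mul_le_mul (h.norm_transformedHeun_transform_le hδ hx.1) ?_ (norm_nonneg _)
      h.incoming_nonneg
    refine (h.norm_transform_le hδ 0 hx.1).trans ?_
    rw [pow_zero, div_one]
    exact mul_le_mul_of_nonneg_left
      (Real.rpow_le_rpow_of_nonpos hδ (by linarith [hx.1]) (by norm_num)) (by positivity)

lemma ModeProfile.abs_current_sub_le (hδ : 0 < δ) (h : ModeProfile δ M ω c b f f' B W)
    (hz : 0 ≤ z) :
    |current δ M ω c f z - ω * ((z + δ) * (z - 2 * M) * ‖transform δ M ω c f 0 z‖ ^ 2)|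
      ≤ ‖1 - Complex.I * c‖ * (B * decayConst δ) ^ 2 * (z + δ) ^ (-(1 / 2) : ℝ) := by
  have hB := h.bound_nonneg hδ
  have hκ := decayConst_nonneg hδ
  have hzδ : 0 < z + δ := by positivity
  have hzδ_norm : ‖(z : ℂ) + δ‖ = z + δ := by rw [← Complex.ofReal_add, norm_ofReal_of_pos hzδ]
  have hz_norm : ‖(z : ℂ)‖ ≤ z + δ := by
    rw [Complex.norm_real, Real.norm_of_nonneg hz]
    linarith
  rw [current_eq, sub_sub_cancel_left, abs_neg]
  refine (Complex.abs_im_le_norm _).trans ?_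
  rw [norm_mul, norm_mul, norm_mul, norm_mul, norm_star, hzδ_norm]
  calc _ ≤ (z + δ) * ((z + δ) * (‖1 - Complex.I * c‖ *
          (B * decayConst δ * (z + δ) ^ (-(3 / 4) : ℝ) / (z + δ) ^ 1)))
          * (B * decayConst δ * (z + δ) ^ (-(3 / 4) : ℝ) / (z + δ) ^ 0) := by
        gcongr
        exacts [h.norm_transform_le hδ 1 hz, h.norm_transform_le hδ 0 hz]
    _ = ‖1 - Complex.I * c‖ * (B * decayConst δ) ^ 2 *
          ((z + δ) ^ (1 : ℝ) * (z + δ) ^ (-(3 / 4) : ℝ) * (z + δ) ^ (-(3 / 4) : ℝ)) := by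
        rw [Real.rpow_one]
        field_simp
    _ = _ := by
        rw [← Real.rpow_add hzδ, ← Real.rpow_add hzδ]
        norm_num

lemma ModeProfile.norm_moment_zero_sq_le (hδ : 0 < δ) (hM : 0 ≤ M)
    (h : ModeProfile δ M ω c b f f' B W) (hz : 2 * M ≤ z) :
    |ω| * (2 * M * δ * ‖moment δ M ω c f 0‖ ^ 2) ≤
      ‖1 - Complex.I * c‖ * (B * decayConst δ) ^ 2 * (z + δ) ^ (-(1 / 2) : ℝ)
        + W * (B * decayConst δ * δ ^ (-(3 / 4) : ℝ)) * z := by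
  have hz0 : 0 ≤ z := by linarith
  set N₀ := 2 * M * δ * ‖moment δ M ω c f 0‖ ^ 2
  set N := (z + δ) * (z - 2 * M) * ‖transform δ M ω c f 0 z‖ ^ 2
  have hN_nonneg : 0 ≤ N :=
    mul_nonneg (mul_nonneg (by positivity) (sub_nonneg.2 hz)) (by positivity)
  have hcurrent_zero : current δ M ω c f 0 = -(ω * N₀) := by
    rw [current_zero, transform_zero_eq_moment]
  calc |ω| * N₀ ≤ |ω| * (N + N₀) := by gcongr; exact le_add_of_nonneg_left hN_nonneg
    _ = |ω * (N + N₀)| := by rw [abs_mul, abs_of_nonneg (a := N + N₀) (by positivity)]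
    _ = |(current δ M ω c f z - current δ M ω c f 0) - (current δ M ω c f z - ω * N)| := by
        rw [hcurrent_zero]
        ring_nf
    _ ≤ |current δ M ω c f z - ω * N| + |current δ M ω c f z - current δ M ω c f 0| :=
        (abs_sub _ _).trans_eq (add_comm _ _)
    _ ≤ _ := add_le_add (h.abs_current_sub_le hδ hz0) (h.abs_current_sub_current_zero_le hδ hz0)

lemma norm_one_sub_I_mul_le {K : ℝ} (hc : |c| ≤ K) : ‖1 - Complex.I * c‖ ≤ 1 + K := by
  refine (norm_sub_le _ _).trans ?_
  rw [norm_mul, Complex.norm_I, norm_one, Complex.norm_real, one_mul]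
  exact add_le_add_right hc 1

lemma exists_moment_zero_small {K e : ℝ} (hδ : 0 < δ) (hM : 0 < M) (hK : 0 < K) (B : ℝ)
    (he : 0 < e) :
    ∃ η, 0 < η ∧ ∀ ω c b W (f f' : ℝ → ℂ), ω ≠ 0 → |ω|⁻¹ ≤ K → |c| ≤ K →
      ModeProfile δ M ω c b f f' B W → W ≤ η → ‖moment δ M ω c f 0‖ ≤ e := by
  set A := (1 + K) * (B * decayConst δ) ^ 2
  set A' := |B * decayConst δ * δ ^ (-(3 / 4) : ℝ)| + 1
  set τ := K⁻¹ * (2 * M * δ * e ^ 2)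
  have hτ_pos : 0 < τ := by positivity
  have hlim : Tendsto (fun z : ℝ => A * (z + δ) ^ (-(1 / 2) : ℝ)) atTop (𝓝 0) := by
    simpa using ((tendsto_rpow_neg_atTop (by norm_num : (0 : ℝ) < 1 / 2)).comp
      (tendsto_atTop_add_const_right _ δ tendsto_id)).const_mul A
  obtain ⟨z, hz_small, hz⟩ := ((hlim.eventually (gt_mem_nhds (half_pos hτ_pos))).and
    (eventually_ge_atTop (2 * M))).exists
  have hz_pos : 0 < z := by linarith
  refine ⟨τ / (2 * A' * z), by positivity, fun ω c b W f f' hω hωK hc h hW => ?_⟩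
  have hinfinity : ‖1 - Complex.I * c‖ * (B * decayConst δ) ^ 2 * (z + δ) ^ (-(1 / 2) : ℝ)
      ≤ τ / 2 := by
    refine le_trans ?_ hz_small.le
    have : 0 < z + δ := by positivity
    gcongr ?_ * _
    exact mul_le_mul_of_nonneg_right (norm_one_sub_I_mul_le hc) (sq_nonneg _)
  have hincoming : W * (B * decayConst δ * δ ^ (-(3 / 4) : ℝ)) * z ≤ τ / 2 := by
    have hW_nonneg := h.incoming_nonneg
    have hA' : B * decayConst δ * δ ^ (-(3 / 4) : ℝ) ≤ A' :=
      (le_abs_self _).trans (le_add_of_nonneg_right zero_le_one)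
    calc _ ≤ W * A' * z := by gcongr
      _ ≤ τ / (2 * A' * z) * A' * z := by gcongr
      _ = τ / 2 := by
          have : A' ≠ 0 := by positivity
          field_simp
  have hsq : K⁻¹ * (2 * M * δ * ‖moment δ M ω c f 0‖ ^ 2) ≤ τ := by
    calc _ ≤ |ω| * (2 * M * δ * ‖moment δ M ω c f 0‖ ^ 2) := by
          gcongr
          exact inv_le_of_inv_le₀ (abs_pos.2 hω) hωK
      _ ≤ τ := by linarith [h.norm_moment_zero_sq_le hδ hM.le hz]
  have hle := le_of_mul_le_mul_left (le_of_mul_le_mul_left hsq (by positivity)) (by positivity)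
  exact (pow_le_pow_iff_left₀ (norm_nonneg _) he.le two_ne_zero).1 hle

end Current

/-! ### Pairings with continuous functions -/

/-- The test function associated with a function `φ` of the compactified variable `x / (x + δ)`. -/
def compactTestFn (δ M ω : ℝ) (φ : ℝ → ℝ) (x : ℝ) : ℂ :=
  phase (4 * M * ω * Real.log (x + δ)) * ((φ (x / (x + δ)) / (x + δ) : ℝ) : ℂ)

/-- The pairing of a profile with a function of the compactified variable. -/
def pairing (δ M ω c : ℝ) (f : ℝ → ℂ) (φ : ℝ → ℝ) : ℂ :=
  ∫ x in Ioi 0, phase (heunAngle δ M ω c x) * f x * compactTestFn δ M ω φ x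

/-- The angle of the weight of `f` in `pairing`. -/
def pairingAngle (δ ω c x : ℝ) : ℝ := 2 * ω * x - c * Real.log x + c * Real.log (x + δ)

section Pairing

variable {δ M ω c b : ℝ} {f f' : ℝ → ℂ} {B W : ℝ} {φ ψ : ℝ → ℝ}

lemma norm_compactTestFn_le {x C : ℝ} (hδ : 0 < δ) (hx : 0 < x)
    (hφ : ∀ t ∈ Icc (0 : ℝ) 1, |φ t| ≤ C) : ‖compactTestFn δ M ω φ x‖ ≤ C / (x + δ) := by
  have hxδ : 0 < x + δ := by positivity
  rw [compactTestFn, norm_mul, norm_phase, one_mul, Complex.norm_real, Real.norm_eq_abs, abs_div,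
    abs_of_pos hxδ]
  gcongr
  exact hφ _ ⟨by positivity, div_add_le_one hδ hx⟩

lemma continuousOn_comp_div_add (hδ : 0 < δ) (hφ : Continuous φ) :
    ContinuousOn (fun x => φ (x / (x + δ)) / (x + δ)) (Ioi 0) := by
  have hne : ∀ x ∈ Ioi (0 : ℝ), x + δ ≠ 0 := fun x hx => (add_pos hx hδ).ne'
  have hadd : ContinuousOn (fun x => x + δ) (Ioi 0) := by fun_prop
  exact (hφ.comp_continuousOn (continuousOn_id.div hadd hne)).div hadd hne

lemma ModeProfile.integrableOn_compactTestFn (hδ : 0 < δ) (h : ModeProfile δ M ω c b f f' B W)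
    (hφ : Continuous φ) :
    IntegrableOn (fun x => phase (heunAngle δ M ω c x) * f x * compactTestFn δ M ω φ x)
      (Ioi 0) := by
  obtain ⟨C, hC⟩ := isCompact_Icc.exists_bound_of_continuousOn (s := Icc (0 : ℝ) 1)
    hφ.continuousOn
  refine h.integrableOn_mul hδ (ContinuousOn.mul (fun x hx => ?_)
    (Complex.continuous_ofReal.comp_continuousOn (continuousOn_comp_div_add hδ hφ)))
    fun x hx => norm_compactTestFn_le hδ hx hC
  exact (hasDerivAt_phase_comp ((hasDerivAt_log_add hδ hx).const_mul
    _)).continuousAt.continuousWithinAt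

lemma ModeProfile.norm_pairing_sub_le {ε : ℝ} (hδ : 0 < δ) (h : ModeProfile δ M ω c b f f' B W)
    (hφ : Continuous φ) (hψ : Continuous ψ) (hε : ∀ t ∈ Icc (0 : ℝ) 1, |φ t - ψ t| ≤ ε) :
    ‖pairing δ M ω c f φ - pairing δ M ω c f ψ‖ ≤ ε * ∫ x in Ioi 0, B / (x + δ) ^ 2 := by
  have hB := h.bound_nonneg hδ
  rw [pairing, pairing, ← integral_sub (h.integrableOn_compactTestFn hδ hφ)
    (h.integrableOn_compactTestFn hδ hψ), ← integral_const_mul]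
  refine norm_integral_le_of_norm_le ((integrableOn_inv_sq hδ B).const_mul ε)
    ((ae_restrict_iff' measurableSet_Ioi).2 (Eventually.of_forall fun x hx => ?_))
  have hx : 0 < x := hx
  have hsub : compactTestFn δ M ω φ x - compactTestFn δ M ω ψ x
      = compactTestFn δ M ω (φ - ψ) x := by
    simp only [compactTestFn, ← mul_sub, ← Complex.ofReal_sub, ← sub_div, Pi.sub_apply]
  rw [← mul_sub, hsub, norm_mul, norm_mul, norm_phase, one_mul]
  calc ‖f x‖ * ‖compactTestFn δ M ω (φ - ψ) x‖ ≤ B / (x + δ) * (ε / (x + δ)) := by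
        gcongr
        exacts [h.bound x hx, norm_compactTestFn_le hδ hx hε]
    _ = ε * (B / (x + δ) ^ 2) := by field_simp

lemma ModeProfile.pairing_polynomial (hδ : 0 < δ) (h : ModeProfile δ M ω c b f f' B W)
    (P : Polynomial ℝ) :
    pairing δ M ω c f (fun t => P.eval t)
      = ∑ n ∈ Finset.range (P.natDegree + 1), (P.coeff n : ℂ) * moment δ M ω c f n := by
  simp_rw [moment, ← integral_const_mul]
  rw [← integral_finsetSum _ (fun n _ => (h.integrableOn_testFn hδ n).const_mul _)]
  refine setIntegral_congr_fun measurableSet_Ioi fun x hx => ?_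
  have hxδ := ofReal_add_ne_zero hδ hx
  simp only [compactTestFn, testFn, Polynomial.eval_eq_sum_range, Finset.sum_div,
    Complex.ofReal_sum, Finset.mul_sum]
  refine Finset.sum_congr rfl fun n _ => ?_
  push_cast
  rw [div_pow, pow_succ]
  field_simp

lemma exists_pairing_polynomial_small {K e : ℝ} (hδ : 0 < δ) (hM : 0 < M) (hK : 0 < K) (B : ℝ)
    (P : Polynomial ℝ) (he : 0 < e) :
    ∃ η, 0 < η ∧ ∀ ω c b W (f f' : ℝ → ℂ), ω ≠ 0 → |ω| ≤ K → |ω|⁻¹ ≤ K → |c| ≤ K → |b| ≤ K →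
      ModeProfile δ M ω c b f f' B W → W ≤ η →
      ‖pairing δ M ω c f (fun t => P.eval t)‖ ≤ e := by
  choose D hD hmoment using exists_moment_bound hδ M K
  set S := ∑ n ∈ Finset.range (P.natDegree + 1), |P.coeff n| * D n with hS
  have hS_nonneg : 0 ≤ S := Finset.sum_nonneg fun n _ => mul_nonneg (abs_nonneg _) (hD n)
  set τ := e / (2 * (S + 1))
  have hτ : 0 < τ := by positivity
  obtain ⟨η, hη, hsmall⟩ := exists_moment_zero_small hδ hM hK B hτ
  refine ⟨min η τ, lt_min hη hτ, fun ω c b W f f' hω hωK hωK' hc hb h hW => ?_⟩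
  have hτ_bound : ‖moment δ M ω c f 0‖ + W ≤ 2 * τ := by
    rw [two_mul]
    exact add_le_add (hsmall ω c b W f f' hω hωK' hc h (hW.trans (min_le_left _ _)))
      (hW.trans (min_le_right _ _))
  rw [h.pairing_polynomial hδ P]
  calc _ ≤ ∑ n ∈ Finset.range (P.natDegree + 1), |P.coeff n| * D n * (2 * τ) := by
        refine norm_sum_le_of_le _ fun n _ => ?_
        rw [norm_mul, Complex.norm_real, Real.norm_eq_abs, mul_assoc]
        have := hD n
        gcongr
        exact (hmoment n ω c b B W f f' hωK hc hb h).trans (by gcongr)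
    _ = S / (S + 1) * e := by rw [← Finset.sum_mul, ← hS]; simp only [τ]; field_simp
    _ ≤ 1 * e := by
        gcongr
        exact (div_le_one (by positivity)).2 (by linarith)
    _ = e := one_mul e

lemma exists_pairing_small {K e : ℝ} (hδ : 0 < δ) (hM : 0 < M) (hK : 0 < K) (B : ℝ)
    (hφ : Continuous φ) (he : 0 < e) :
    ∃ η, 0 < η ∧ ∀ ω c b W (f f' : ℝ → ℂ), ω ≠ 0 → |ω| ≤ K → |ω|⁻¹ ≤ K → |c| ≤ K → |b| ≤ K →
      ModeProfile δ M ω c b f f' B W → W ≤ η → ‖pairing δ M ω c f φ‖ ≤ e := by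
  set J := |∫ x in Ioi 0, B / (x + δ) ^ 2|
  obtain ⟨P, hP⟩ := exists_polynomial_near_of_continuousOn 0 1 φ hφ.continuousOn
    (e / (2 * (J + 1))) (by positivity)
  obtain ⟨η, hη, hsmall⟩ := exists_pairing_polynomial_small hδ hM hK B P (half_pos he)
  refine ⟨η, hη, fun ω c b W f f' hω hωK hωK' hc hb h hW => ?_⟩
  have hdiff := h.norm_pairing_sub_le hδ hφ P.continuous (ε := e / (2 * (J + 1)))
    fun t ht => by rw [abs_sub_comm]; exact (hP t ht).le
  have hJ : e / (2 * (J + 1)) * (∫ x in Ioi 0, B / (x + δ) ^ 2) ≤ e / 2 := by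
    calc _ ≤ e / (2 * (J + 1)) * (J + 1) := by
          gcongr
          exact (le_abs_self _).trans (le_add_of_nonneg_right zero_le_one)
      _ = e / 2 := by
          have hJ1 : J + 1 ≠ 0 := by positivity
          field_simp
  calc ‖pairing δ M ω c f φ‖
      ≤ ‖pairing δ M ω c f φ - pairing δ M ω c f (fun t => P.eval t)‖
        + ‖pairing δ M ω c f (fun t => P.eval t)‖ := norm_le_norm_sub_add _ _
    _ ≤ e / 2 + e / 2 := add_le_add (hdiff.trans hJ) (hsmall ω c b W f f' hω hωK hωK' hc hb h hW)
    _ = e := add_halves e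

/-! ### The lower bound for the incoming part -/

lemma hasDerivAt_pairingAngle {x : ℝ} (hδ : 0 < δ) (ω c : ℝ) (hx : 0 < x) :
    HasDerivAt (pairingAngle δ ω c) (2 * ω - c / x + c / (x + δ)) x :=
  ((((hasDerivAt_id x).const_mul (2 * ω)).sub ((Real.hasDerivAt_log hx.ne').const_mul c)).add
    ((hasDerivAt_log_add hδ hx).const_mul c)).congr_deriv (by ring)

lemma norm_phase_pairingAngle_sub_le {K x y : ℝ} (hδ : 0 < δ) (hω : |ω| ≤ K) (hc : |c| ≤ K)
    (hy : 0 < y) (hyx : y ≤ x) :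
    ‖phase (pairingAngle δ ω c x) - phase (pairingAngle δ ω c y)‖
      ≤ (2 * K + 2 * K / y) * (x - y) := by
  have hK : 0 ≤ K := (abs_nonneg _).trans hω
  refine norm_image_sub_le_of_norm_deriv_le_segment'
    (f := fun t => phase (pairingAngle δ ω c t)) (b := x) (fun t ht => (hasDerivAt_phase_comp
      (hasDerivAt_pairingAngle hδ ω c (hy.trans_le ht.1))).hasDerivWithinAt)
    (fun t ht => ?_) x ⟨hyx, le_rfl⟩
  have ht_pos : 0 < t := hy.trans_le ht.1
  have hyt : y ≤ t + δ := by linarith [ht.1]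
  rw [norm_mul, norm_mul, Complex.norm_I, norm_phase, one_mul, mul_one, Complex.norm_real,
    Real.norm_eq_abs]
  calc |2 * ω - c / t + c / (t + δ)| ≤ |2 * ω| + |c / t| + |c / (t + δ)| :=
        (abs_add_le _ _).trans (add_le_add_left (abs_sub _ _) _)
    _ = 2 * |ω| + |c| / t + |c| / (t + δ) := by
        rw [abs_mul, abs_two, abs_div, abs_div, abs_of_pos ht_pos,
          abs_of_pos (by positivity : 0 < t + δ)]
    _ ≤ 2 * K + K / y + K / y := by
        have := ht.1
        gcongr
    _ = 2 * K + 2 * K / y := by ring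

lemma phase_heunAngle_mul_compactTestFn (δ M ω c : ℝ) (f : ℝ → ℂ) (φ : ℝ → ℝ) (x : ℝ) :
    phase (heunAngle δ M ω c x) * f x * compactTestFn δ M ω φ x
      = phase (pairingAngle δ ω c x) * f x * ((φ (x / (x + δ)) / (x + δ) : ℝ) : ℂ) := by
  have hangle : phase (pairingAngle δ ω c x)
      = phase (heunAngle δ M ω c x) * phase (4 * M * ω * Real.log (x + δ)) := by
    rw [← phase_add, pairingAngle, heunAngle]
    ring_nf
  rw [compactTestFn, hangle]
  ring

lemma norm_phase_mul_sub_le {K x y : ℝ} {f₀ : ℂ} (hδ : 0 < δ) (hω : |ω| ≤ K) (hc : |c| ≤ K)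
    (hy : 0 < y) (hyx : y ≤ x) :
    ‖phase (pairingAngle δ ω c x) * f x - phase (pairingAngle δ ω c y) * f₀‖
      ≤ ‖f x - f₀‖ + (2 * K + 2 * K / y) * (x - y) * ‖f₀‖ := by
  calc _ = ‖phase (pairingAngle δ ω c x) * (f x - f₀)
        + (phase (pairingAngle δ ω c x) - phase (pairingAngle δ ω c y)) * f₀‖ := by ring_nf
    _ ≤ ‖f x - f₀‖
        + ‖phase (pairingAngle δ ω c x) - phase (pairingAngle δ ω c y)‖ * ‖f₀‖ := by
        refine (norm_add_le _ _).trans_eq ?_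
        rw [norm_mul, norm_mul, norm_phase, one_mul]
    _ ≤ _ := by
        gcongr
        exact norm_phase_pairingAngle_sub_le hδ hω hc hy hyx

lemma mul_integral_le_norm_integral_mul {α : Type*} [MeasurableSpace α] {μ : Measure α}
    {h : α → ℂ} {g : α → ℝ} {h₀ : ℂ} {θ : ℝ} (hg : Integrable g μ) (hg_nonneg : 0 ≤ᵐ[μ] g)
    (hhg : Integrable (fun x => h x * (g x : ℂ)) μ)
    (hθ : ∀ᵐ x ∂μ, g x ≠ 0 → ‖h x - h₀‖ ≤ θ) :
    (‖h₀‖ - θ) * ∫ x, g x ∂μ ≤ ‖∫ x, h x * (g x : ℂ) ∂μ‖ := by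
  have hconst : ∫ x, h₀ * (g x : ℂ) ∂μ = h₀ * (∫ x, g x ∂μ : ℝ) := by
    rw [integral_const_mul, integral_complex_ofReal]
  have hdiff : ‖∫ x, h x * (g x : ℂ) ∂μ - h₀ * (∫ x, g x ∂μ : ℝ)‖ ≤ θ * ∫ x, g x ∂μ := by
    have hint : Integrable (fun x => h₀ * (g x : ℂ)) μ := hg.ofReal.const_mul h₀
    rw [← hconst, ← integral_sub hhg hint, ← integral_const_mul]
    refine norm_integral_le_of_norm_le (hg.const_mul θ) ?_
    filter_upwards [hg_nonneg, hθ] with x hx hxθ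
    rw [← sub_mul, norm_mul, Complex.norm_real, Real.norm_of_nonneg hx]
    by_cases hgx : g x = 0
    · simp [hgx]
    · exact mul_le_mul_of_nonneg_right (hxθ hgx) hx
  have hnorm : ‖h₀ * (∫ x, g x ∂μ : ℝ)‖ = ‖h₀‖ * ∫ x, g x ∂μ := by
    rw [norm_mul, Complex.norm_real, Real.norm_of_nonneg (integral_nonneg_of_ae hg_nonneg)]
  linarith [norm_sub_norm_le (h₀ * (∫ x, g x ∂μ : ℝ)) (∫ x, h x * (g x : ℂ) ∂μ),
    norm_sub_rev (h₀ * (∫ x, g x ∂μ : ℝ)) (∫ x, h x * (g x : ℂ) ∂μ)]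

lemma div_add_lt_div_add {x y : ℝ} (hδ : 0 < δ) (hx : 0 < x) (hy : 0 < y) :
    x / (x + δ) < y / (y + δ) ↔ x < y := by
  rw [div_lt_div_iff₀ (by positivity) (by positivity), mul_add, mul_add, mul_comm y x,
    add_lt_add_iff_left, mul_lt_mul_iff_left₀ hδ]

lemma exists_compact_bump {x₁ x₂ : ℝ} (hδ : 0 < δ) (hx₁ : 0 < x₁) (hx₁₂ : x₁ < x₂) :
    ∃ φ : ℝ → ℝ, Continuous φ ∧ (∀ t, 0 ≤ φ t) ∧
      ∀ x, 0 < x → (φ (x / (x + δ)) ≠ 0 ↔ x ∈ Ioo x₁ x₂) := by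
  have hx₂ : 0 < x₂ := hx₁.trans hx₁₂
  set v₁ := x₁ / (x₁ + δ)
  set v₂ := x₂ / (x₂ + δ)
  have hv : v₁ < v₂ := (div_add_lt_div_add hδ hx₁ hx₂).2 hx₁₂
  let φ : ContDiffBump ((v₁ + v₂) / 2) := ⟨(v₂ - v₁) / 4, (v₂ - v₁) / 2, by linarith, by linarith⟩
  refine ⟨φ, φ.continuous, fun t => φ.nonneg, fun x hx => ?_⟩
  rw [← Function.mem_support, φ.support_eq, Real.ball_eq_Ioo]
  have hleft : (v₁ + v₂) / 2 - φ.rOut = v₁ := by simp only [φ]; ring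
  have hright : (v₁ + v₂) / 2 + φ.rOut = v₂ := by simp only [φ]; ring
  rw [hleft, hright, mem_Ioo, mem_Ioo, div_add_lt_div_add hδ hx₁ hx, div_add_lt_div_add hδ hx hx₂]

lemma integrableOn_compact_bump {x₁ x₂ : ℝ} (hδ : 0 < δ) (hx₁ : 0 < x₁) (hφ : Continuous φ)
    (hsupp : ∀ x, 0 < x → (φ (x / (x + δ)) ≠ 0 ↔ x ∈ Ioo x₁ x₂)) :
    IntegrableOn (fun x => φ (x / (x + δ)) / (x + δ)) (Ioi 0) := by
  have hcont : ContinuousOn (fun x => φ (x / (x + δ)) / (x + δ)) (Icc x₁ x₂) :=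
    (continuousOn_comp_div_add hδ hφ).mono fun x hx => hx₁.trans_le hx.1
  refine hcont.integrableOn_Icc.of_forall_sdiff_eq_zero measurableSet_Ioi fun x hx => ?_
  have hzero : φ (x / (x + δ)) = 0 := by
    by_contra hne
    exact hx.2 (Ioo_subset_Icc_self ((hsupp x hx.1).1 hne))
  rw [hzero, zero_div]

lemma integral_compact_bump_pos {x₁ x₂ : ℝ} (hδ : 0 < δ) (hx₁ : 0 < x₁) (hx₁₂ : x₁ < x₂)
    (hφ : Continuous φ) (hφ_nonneg : ∀ t, 0 ≤ φ t)
    (hsupp : ∀ x, 0 < x → (φ (x / (x + δ)) ≠ 0 ↔ x ∈ Ioo x₁ x₂)) :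
    0 < ∫ x in Ioi 0, φ (x / (x + δ)) / (x + δ) := by
  rw [setIntegral_pos_iff_support_of_nonneg_ae
    ((ae_restrict_iff' measurableSet_Ioi).2 (Eventually.of_forall fun x hx =>
      div_nonneg (hφ_nonneg _) (add_pos hx hδ).le)) (integrableOn_compact_bump hδ hx₁ hφ hsupp)]
  refine lt_of_lt_of_le ?_ (measure_mono (s := Ioo x₁ x₂) fun x hx => ?_)
  · simpa using hx₁₂
  · have hx_pos : 0 < x := hx₁.trans hx.1
    exact ⟨div_ne_zero ((hsupp x hx_pos).2 hx) (add_pos hx_pos hδ).ne', hx_pos⟩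

lemma ModeProfile.mul_integral_le_norm_pairing {x₁ x₂ θ : ℝ} {f₀ : ℂ} (hδ : 0 < δ)
    (h : ModeProfile δ M ω c b f f' B W) (hx₁ : 0 < x₁) (hφ : Continuous φ)
    (hφ_nonneg : ∀ t, 0 ≤ φ t) (hsupp : ∀ x, 0 < x → (φ (x / (x + δ)) ≠ 0 ↔ x ∈ Ioo x₁ x₂))
    (hnear : ∀ x ∈ Ioo x₁ x₂, ‖phase (pairingAngle δ ω c x) * f x
      - phase (pairingAngle δ ω c x₁) * f₀‖ ≤ θ) :
    (‖f₀‖ - θ) * ∫ x in Ioi 0, φ (x / (x + δ)) / (x + δ) ≤ ‖pairing δ M ω c f φ‖ := by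
  have hint := h.integrableOn_compactTestFn hδ hφ
  simp only [phase_heunAngle_mul_compactTestFn] at hint
  have hlower := mul_integral_le_norm_integral_mul (integrableOn_compact_bump hδ hx₁ hφ hsupp)
    ((ae_restrict_iff' measurableSet_Ioi).2 (Eventually.of_forall fun x hx =>
      div_nonneg (hφ_nonneg _) (add_pos hx hδ).le)) hint
    ((ae_restrict_iff' measurableSet_Ioi).2 (Eventually.of_forall fun x hx hne =>
      hnear x ((hsupp x hx).1 (div_ne_zero_iff.1 hne).1)))
  rw [norm_mul, norm_phase, one_mul] at hlower
  simpa only [pairing, phase_heunAngle_mul_compactTestFn] using hlower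

theorem exists_incoming_lower_bound {K c₀ x₀ : ℝ} (hδ : 0 < δ) (hM : 0 < M) (hK : 0 < K) (B : ℝ)
    (hc₀ : 0 < c₀) (hx₀ : 0 < x₀) :
    ∃ η, 0 < η ∧ ∀ ω c b W (f f' : ℝ → ℂ) (f₀ : ℂ), ω ≠ 0 → |ω| ≤ K → |ω|⁻¹ ≤ K → |c| ≤ K →
      |b| ≤ K → ModeProfile δ M ω c b f f' B W → ‖f₀‖ = c₀ →
      (∀ x, 0 < x → x ≤ x₀ → ‖f x - f₀‖ ≤ c₀ / 8) → η < W := by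
  set x₁ := x₀ / 2 with hx₁
  have hx₁_pos : 0 < x₁ := by positivity
  set T := 2 * K + 2 * K / x₁
  have hT_pos : 0 < T := by positivity
  set x₂ := min x₀ (x₁ + 1 / (2 * T))
  have hx₁₂ : x₁ < x₂ := lt_min (hx₁ ▸ half_lt_self hx₀) (lt_add_of_pos_right _ (by positivity))
  obtain ⟨φ, hφ, hφ_nonneg, hsupp⟩ := exists_compact_bump hδ hx₁_pos hx₁₂
  have hmass := integral_compact_bump_pos hδ hx₁_pos hx₁₂ hφ hφ_nonneg hsupp
  set H := ∫ x in Ioi 0, φ (x / (x + δ)) / (x + δ)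
  obtain ⟨η, hη, hsmall⟩ := exists_pairing_small hδ hM hK B hφ (e := c₀ * H / 4) (by positivity)
  refine ⟨η, hη, fun ω c b W f f' f₀ hω hωK hωK' hc hb h hf₀ hf => ?_⟩
  by_contra! hW
  have hupper := hsmall ω c b W f f' hω hωK hωK' hc hb h hW
  have hnear : ∀ x ∈ Ioo x₁ x₂, ‖phase (pairingAngle δ ω c x) * f x
      - phase (pairingAngle δ ω c x₁) * f₀‖ ≤ c₀ / 8 + 1 / 2 * c₀ := fun x hx => by
    have hTx : T * (x - x₁) ≤ 1 / 2 := by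
      have : x - x₁ ≤ 1 / (2 * T) := by linarith [hx.2.le.trans (min_le_right _ _)]
      calc T * (x - x₁) ≤ T * (1 / (2 * T)) := by gcongr
        _ = 1 / 2 := by field_simp
    refine (norm_phase_mul_sub_le hδ hωK hc hx₁_pos hx.1.le).trans ?_
    rw [hf₀]
    exact add_le_add (hf x (hx₁_pos.trans hx.1) (hx.2.le.trans (min_le_left _ _))) (by gcongr)
  have hlower := h.mul_integral_le_norm_pairing hδ hx₁_pos hφ hφ_nonneg hsupp hnear
  rw [hf₀] at hlower
  linarith [mul_pos hc₀ hmass]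

end Pairing

/-! ### Behaviour near the horizon -/

section NearHorizon

variable {δ M ω c b κ x₀ : ℝ} {f f' : ℝ → ℂ} {f₀ : ℂ}

lemma norm_sub_limit_le {E : Type*} [NormedAddCommGroup E] [NormedSpace ℝ E] {g g' : ℝ → E}
    {g₀ : E} {C a x : ℝ} (hx : a < x) (hg : ∀ t, a < t → t ≤ x → HasDerivAt g (g' t) t)
    (hC : ∀ t, a < t → t ≤ x → ‖g' t‖ ≤ C) (hlim : Tendsto g (𝓝[>] a) (𝓝 g₀)) :
    ‖g x - g₀‖ ≤ C * (x - a) := by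
  have hC0 : 0 ≤ C := (norm_nonneg _).trans (hC x hx le_rfl)
  refine le_of_tendsto (tendsto_const_nhds.sub hlim).norm ?_
  filter_upwards [Ioc_mem_nhdsGT hx] with e he
  calc ‖g x - g e‖ ≤ C * (x - e) := norm_image_sub_le_of_norm_deriv_le_segment'
        (fun t ht => (hg t (he.1.trans_le ht.1) ht.2).hasDerivWithinAt)
        (fun t ht => hC t (he.1.trans_le ht.1) ht.2.le) x ⟨he.2, le_rfl⟩
    _ ≤ C * (x - a) := by
        gcongr
        exact he.1.le

lemma exists_norm_le_of_tendsto_nhdsGT {E : Type*} [NormedAddCommGroup E] {g : ℝ → E} {g₀ : E}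
    {a x₀ : ℝ} (hx₀ : a < x₀) (hg : ContinuousOn g (Ioc a x₀))
    (hlim : Tendsto g (𝓝[>] a) (𝓝 g₀)) :
    ∃ S, (∀ x ∈ Ioc a x₀, ‖g x‖ ≤ S) ∧ (S = ‖g₀‖ ∨ ∃ x ∈ Ioc a x₀, S = ‖g x‖) := by
  have hcont : ContinuousOn (Function.update g a g₀) (Icc a x₀) :=
    continuousOn_update_iff.2 ⟨by rwa [Icc_sdiff_left], fun _ =>
      hlim.mono_left (nhdsWithin_mono _ fun t ht => lt_of_le_of_ne ht.1.1 (Ne.symm ht.2))⟩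
  obtain ⟨t, ht, hmax⟩ := isCompact_Icc.exists_isMaxOn ⟨a, left_mem_Icc.2 hx₀.le⟩ hcont.norm
  refine ⟨‖Function.update g a g₀ t‖, fun x hx => ?_, ?_⟩
  · have hle : ‖Function.update g a g₀ x‖ ≤ _ := hmax (Ioc_subset_Icc_self hx)
    rwa [Function.update_of_ne hx.1.ne'] at hle
  · rcases ht.1.eq_or_lt with rfl | hat
    · exact .inl (by rw [Function.update_self])
    · exact .inr ⟨t, ⟨hat, ht.2⟩, by rw [Function.update_of_ne hat.ne']⟩

lemma RegularHeunSolution.hasDerivAt_weightedFlux (hδ : 0 < δ)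
    (h : RegularHeunSolution δ M ω c b f f') {x : ℝ} (hx : 0 < x) :
    HasDerivAt (fun y => phase (heunAngle δ M ω c y) * (((y * (y + δ) : ℝ) : ℂ) * f' y))
      (-(phase (heunAngle δ M ω c x) * (heunPotential δ M ω b x * f x))) x := by
  have hx0 : (x : ℂ) ≠ 0 := by exact_mod_cast hx.ne'
  have hxδ := ofReal_add_ne_zero hδ hx
  refine ((hasDerivAt_phase_comp (hasDerivAt_heunAngle M ω c hδ hx)).mul
    (h.ode x hx)).congr_deriv ?_
  push_cast
  field_simp
  ring

lemma RegularHeunSolution.tendsto_weightedFlux (h : RegularHeunSolution δ M ω c b f f') :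
    Tendsto (fun y => phase (heunAngle δ M ω c y) * (((y * (y + δ) : ℝ) : ℂ) * f' y))
      (𝓝[>] 0) (𝓝 0) := by
  have hlim : Tendsto (fun x : ℝ => ((x + δ : ℝ) : ℂ) * (x * f' x)) (𝓝[>] 0) (𝓝 0) := by
    have hcont : ContinuousAt (fun x : ℝ => ((x + δ : ℝ) : ℂ)) 0 := by fun_prop
    simpa using (hcont.tendsto.mono_left nhdsWithin_le_nhds).mul h.at_zero
  refine squeeze_zero_norm (fun x => le_of_eq ?_) (tendsto_zero_iff_norm_tendsto_zero.1 hlim)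
  rw [norm_mul, norm_phase, one_mul]
  push_cast
  ring_nf

lemma RegularHeunSolution.norm_deriv_le (hδ : 0 < δ) (h : RegularHeunSolution δ M ω c b f f')
    {S : ℝ} (hκ : ∀ x, 0 < x → x ≤ x₀ → ‖heunPotential δ M ω b x‖ ≤ κ)
    (hS : ∀ x, 0 < x → x ≤ x₀ → ‖f x‖ ≤ S) {x : ℝ} (hx : 0 < x) (hxx : x ≤ x₀) :
    ‖f' x‖ ≤ κ * S / δ := by
  have hκ0 : 0 ≤ κ := (norm_nonneg _).trans (hκ x hx hxx)
  have hflux := norm_sub_limit_le (C := κ * S) hx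
    (fun t ht _ => h.hasDerivAt_weightedFlux hδ ht) (fun t ht htx => by
      rw [norm_neg, norm_mul, norm_phase, one_mul, norm_mul]
      exact mul_le_mul (hκ t ht (htx.trans hxx)) (hS t ht (htx.trans hxx)) (norm_nonneg _) hκ0)
    h.tendsto_weightedFlux
  rw [sub_zero, sub_zero, norm_mul, norm_phase, one_mul, norm_mul,
    norm_ofReal_of_pos (by positivity)] at hflux
  have hle : (x + δ) * ‖f' x‖ ≤ κ * S := le_of_mul_le_mul_left (by linarith) hx
  rw [le_div_iff₀ hδ]
  nlinarith [norm_nonneg (f' x)]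

lemma RegularHeunSolution.near_horizon (hδ : 0 < δ) (hx₀ : 0 < x₀)
    (h : RegularHeunSolution δ M ω c b f f') (hlim : Tendsto f (𝓝[>] 0) (𝓝 f₀))
    (hκ : ∀ x, 0 < x → x ≤ x₀ → ‖heunPotential δ M ω b x‖ ≤ κ) (hκx : κ * x₀ ≤ δ / 16)
    {x : ℝ} (hx : 0 < x) (hxx : x ≤ x₀) :
    ‖f x - f₀‖ ≤ ‖f₀‖ / 8 ∧ ‖f' x‖ ≤ 2 * κ / δ * ‖f₀‖ := by
  have hκ0 : 0 ≤ κ := (norm_nonneg _).trans (hκ x hx hxx)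
  obtain ⟨S, hfS, hS⟩ := exists_norm_le_of_tendsto_nhdsGT hx₀
    (h.continuousOn.mono fun t ht => ht.1) hlim
  have hS0 : 0 ≤ S := (norm_nonneg _).trans (hfS x ⟨hx, hxx⟩)
  have hf' : ∀ t, 0 < t → t ≤ x₀ → ‖f' t‖ ≤ κ * S / δ := fun t ht htx =>
    h.norm_deriv_le hδ hκ (fun s hs hsx => hfS s ⟨hs, hsx⟩) ht htx
  have hf : ∀ t, 0 < t → t ≤ x₀ → ‖f t - f₀‖ ≤ S / 16 := fun t ht htx => by
    calc ‖f t - f₀‖ ≤ κ * S / δ * (t - 0) :=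
          norm_sub_limit_le ht (fun s hs _ => h.hasDerivAt s hs)
            (fun s hs hst => hf' s hs (hst.trans htx)) hlim
      _ ≤ κ * S / δ * x₀ := by
          gcongr
          rwa [sub_zero]
      _ = κ * x₀ * (S / δ) := by ring
      _ ≤ δ / 16 * (S / δ) := by gcongr
      _ = S / 16 := by field_simp
  have hS_le : S ≤ 2 * ‖f₀‖ := by
    rcases hS with rfl | ⟨t, ht, rfl⟩
    · linarith
    · linarith [hf t ht.1 ht.2, norm_sub_norm_le (f t) f₀]
  refine ⟨by linarith [hf x hx hxx], (hf' x hx hxx).trans ?_⟩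
  calc κ * S / δ ≤ κ * (2 * ‖f₀‖) / δ := by gcongr
    _ = 2 * κ / δ * ‖f₀‖ := by ring

end NearHorizon

/-! ### The separated radial equation -/

/-- The separated radial equation
`(x (x + δ) R')' + (drift² / (4 x (x + δ)) + 8 M ω² x + b) R = 0`, which is the self-adjoint form of
the confluent Heun equation, written as a system for `R` and `F = x (x + δ) R'`. -/
structure RadialSystem (δ M ω c b : ℝ) (R F : ℝ → ℂ) : Prop where
  deriv_fst : ∀ x, 0 < x → HasDerivAt R (F x / ((x * (x + δ) : ℝ) : ℂ)) x
  deriv_snd : ∀ x, 0 < x → HasDerivAt F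
    (-(((heunDrift δ M ω c x / 2) ^ 2 / (x * (x + δ)) + 8 * M * ω ^ 2 * x + b : ℝ) * R x)) x

/-- The unimodular factor turning solutions of the separated radial equation into solutions of the
confluent Heun equation. -/
def radialPhase (δ M ω c x : ℝ) : ℂ := phase (-(heunAngle δ M ω c x / 2))

lemma norm_radialPhase (δ M ω c x : ℝ) : ‖radialPhase δ M ω c x‖ = 1 := norm_phase _

lemma hasDerivAt_radialPhase {δ x : ℝ} (M ω c : ℝ) (hδ : 0 < δ) (hx : 0 < x) :
    HasDerivAt (radialPhase δ M ω c)
      (-(Complex.I * (heunDrift δ M ω c x / 2 / (x * (x + δ)) : ℝ) * radialPhase δ M ω c x)) x := by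
  refine (hasDerivAt_phase_comp
    ((hasDerivAt_heunAngle M ω c hδ hx).div_const 2).fun_neg).congr_deriv ?_
  rw [radialPhase]
  push_cast
  ring

/-- The solution of the confluent Heun equation determined by a solution `R` of the separated
radial equation. -/
def heunProfile (δ M ω c : ℝ) (R : ℝ → ℂ) (x : ℝ) : ℂ := radialPhase δ M ω c x * R x

/-- `x (x + δ)` times the derivative of `heunProfile`. -/
def heunFlux (δ M ω c : ℝ) (R F : ℝ → ℂ) (x : ℝ) : ℂ :=
  radialPhase δ M ω c x * (F x - Complex.I * (heunDrift δ M ω c x / 2 : ℝ) * R x)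

section RadialSystem

variable {δ M ω c b x : ℝ} {R F : ℝ → ℂ}

lemma hasDerivAt_heunDrift (δ M ω c x : ℝ) :
    HasDerivAt (heunDrift δ M ω c) (2 * ω * (2 * x + δ - 2 * M)) x := by
  have h := ((((hasDerivAt_id x).const_mul ω).mul ((hasDerivAt_id x).add_const δ)).sub
    ((hasDerivAt_id x).const_mul (2 * M * ω))).sub_const (c * δ / 2)
  refine (h.const_mul 2).congr_deriv ?_
  simp only [id]
  ring

lemma RadialSystem.hasDerivAt_heunProfile (hδ : 0 < δ) (h : RadialSystem δ M ω c b R F)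
    (hx : 0 < x) :
    HasDerivAt (heunProfile δ M ω c R) (heunFlux δ M ω c R F x / ((x * (x + δ) : ℝ) : ℂ)) x := by
  refine ((hasDerivAt_radialPhase M ω c hδ hx).mul (h.deriv_fst x hx)).congr_deriv ?_
  rw [heunFlux]
  push_cast
  ring

lemma RadialSystem.hasDerivAt_heunFlux (hδ : 0 < δ) (h : RadialSystem δ M ω c b R F)
    (hx : 0 < x) :
    HasDerivAt (heunFlux δ M ω c R F)
      (-(Complex.I * heunDrift δ M ω c x * (heunFlux δ M ω c R F x / ((x * (x + δ) : ℝ) : ℂ)))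
        - heunPotential δ M ω b x * heunProfile δ M ω c R x) x := by
  have hx0 : (x : ℂ) ≠ 0 := by exact_mod_cast hx.ne'
  have hxδ := ofReal_add_ne_zero hδ hx
  have hdrift := ((hasDerivAt_heunDrift δ M ω c x).div_const 2).ofReal_comp.const_mul Complex.I
  refine ((hasDerivAt_radialPhase M ω c hδ hx).mul ((h.deriv_snd x hx).sub
    (hdrift.mul (h.deriv_fst x hx)))).congr_deriv ?_
  simp only [heunFlux, heunProfile, heunPotential, Pi.sub_apply, Pi.mul_apply]
  push_cast
  field_simp
  ring_nf
  rw [Complex.I_sq]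
  ring

end RadialSystem

/-! ### Kerr–Newman geometry in the variable `x = r - r₊` -/

/-- The distance `r₊ - r₋` between the horizons. -/
def gap (a Q M : ℝ) : ℝ := rPlus a Q M - rMinus a Q M

/-- The value at the horizon of `(r² + a²) ω - a m`. -/
def horizonFreq (a Q M ω : ℝ) (m : ℤ) : ℝ := ω * (rPlus a Q M ^ 2 + a ^ 2) - a * m

/-- The parameter `c` of the Heun equation of a mode; the horizon exponent is `-i c / 2`. -/
def horizonExponent (a Q M ω : ℝ) (m : ℤ) : ℝ := 2 * horizonFreq a Q M ω m / gap a Q M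

/-- The accessory parameter `b` of the Heun equation of a mode. -/
def accessory (a Q M ω : ℝ) (m : ℤ) (lam : ℝ) : ℝ :=
  4 * ω * horizonFreq a Q M ω m - lam - a ^ 2 * ω ^ 2 + 2 * a * m * ω

/-- `dr*/dr` at `r = r₊ + x`. -/
def tortoiseDeriv (a Q M x : ℝ) : ℝ := ((rPlus a Q M + x) ^ 2 + a ^ 2) / (x * (x + gap a Q M))

/-- `√(r² + a²)` at `r = r₊ + x`. -/
def areaRadius (a Q M x : ℝ) : ℝ := √((rPlus a Q M + x) ^ 2 + a ^ 2)

section Geometry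

variable {a Q M x : ℝ}

lemma gap_pos (h : Subextremal a Q M) : 0 < gap a Q M := by
  have : 0 < √(M ^ 2 - a ^ 2 - Q ^ 2) := Real.sqrt_pos.2 (by linarith [h.2])
  simp only [gap, rPlus, rMinus]
  linarith

lemma gap_eq (a Q M : ℝ) : gap a Q M = 2 * (rPlus a Q M - M) := by
  simp only [gap, rPlus, rMinus]
  ring

lemma mass_le_rPlus (a Q M : ℝ) : M ≤ rPlus a Q M :=
  le_add_of_nonneg_right (Real.sqrt_nonneg _)

lemma rPlus_pos (h : Subextremal a Q M) : 0 < rPlus a Q M :=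
  h.1.trans_le (mass_le_rPlus a Q M)

lemma gap_le_rPlus (h : Subextremal a Q M) : gap a Q M ≤ rPlus a Q M := by
  have : √(M ^ 2 - a ^ 2 - Q ^ 2) ≤ M := by
    rw [Real.sqrt_le_left h.1.le]
    nlinarith [sq_nonneg a, sq_nonneg Q]
  simp only [gap, rPlus, rMinus]
  linarith

lemma Delta_rPlus (h : Subextremal a Q M) : Delta a Q M (rPlus a Q M) = 0 := by
  have := Real.sq_sqrt (show 0 ≤ M ^ 2 - a ^ 2 - Q ^ 2 by linarith [h.2])
  simp only [Delta, rPlus]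
  linear_combination this

lemma Delta_rPlus_add (h : Subextremal a Q M) (x : ℝ) :
    Delta a Q M (rPlus a Q M + x) = x * (x + gap a Q M) := by
  have hroot := Delta_rPlus h
  rw [gap_eq]
  simp only [Delta] at hroot ⊢
  linear_combination hroot

lemma tortoiseDeriv_pos (h : Subextremal a Q M) (hx : 0 < x) : 0 < tortoiseDeriv a Q M x := by
  have := gap_pos h
  have := rPlus_pos h
  unfold tortoiseDeriv
  positivity

lemma areaRadius_sq (a Q M x : ℝ) :
    areaRadius a Q M x ^ 2 = (rPlus a Q M + x) ^ 2 + a ^ 2 := Real.sq_sqrt (by positivity)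

lemma areaRadius_pos (h : Subextremal a Q M) (hx : 0 ≤ x) : 0 < areaRadius a Q M x := by
  have := rPlus_pos h
  exact Real.sqrt_pos.2 (by positivity)

lemma hasDerivAt_areaRadius (h : Subextremal a Q M) (hx : 0 ≤ x) :
    HasDerivAt (areaRadius a Q M) ((rPlus a Q M + x) / areaRadius a Q M x) x := by
  have hr := rPlus_pos h
  have hd : HasDerivAt (fun y => (rPlus a Q M + y) ^ 2 + a ^ 2) (2 * (rPlus a Q M + x)) x := by
    simpa using (((hasDerivAt_id x).const_add (rPlus a Q M)).pow 2).add_const (a ^ 2)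
  refine (hd.sqrt (by positivity)).congr_deriv ?_
  rw [areaRadius]
  field_simp

lemma horizonExponent_mul_gap (h : Subextremal a Q M) (ω : ℝ) (m : ℤ) :
    horizonExponent a Q M ω m * gap a Q M = 2 * horizonFreq a Q M ω m :=
  div_mul_cancel₀ _ (gap_pos h).ne'

lemma xi_eq (h : Subextremal a Q M) (ω : ℝ) (m : ℤ) :
    xi a Q M ω m = Complex.I * ((-(horizonExponent a Q M ω m / 2) : ℝ) : ℂ) := by
  have hroot := Delta_rPlus h
  have hgap : rPlus a Q M - rMinus a Q M ≠ 0 := (gap_pos h).ne'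
  rw [xi]
  congr 2
  simp only [horizonExponent, horizonFreq, gap]
  simp only [Delta] at hroot
  field_simp
  linear_combination ω * hroot

lemma heunDrift_horizonExponent (h : Subextremal a Q M) (ω : ℝ) (m : ℤ) (x : ℝ) :
    heunDrift (gap a Q M) M ω (horizonExponent a Q M ω m) x
      = 2 * (ω * x * (x + gap a Q M) - 2 * M * ω * x - horizonFreq a Q M ω m) := by
  rw [heunDrift, horizonExponent_mul_gap h]
  ring

lemma potential_eq (h : Subextremal a Q M) (ω : ℝ) (m : ℤ) (lam : ℝ) (hx : 0 < x) :
    ((rPlus a Q M + x) ^ 2 + a ^ 2) ^ 2 * (ω ^ 2 - potential a Q M ω m lam (rPlus a Q M + x))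
      = x * (x + gap a Q M) * (accessory a Q M ω m lam + 8 * M * ω ^ 2 * x)
        + (heunDrift (gap a Q M) M ω (horizonExponent a Q M ω m) x / 2) ^ 2
        - x * (x + gap a Q M) * (2 * (rPlus a Q M + x) ^ 2 + x * (x + gap a Q M)
            - 2 * M * (rPlus a Q M + x)) / ((rPlus a Q M + x) ^ 2 + a ^ 2)
        + 3 * (x * (x + gap a Q M)) ^ 2 * (rPlus a Q M + x) ^ 2
            / ((rPlus a Q M + x) ^ 2 + a ^ 2) ^ 2 := by
  have hr := rPlus_pos h
  have hn : (rPlus a Q M + x) ^ 2 + a ^ 2 ≠ 0 := by positivity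
  simp only [potential, Delta_rPlus_add h, accessory, horizonFreq, heunDrift_horizonExponent h]
  rw [gap_eq]
  generalize rPlus a Q M = r at hn
  field_simp
  ring

end Geometry

/-! ### From the Carter equation to the confluent Heun equation -/

/-- The Carter equation as a system for `v = u` and `y = u'` in the variable `x = r - r₊`. -/
structure CarterSystem (a Q M ω : ℝ) (m : ℤ) (lam : ℝ) (v y : ℝ → ℂ) : Prop where
  deriv_fst : ∀ x, 0 < x → HasDerivAt v (tortoiseDeriv a Q M x * y x) x
  deriv_snd : ∀ x, 0 < x → HasDerivAt y (-(tortoiseDeriv a Q M x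
    * ((ω ^ 2 - potential a Q M ω m lam (rPlus a Q M + x) : ℝ) * v x))) x

/-- The logarithmic derivative of `areaRadius` in the tortoise coordinate, as a function of
`x = r - r₊`. -/
def areaRadiusLogDeriv (a Q M x : ℝ) : ℝ :=
  x * (x + gap a Q M) * (rPlus a Q M + x) / ((rPlus a Q M + x) ^ 2 + a ^ 2) ^ 2

/-- The radial function `R = u / √(r² + a²)`. -/
def radialFunction (a Q M : ℝ) (v : ℝ → ℂ) (x : ℝ) : ℂ := v x / areaRadius a Q M x

/-- `Δ dR/dr` for the radial function `R`. -/
def radialFlux (a Q M : ℝ) (v y : ℝ → ℂ) (x : ℝ) : ℂ :=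
  areaRadius a Q M x * (y x - areaRadiusLogDeriv a Q M x * v x)

section Carter

variable {a Q M ω lam x : ℝ} {m : ℤ} {rs : ℝ → ℝ} {u v y : ℝ → ℂ}

lemma IsTortoise.hasDerivAt_shift (hs : Subextremal a Q M) (hrs : IsTortoise a Q M rs)
    (hx : 0 < x) :
    HasDerivAt (fun x => rs (rPlus a Q M + x)) (tortoiseDeriv a Q M x) x := by
  have := hrs (rPlus a Q M + x) (by linarith)
  rw [Delta_rPlus_add hs] at this
  exact this.comp_const_add (rPlus a Q M) x

lemma IsCarterSolution.differentiable (hu : IsCarterSolution a Q M ω m lam rs u) :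
    Differentiable ℝ u :=
  hu.1.differentiable (by norm_num)

lemma IsCarterSolution.differentiable_deriv (hu : IsCarterSolution a Q M ω m lam rs u) :
    Differentiable ℝ (deriv u) :=
  (contDiff_succ_iff_deriv.1 (show ContDiff ℝ (1 + 1) u from hu.1)).2.2.differentiable
    (by norm_num)

lemma IsCarterSolution.carterSystem (hs : Subextremal a Q M) (hrs : IsTortoise a Q M rs)
    (hu : IsCarterSolution a Q M ω m lam rs u) :
    CarterSystem a Q M ω m lam (fun x => u (rs (rPlus a Q M + x)))
      (fun x => deriv u (rs (rPlus a Q M + x))) := by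
  refine ⟨fun x hx => ?_, fun x hx => ?_⟩
  · exact ((hu.differentiable _).hasDerivAt.scomp x (hrs.hasDerivAt_shift hs hx)).congr_deriv
      (Complex.real_smul ..)
  · refine ((hu.differentiable_deriv _).hasDerivAt.scomp x
      (hrs.hasDerivAt_shift hs hx)).congr_deriv ?_
    rw [eq_neg_of_add_eq_zero_left (hu.2 (rPlus a Q M + x) (by linarith)), smul_neg,
      Complex.real_smul]

lemma hasDerivAt_areaRadiusLogDeriv (hs : Subextremal a Q M) (hx : 0 < x) :
    HasDerivAt (areaRadiusLogDeriv a Q M)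
      ((2 * x + gap a Q M) * (rPlus a Q M + x) / ((rPlus a Q M + x) ^ 2 + a ^ 2) ^ 2
        + x * (x + gap a Q M) / ((rPlus a Q M + x) ^ 2 + a ^ 2) ^ 2
        - 4 * (x * (x + gap a Q M)) * (rPlus a Q M + x) ^ 2
          / ((rPlus a Q M + x) ^ 2 + a ^ 2) ^ 3) x := by
  have hr := rPlus_pos hs
  have hn : (rPlus a Q M + x) ^ 2 + a ^ 2 ≠ 0 := by positivity
  have dx := hasDerivAt_id x
  have dr := dx.const_add (rPlus a Q M)
  refine (((dx.mul (dx.add_const (gap a Q M))).mul dr).div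
    (((dr.pow 2).add_const (a ^ 2)).pow 2) (pow_ne_zero 2 hn)).congr_deriv ?_
  simp only [Pi.pow_apply, Pi.mul_apply, id]
  push_cast
  field_simp
  ring

lemma CarterSystem.hasDerivAt_radialFunction (hs : Subextremal a Q M)
    (h : CarterSystem a Q M ω m lam v y) (hx : 0 < x) :
    HasDerivAt (radialFunction a Q M v)
      (radialFlux a Q M v y x / ((x * (x + gap a Q M) : ℝ) : ℂ)) x := by
  have hx0 : (x : ℂ) ≠ 0 := by exact_mod_cast hx.ne'
  have hxδ := ofReal_add_ne_zero (gap_pos hs) hx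
  have hN : (areaRadius a Q M x : ℂ) ≠ 0 := by exact_mod_cast (areaRadius_pos hs hx.le).ne'
  refine ((h.deriv_fst x hx).div
    (hasDerivAt_areaRadius hs hx.le).ofReal_comp hN).congr_deriv ?_
  simp only [radialFlux, areaRadiusLogDeriv, tortoiseDeriv, ← areaRadius_sq]
  push_cast
  field_simp

lemma CarterSystem.hasDerivAt_radialFlux (hs : Subextremal a Q M)
    (h : CarterSystem a Q M ω m lam v y) (hx : 0 < x) :
    HasDerivAt (radialFlux a Q M v y)
      (-(((heunDrift (gap a Q M) M ω (horizonExponent a Q M ω m) x / 2) ^ 2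
          / (x * (x + gap a Q M)) + 8 * M * ω ^ 2 * x + accessory a Q M ω m lam : ℝ)
        * radialFunction a Q M v x)) x := by
  have hx0 : (x : ℂ) ≠ 0 := by exact_mod_cast hx.ne'
  have hxδ := ofReal_add_ne_zero (gap_pos hs) hx
  have hN : (areaRadius a Q M x : ℂ) ≠ 0 := by exact_mod_cast (areaRadius_pos hs hx.le).ne'
  have hV : ω ^ 2 - potential a Q M ω m lam (rPlus a Q M + x) = _ :=
    eq_div_of_mul_eq (pow_ne_zero 2 (by have := rPlus_pos hs; positivity))
      ((mul_comm _ _).trans (potential_eq hs ω m lam hx))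
  have hM : M = rPlus a Q M - gap a Q M / 2 := by rw [gap_eq]; ring
  refine ((hasDerivAt_areaRadius hs hx.le).ofReal_comp.mul ((h.deriv_snd x hx).sub
    ((hasDerivAt_areaRadiusLogDeriv hs hx).ofReal_comp.mul (h.deriv_fst x hx)))).congr_deriv ?_
  rw [hV]
  simp only [radialFunction, areaRadiusLogDeriv, tortoiseDeriv, Pi.sub_apply, Pi.mul_apply,
    ← areaRadius_sq]
  generalize heunDrift (gap a Q M) M ω (horizonExponent a Q M ω m) x = T
  generalize areaRadius a Q M x = N at hN ⊢
  generalize accessory a Q M ω m lam = b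
  generalize gap a Q M = δ at hM hxδ ⊢
  generalize rPlus a Q M = r at hM ⊢
  subst hM
  push_cast
  field_simp
  ring

lemma CarterSystem.radialSystem (hs : Subextremal a Q M) (h : CarterSystem a Q M ω m lam v y) :
    RadialSystem (gap a Q M) M ω (horizonExponent a Q M ω m) (accessory a Q M ω m lam)
      (radialFunction a Q M v) (radialFlux a Q M v y) :=
  ⟨fun _ hx => h.hasDerivAt_radialFunction hs hx, fun _ hx => h.hasDerivAt_radialFlux hs hx⟩

end Carter

/-! ### Energy estimate for the Carter equation -/

section Potential

variable {a Q M ω lam K x : ℝ} {m : ℤ}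

lemma mul_add_gap_le (hs : Subextremal a Q M) (hx : 0 < x) :
    x * (x + gap a Q M) ≤ (rPlus a Q M + x) ^ 2 + a ^ 2 := by
  nlinarith [gap_le_rPlus hs, rPlus_pos hs, mul_pos (rPlus_pos hs) hx, sq_nonneg a]

lemma one_le_tortoiseDeriv (hs : Subextremal a Q M) (hx : 0 < x) : 1 ≤ tortoiseDeriv a Q M x := by
  have := gap_pos hs
  exact (one_le_div (by positivity)).2 (mul_add_gap_le hs hx)

/-- A bound for `(r² + a²) V` when the frequency parameters are bounded by `K`. -/
def potentialBound (a Q M K : ℝ) : ℝ :=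
  2 * |a| * K * K + a ^ 2 * K ^ 2 / rPlus a Q M ^ 2 + (K + a ^ 2 * K ^ 2) + 6

lemma potentialBound_nonneg (hK : 0 ≤ K) : 0 ≤ potentialBound a Q M K := by
  unfold potentialBound
  positivity

lemma potential_mul_eq (a Q M ω : ℝ) (m : ℤ) (lam : ℝ) {r : ℝ} (hr : r ^ 2 + a ^ 2 ≠ 0) :
    potential a Q M ω m lam r * (r ^ 2 + a ^ 2)
      = 2 * a * m * ω * (1 - Delta a Q M r / (r ^ 2 + a ^ 2)) - a ^ 2 * m ^ 2 / (r ^ 2 + a ^ 2)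
        + Delta a Q M r / (r ^ 2 + a ^ 2) * (lam + a ^ 2 * ω ^ 2)
        + Delta a Q M r / (r ^ 2 + a ^ 2)
          * ((2 * r ^ 2 + Delta a Q M r - 2 * M * r) / (r ^ 2 + a ^ 2)
            - 3 * (Delta a Q M r / (r ^ 2 + a ^ 2)) * (r ^ 2 / (r ^ 2 + a ^ 2))) := by
  rw [potential]
  field_simp
  ring

lemma abs_add_le_of_freq_le (hω : |ω| ≤ K) (hl : |lam| ≤ K) :
    |lam + a ^ 2 * ω ^ 2| ≤ K + a ^ 2 * K ^ 2 := by
  calc |lam + a ^ 2 * ω ^ 2| ≤ |lam| + a ^ 2 * |ω| ^ 2 := by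
        refine (abs_add_le _ _).trans_eq ?_
        rw [abs_mul, abs_sq, abs_pow]
    _ ≤ K + a ^ 2 * K ^ 2 := by gcongr

lemma abs_curvature_le {r D n : ℝ} (hn : 0 < n) (hD0 : 0 ≤ D) (hDn : D ≤ n) (hrn : r ^ 2 ≤ n)
    (hM : 0 ≤ M) (hMr : M ≤ r) :
    |(2 * r ^ 2 + D - 2 * M * r) / n - 3 * (D / n) * (r ^ 2 / n)| ≤ 3 := by
  have hp0 : 0 ≤ D / n := by positivity
  have hp1 : D / n ≤ 1 := (div_le_one hn).2 hDn
  have hs0 : 0 ≤ r ^ 2 / n := by positivity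
  have hs1 : r ^ 2 / n ≤ 1 := (div_le_one hn).2 hrn
  have hw0 : 0 ≤ (2 * r ^ 2 + D - 2 * M * r) / n := div_nonneg (by nlinarith) hn.le
  have hw3 : (2 * r ^ 2 + D - 2 * M * r) / n ≤ 3 := by
    rw [div_le_iff₀ hn]
    nlinarith [mul_nonneg hM (hM.trans hMr)]
  have hps := mul_le_one₀ hp1 hs0 hs1
  have hps0 := mul_nonneg hp0 hs0
  rw [abs_le]
  constructor <;> linarith

lemma abs_potential_mul_le (hs : Subextremal a Q M) (hω : |ω| ≤ K) (hm : |(m : ℝ)| ≤ K)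
    (hl : |lam| ≤ K) (hx : 0 < x) :
    |potential a Q M ω m lam (rPlus a Q M + x)| * ((rPlus a Q M + x) ^ 2 + a ^ 2)
      ≤ potentialBound a Q M K := by
  have hr := rPlus_pos hs
  have hδ := gap_pos hs
  have hK : 0 ≤ K := (abs_nonneg _).trans hω
  have hn : 0 < (rPlus a Q M + x) ^ 2 + a ^ 2 := by positivity
  have hrn : rPlus a Q M ^ 2 ≤ (rPlus a Q M + x) ^ 2 + a ^ 2 := by nlinarith [sq_nonneg a]
  have hD0 : 0 ≤ Delta a Q M (rPlus a Q M + x) := by rw [Delta_rPlus_add hs]; positivity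
  have hDn : Delta a Q M (rPlus a Q M + x) ≤ (rPlus a Q M + x) ^ 2 + a ^ 2 := by
    rw [Delta_rPlus_add hs]
    exact mul_add_gap_le hs hx
  have hcurv := abs_curvature_le hn hD0 hDn (le_add_of_nonneg_right (sq_nonneg a)) hs.1.le
    (by linarith [mass_le_rPlus a Q M])
  have hp0 := div_nonneg hD0 hn.le
  have hp1 := (div_le_one hn).2 hDn
  rw [← abs_of_pos hn, ← abs_mul, potential_mul_eq a Q M ω m lam hn.ne']
  generalize Delta a Q M (rPlus a Q M + x) / ((rPlus a Q M + x) ^ 2 + a ^ 2) = p at *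
  have hrotation : |2 * a * m * ω * (1 - p)| ≤ 2 * |a| * K * K := by
    rw [abs_mul, abs_mul, abs_mul, abs_mul, abs_two, abs_of_nonneg (sub_nonneg.2 hp1)]
    calc 2 * |a| * |(m : ℝ)| * |ω| * (1 - p) ≤ 2 * |a| * K * K * 1 := by gcongr; linarith
      _ = 2 * |a| * K * K := mul_one _
  have hcentrifugal : |a ^ 2 * (m : ℝ) ^ 2 / ((rPlus a Q M + x) ^ 2 + a ^ 2)|
      ≤ a ^ 2 * K ^ 2 / rPlus a Q M ^ 2 := by
    rw [abs_of_nonneg (by positivity), ← sq_abs (m : ℝ)]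
    gcongr
  have hangular : |p * (lam + a ^ 2 * ω ^ 2)| ≤ K + a ^ 2 * K ^ 2 := by
    rw [abs_mul, abs_of_nonneg hp0]
    exact (mul_le_of_le_one_left (abs_nonneg _) hp1).trans (abs_add_le_of_freq_le hω hl)
  have hcurvature : ∀ w : ℝ, |w| ≤ 3 → |p * w| ≤ 3 := fun w hw => by
    rw [abs_mul, abs_of_nonneg hp0]
    exact (mul_le_of_le_one_left (abs_nonneg _) hp1).trans hw
  refine (abs_add_le _ _).trans ?_
  refine (add_le_add ((abs_add_le _ _).trans (add_le_add ((abs_sub _ _).trans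
    (add_le_add hrotation hcentrifugal)) hangular)) (hcurvature _ hcurv)).trans ?_
  rw [potentialBound]
  linarith

lemma abs_tortoiseDeriv_mul_potential_le (hs : Subextremal a Q M) (hω : |ω| ≤ K)
    (hm : |(m : ℝ)| ≤ K) (hl : |lam| ≤ K) {x₀ : ℝ} (hx₀ : 0 < x₀) (hx : x₀ ≤ x) :
    |tortoiseDeriv a Q M x * potential a Q M ω m lam (rPlus a Q M + x)|
      ≤ potentialBound a Q M K * ((x₀ + gap a Q M) / x₀) / (x + gap a Q M) ^ 2 := by
  have hδ := gap_pos hs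
  have hx0 : 0 < x := hx₀.trans_le hx
  have hK := potentialBound_nonneg (a := a) (Q := Q) (M := M) ((abs_nonneg _).trans hω)
  have hweight : 1 / (x * (x + gap a Q M)) ≤ (x₀ + gap a Q M) / x₀ / (x + gap a Q M) ^ 2 := by
    rw [div_div, div_le_div_iff₀ (by positivity) (by positivity)]
    have : x₀ * (x + gap a Q M) ≤ (x₀ + gap a Q M) * x := by nlinarith
    nlinarith [mul_le_mul_of_nonneg_right this (by positivity : 0 ≤ x + gap a Q M)]
  rw [abs_mul, abs_of_pos (tortoiseDeriv_pos hs hx0)]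
  calc tortoiseDeriv a Q M x * |potential a Q M ω m lam (rPlus a Q M + x)|
      = |potential a Q M ω m lam (rPlus a Q M + x)| * ((rPlus a Q M + x) ^ 2 + a ^ 2)
        * (1 / (x * (x + gap a Q M))) := by rw [tortoiseDeriv]; ring
    _ ≤ potentialBound a Q M K * ((x₀ + gap a Q M) / x₀ / (x + gap a Q M) ^ 2) :=
        mul_le_mul (abs_potential_mul_le hs hω hm hl hx0) hweight (by positivity) hK
    _ = potentialBound a Q M K * ((x₀ + gap a Q M) / x₀) / (x + gap a Q M) ^ 2 := by ring

end Potential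

lemma le_mul_exp_of_deriv_le_div_sq {E E' : ℝ → ℝ} {C δ x₀ x : ℝ} (hC : 0 ≤ C) (hδ : 0 < x₀ + δ)
    (hd : ∀ x, x₀ ≤ x → HasDerivAt E (E' x) x) (hE : ∀ x, x₀ ≤ x → 0 ≤ E x)
    (hE' : ∀ x, x₀ ≤ x → E' x ≤ C / (x + δ) ^ 2 * E x) (hx : x₀ ≤ x) :
    E x ≤ E x₀ * Real.exp (C / (x₀ + δ)) := by
  have hpos : ∀ x, x₀ ≤ x → 0 < x + δ := fun x hx => by linarith
  have hexp : ∀ x, x₀ ≤ x → HasDerivAt (fun y => Real.exp (C / (y + δ)))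
      (Real.exp (C / (x + δ)) * (-(C / (x + δ) ^ 2))) x := fun x hx => by
    refine (((hasDerivAt_const x C).fun_div ((hasDerivAt_id x).add_const δ)
      (hpos x hx).ne').exp).congr_deriv ?_
    simp only [id]
    ring
  have hanti : AntitoneOn (fun x => E x * Real.exp (C / (x + δ))) (Ici x₀) := by
    refine antitoneOn_of_hasDerivWithinAt_nonpos (convex_Ici x₀)
      (fun x hx => ((hd x hx).mul (hexp x hx)).continuousAt.continuousWithinAt)
      (fun x hx => ((hd x (interior_subset hx)).mul
        (hexp x (interior_subset hx))).hasDerivWithinAt) fun x hx => ?_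
    nlinarith [hE' x (interior_subset hx), Real.exp_pos (C / (x + δ))]
  have hone : 1 ≤ Real.exp (C / (x + δ)) :=
    Real.one_le_exp (div_nonneg hC (hpos x hx).le)
  exact (le_mul_of_one_le_right (hE x hx) hone).trans (hanti self_mem_Ici hx hx)

/-- The energy `|u'|² + ω² |u|²` of a solution of the Carter equation. -/
def modeEnergy (ω : ℝ) (v y : ℝ → ℂ) (x : ℝ) : ℝ := ‖y x‖ ^ 2 + ω ^ 2 * ‖v x‖ ^ 2

section Energy

variable {a Q M ω lam K x : ℝ} {m : ℤ} {v y : ℝ → ℂ}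

lemma modeEnergy_nonneg (ω : ℝ) (v y : ℝ → ℂ) (x : ℝ) : 0 ≤ modeEnergy ω v y x := by
  unfold modeEnergy
  positivity

lemma two_mul_abs_inner_le (hω : ω ≠ 0) :
    2 * |inner ℝ (y x) (v x)| ≤ |ω|⁻¹ * modeEnergy ω v y x := by
  rw [inv_mul_eq_div, le_div_iff₀ (abs_pos.2 hω)]
  calc 2 * |inner ℝ (y x) (v x)| * |ω| ≤ 2 * (‖y x‖ * ‖v x‖) * |ω| := by
        gcongr
        exact abs_real_inner_le_norm _ _
    _ ≤ modeEnergy ω v y x := by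
        rw [modeEnergy, ← sq_abs ω]
        nlinarith [sq_nonneg (‖y x‖ - |ω| * ‖v x‖)]

lemma CarterSystem.hasDerivAt_modeEnergy (h : CarterSystem a Q M ω m lam v y) (hx : 0 < x) :
    HasDerivAt (modeEnergy ω v y) (2 * (tortoiseDeriv a Q M x
      * potential a Q M ω m lam (rPlus a Q M + x)) * inner ℝ (y x) (v x)) x := by
  refine ((h.deriv_snd x hx).norm_sq.add
    ((h.deriv_fst x hx).norm_sq.const_mul (ω ^ 2))).congr_deriv ?_
  rw [← Complex.real_smul, ← Complex.real_smul, ← Complex.real_smul, inner_neg_right,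
    inner_smul_right, inner_smul_right, inner_smul_right, real_inner_comm (y x) (v x)]
  ring

lemma CarterSystem.modeEnergy_le (hs : Subextremal a Q M) (h : CarterSystem a Q M ω m lam v y)
    (hω0 : ω ≠ 0) (hω : |ω| ≤ K) (hm : |(m : ℝ)| ≤ K) (hl : |lam| ≤ K) {x₀ : ℝ} (hx₀ : 0 < x₀)
    (hx : x₀ ≤ x) :
    modeEnergy ω v y x ≤ modeEnergy ω v y x₀
      * Real.exp (potentialBound a Q M K * ((x₀ + gap a Q M) / x₀) * |ω|⁻¹
        / (x₀ + gap a Q M)) := by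
  have hδ := gap_pos hs
  have hK := potentialBound_nonneg (a := a) (Q := Q) (M := M) ((abs_nonneg _).trans hω)
  refine le_mul_exp_of_deriv_le_div_sq (by positivity) (by positivity)
    (fun t ht => h.hasDerivAt_modeEnergy (hx₀.trans_le ht)) (fun t _ => modeEnergy_nonneg ω v y t)
    (fun t ht => ?_) hx
  calc _ ≤ |tortoiseDeriv a Q M t * potential a Q M ω m lam (rPlus a Q M + t)|
        * (2 * |inner ℝ (y t) (v t)|) := by
        refine (le_abs_self _).trans_eq ?_
        rw [abs_mul, abs_mul 2, abs_two]
        ring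
    _ ≤ potentialBound a Q M K * ((x₀ + gap a Q M) / x₀) / (t + gap a Q M) ^ 2
        * (|ω|⁻¹ * modeEnergy ω v y t) := by
        have ht0 : 0 < t := hx₀.trans_le ht
        exact mul_le_mul (abs_tortoiseDeriv_mul_potential_le hs hω hm hl hx₀ ht)
          (two_mul_abs_inner_le hω0) (by positivity) (by positivity)
    _ = _ := by ring

end Energy

/-! ### The tortoise coordinate and the Wronskian -/

section Tortoise

variable {a Q M ω lam : ℝ} {m : ℤ} {rs : ℝ → ℝ} {u₁ u₂ : ℝ → ℂ}

lemma IsTortoise.tendsto_atTop (hs : Subextremal a Q M) (hrs : IsTortoise a Q M rs) :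
    Tendsto (fun x => rs (rPlus a Q M + x)) atTop atTop := by
  have hd : ∀ x ∈ Ici (1 : ℝ), HasDerivAt (fun x => rs (rPlus a Q M + x) - x)
      (tortoiseDeriv a Q M x - 1) x := fun x hx =>
    (hrs.hasDerivAt_shift hs (one_pos.trans_le hx)).sub (hasDerivAt_id x)
  have hmono : MonotoneOn (fun x => rs (rPlus a Q M + x) - x) (Ici 1) :=
    monotoneOn_of_hasDerivWithinAt_nonneg (convex_Ici 1)
      (fun x hx => (hd x hx).continuousAt.continuousWithinAt)
      (fun x hx => (hd x (interior_subset hx)).hasDerivWithinAt)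
      fun x hx => sub_nonneg.2 (one_le_tortoiseDeriv hs (one_pos.trans_le (interior_subset hx)))
  refine tendsto_atTop_mono' atTop ?_
    (tendsto_atTop_add_const_left atTop (rs (rPlus a Q M + 1) - 1) tendsto_id)
  filter_upwards [eventually_ge_atTop 1] with x hx
  have := hmono self_mem_Ici hx hx
  simp only [id] at this ⊢
  linarith

lemma tortoiseDeriv_ge (hs : Subextremal a Q M) {x : ℝ} (hx : 0 < x) (hx1 : x ≤ 1) :
    rPlus a Q M ^ 2 / (1 + gap a Q M) * x⁻¹ ≤ tortoiseDeriv a Q M x := by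
  have hδ := gap_pos hs
  have hr := rPlus_pos hs
  rw [tortoiseDeriv, ← div_eq_mul_inv, div_div]
  exact div_le_div₀ (by positivity) (by nlinarith [sq_nonneg a]) (by positivity) (by nlinarith)

lemma IsTortoise.tendsto_atBot (hs : Subextremal a Q M) (hrs : IsTortoise a Q M rs) :
    Tendsto (fun x => rs (rPlus a Q M + x)) (𝓝[>] 0) atBot := by
  have hδ := gap_pos hs
  have hr := rPlus_pos hs
  set k := rPlus a Q M ^ 2 / (1 + gap a Q M)
  have hk : 0 < k := by positivity
  have hd : ∀ x ∈ Ioc (0 : ℝ) 1, HasDerivAt (fun x => rs (rPlus a Q M + x) - k * Real.log x)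
      (tortoiseDeriv a Q M x - k * x⁻¹) x := fun x hx =>
    (hrs.hasDerivAt_shift hs hx.1).sub ((Real.hasDerivAt_log hx.1.ne').const_mul k)
  have hmono : MonotoneOn (fun x => rs (rPlus a Q M + x) - k * Real.log x) (Ioc 0 1) :=
    monotoneOn_of_hasDerivWithinAt_nonneg (convex_Ioc 0 1)
      (fun x hx => (hd x hx).continuousAt.continuousWithinAt)
      (fun x hx => (hd x (interior_subset hx)).hasDerivWithinAt) fun x hx =>
        sub_nonneg.2 (tortoiseDeriv_ge hs (interior_subset hx).1 (interior_subset hx).2)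
  refine tendsto_atBot_mono' _ ?_ (tendsto_atBot_add_const_left _ (rs (rPlus a Q M + 1))
    (Real.tendsto_log_nhdsGT_zero.const_mul_atBot hk))
  filter_upwards [Ioc_mem_nhdsGT one_pos] with x hx
  have := hmono hx ⟨one_pos, le_rfl⟩ hx.2
  simp only [Real.log_one] at this
  linarith

lemma IsTortoise.exists_eq (hs : Subextremal a Q M) (hrs : IsTortoise a Q M rs) (t : ℝ) :
    ∃ x, 0 < x ∧ rs (rPlus a Q M + x) = t :=
  isPreconnected_Ioi.intermediate_value_Iii (l₁ := 𝓝[>] 0) inf_le_right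
    (le_principal_iff.2 (Ioi_mem_atTop 0))
    (fun _ hx => (hrs.hasDerivAt_shift hs hx).continuousAt.continuousWithinAt)
    (hrs.tendsto_atBot hs) (hrs.tendsto_atTop hs) (mem_univ t)

lemma wronskian_eq (hs : Subextremal a Q M) (hrs : IsTortoise a Q M rs)
    (h₁ : IsCarterSolution a Q M ω m lam rs u₁) (h₂ : IsCarterSolution a Q M ω m lam rs u₂)
    (s t : ℝ) : wronskian u₁ u₂ s = wronskian u₁ u₂ t := by
  have hd : ∀ t, HasDerivAt (wronskian u₁ u₂) 0 t := by
    intro t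
    obtain ⟨x, hx, rfl⟩ := hrs.exists_eq hs t
    refine (((h₁.differentiable _).hasDerivAt.mul (h₂.differentiable_deriv _).hasDerivAt).sub
      ((h₁.differentiable_deriv _).hasDerivAt.mul
        (h₂.differentiable _).hasDerivAt)).congr_deriv ?_
    rw [eq_neg_of_add_eq_zero_left (h₁.2 (rPlus a Q M + x) (by linarith)),
      eq_neg_of_add_eq_zero_left (h₂.2 (rPlus a Q M + x) (by linarith))]
    ring
  exact is_const_of_deriv_eq_zero (fun t => (hd t).differentiableAt) (fun t => (hd t).deriv) s t

end Tortoise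

/-! ### The radiation condition -/

lemma eq_zero_of_tendsto_of_tendsto_deriv {E : Type*} [NormedAddCommGroup E] [NormedSpace ℝ E]
    {g g' : ℝ → E} {c d : E} (hg : ∀ᶠ x in atTop, HasDerivAt g (g' x) x)
    (hc : Tendsto g atTop (𝓝 c)) (hd : Tendsto g' atTop (𝓝 d)) : d = 0 := by
  rw [← norm_le_zero_iff]
  refine le_of_forall_pos_le_add fun e he => ?_
  rw [zero_add]
  have hincrement : Tendsto (fun x => ‖g (x + 1) - g x - d‖) atTop (𝓝 ‖c - c - d‖) :=
    (((hc.comp (tendsto_atTop_add_const_right _ 1 tendsto_id)).sub hc).sub tendsto_const_nhds).norm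
  rw [sub_self, zero_sub, norm_neg] at hincrement
  refine le_of_tendsto hincrement ?_
  obtain ⟨X, hX⟩ := eventually_atTop.1
    (hg.and ((hd.sub_const d).norm.eventually (ge_mem_nhds (by rwa [sub_self, norm_zero]))))
  filter_upwards [eventually_ge_atTop X] with x hx
  have hder : ∀ t ∈ Icc x (x + 1),
      HasDerivWithinAt (fun t => g t - t • d) (g' t - d) (Icc x (x + 1)) t := fun t ht => by
    simpa only [one_smul, id] using
      ((hX t (hx.trans ht.1)).1.fun_sub ((hasDerivAt_id t).smul_const d)).hasDerivWithinAt
  have hle := norm_image_sub_le_of_norm_deriv_le_segment' hder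
    (fun t ht => (hX t (hx.trans ht.1)).2) (x + 1) ⟨by linarith, le_rfl⟩
  calc ‖g (x + 1) - g x - d‖ = ‖g (x + 1) - (x + 1) • d - (g x - x • d)‖ := by
        congr 1
        rw [add_smul, one_smul]
        abel
    _ ≤ e := by simpa only [add_sub_cancel_left, mul_one] using hle

lemma tendsto_tortoiseDeriv (a Q M : ℝ) : Tendsto (tortoiseDeriv a Q M) atTop (𝓝 1) := by
  have hinv : Tendsto (fun x : ℝ => x⁻¹) atTop (𝓝 0) := tendsto_inv_atTop_zero
  have hlim := ((((hinv.const_mul (rPlus a Q M)).const_add 1).pow 2).add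
    ((hinv.const_mul a).pow 2)).div ((hinv.const_mul (gap a Q M)).const_add 1) (by norm_num)
  simp only [mul_zero, add_zero, one_pow, ne_eq, OfNat.ofNat_ne_zero, not_false_eq_true, zero_pow,
    div_one] at hlim
  refine hlim.congr' ?_
  filter_upwards [eventually_gt_atTop 0] with x hx
  rw [Pi.div_apply, tortoiseDeriv, ← mul_div_mul_left _ _ (pow_pos hx 2).ne']
  congr 1
  · field_simp
    ring
  · field_simp

/-- The factor `e^{-iωr*}` as a function of `r - r₊`. -/
def outgoingFactor (a Q M ω : ℝ) (rs : ℝ → ℝ) (x : ℝ) : ℂ := phase (-(ω * rs (rPlus a Q M + x)))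

lemma norm_mul_outgoingFactor (a Q M ω : ℝ) (rs : ℝ → ℝ) (x : ℝ) (z : ℂ) :
    ‖z * outgoingFactor a Q M ω rs x‖ = ‖z‖ := by
  rw [norm_mul, outgoingFactor, norm_phase, mul_one]

section Radiation

variable {a Q M ω lam : ℝ} {m : ℤ} {rs : ℝ → ℝ} {u v y : ℝ → ℂ}

lemma outgoingFactor_eq_exp (a Q M ω : ℝ) (rs : ℝ → ℝ) (x : ℝ) :
    outgoingFactor a Q M ω rs x = Complex.exp (-(Complex.I * ω * rs (rPlus a Q M + x))) := by
  rw [outgoingFactor, phase]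
  congr 1
  push_cast
  ring

lemma hasDerivAt_outgoingFactor (hs : Subextremal a Q M) (hrs : IsTortoise a Q M rs) (ω : ℝ)
    {x : ℝ} (hx : 0 < x) :
    HasDerivAt (outgoingFactor a Q M ω rs)
      (-(Complex.I * ω * tortoiseDeriv a Q M x * outgoingFactor a Q M ω rs x)) x := by
  refine (hasDerivAt_phase_comp ((hrs.hasDerivAt_shift hs hx).const_mul ω).fun_neg).congr_deriv ?_
  rw [outgoingFactor]
  push_cast
  ring

lemma IsOut.tendsto_norm (hu : IsOut a Q M ω m lam rs u) :
    Tendsto (fun x => ‖u (rs (rPlus a Q M + x))‖) atTop (𝓝 1) := by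
  have h := (hu.normalized.comp (tendsto_atTop_add_const_left _ (rPlus a Q M) tendsto_id)).sqrt
  rw [Real.sqrt_one] at h
  refine h.congr fun x => ?_
  simp only [Function.comp_apply, id]
  rw [Real.sqrt_sq (norm_nonneg _), ← outgoingFactor_eq_exp, norm_mul_outgoingFactor]

lemma IsOut.exists_tendsto_mul_outgoingFactor (hu : IsOut a Q M ω m lam rs u) :
    ∃ A, Tendsto (fun x => u (rs (rPlus a Q M + x)) * outgoingFactor a Q M ω rs x) atTop (𝓝 A) := by
  obtain ⟨C, hC⟩ := hu.asymp
  refine ⟨C 0, ?_⟩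
  have hlead := hC 0
  simp only [zero_add, Finset.range_one, Finset.sum_singleton, pow_zero, inv_one, mul_one,
    pow_one] at hlead
  have hlim := ((hlead.trans_tendsto tendsto_inv_atTop_zero).comp
    (tendsto_atTop_add_const_left _ (rPlus a Q M) tendsto_id)).norm
  rw [norm_zero] at hlim
  rw [tendsto_iff_norm_sub_tendsto_zero]
  refine hlim.congr fun x => ?_
  simp only [Function.comp_apply, id]
  rw [← norm_mul_outgoingFactor a Q M ω rs x, sub_mul, mul_right_comm, outgoingFactor_eq_exp,
    ← Complex.exp_add, add_neg_cancel, Complex.exp_zero, one_mul]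

lemma CarterSystem.hasDerivAt_incoming (hs : Subextremal a Q M) (hrs : IsTortoise a Q M rs)
    (h : CarterSystem a Q M ω m lam v y) {x : ℝ} (hx : 0 < x) :
    HasDerivAt (fun x => (y x + Complex.I * ω * v x) * outgoingFactor a Q M ω rs x)
      ((tortoiseDeriv a Q M x * potential a Q M ω m lam (rPlus a Q M + x) : ℝ)
        * (v x * outgoingFactor a Q M ω rs x)) x := by
  refine (((h.deriv_snd x hx).add ((h.deriv_fst x hx).const_mul (Complex.I * ω))).mul
    (hasDerivAt_outgoingFactor hs hrs ω hx)).congr_deriv ?_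
  simp only [Pi.add_apply]
  push_cast
  linear_combination (-tortoiseDeriv a Q M x * ω ^ 2 * v x * outgoingFactor a Q M ω rs x)
    * Complex.I_sq

lemma CarterSystem.exists_tendsto_incoming (hs : Subextremal a Q M) (hrs : IsTortoise a Q M rs)
    (h : CarterSystem a Q M ω m lam v y) {B : ℝ} (hv : ∀ᶠ x in atTop, ‖v x‖ ≤ B) :
    ∃ L, Tendsto (fun x => (y x + Complex.I * ω * v x) * outgoingFactor a Q M ω rs x)
      atTop (𝓝 L) := by
  obtain ⟨X, hX⟩ := eventually_atTop.1 (hv.and (eventually_gt_atTop 0))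
  have hX0 : 0 < X := (hX X le_rfl).2
  have hder := fun x (hx : x ∈ Ioi X) => h.hasDerivAt_incoming hs hrs (hX0.trans hx)
  refine ⟨_, tendsto_limUnder_of_hasDerivAt_of_integrableOn_Ioi hder ?_⟩
  set K := |ω| + |(m : ℝ)| + |lam|
  refine Integrable.mono' ((integrableOn_inv_sq (gap_pos hs) (potentialBound a Q M K
    * ((X + gap a Q M) / X) * B)).mono_set (Ioi_subset_Ioi hX0.le)) ?_ ?_
  · refine (aestronglyMeasurable_deriv
      (fun x => (y x + Complex.I * ω * v x) * outgoingFactor a Q M ω rs x) _).congr ?_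
    exact (ae_restrict_iff' measurableSet_Ioi).2 (Eventually.of_forall fun x hx =>
      (hder x hx).deriv)
  · refine (ae_restrict_iff' measurableSet_Ioi).2 (Eventually.of_forall fun x hx => ?_)
    have hpot := abs_tortoiseDeriv_mul_potential_le (ω := ω) (m := m) (lam := lam) (K := K) hs
      (by linarith [abs_nonneg (m : ℝ), abs_nonneg lam])
      (by linarith [abs_nonneg ω, abs_nonneg lam])
      (by linarith [abs_nonneg (m : ℝ), abs_nonneg ω]) hX0 (le_of_lt hx)
    rw [norm_mul, norm_mul_outgoingFactor, Complex.norm_real, Real.norm_eq_abs]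
    calc _ ≤ _ := mul_le_mul hpot (hX x (le_of_lt hx)).1 (norm_nonneg _)
          ((abs_nonneg _).trans hpot)
      _ = _ := by ring

lemma IsOut.radiation_condition (hs : Subextremal a Q M) (hrs : IsTortoise a Q M rs)
    (hu : IsOut a Q M ω m lam rs u) :
    Tendsto (fun x => ‖deriv u (rs (rPlus a Q M + x))
      - Complex.I * ω * u (rs (rPlus a Q M + x))‖) atTop (𝓝 0) := by
  have h := hu.solution.carterSystem hs hrs
  obtain ⟨A, hA⟩ := hu.exists_tendsto_mul_outgoingFactor
  obtain ⟨L, hL⟩ := h.exists_tendsto_incoming hs hrs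
    (hu.tendsto_norm.eventually (ge_mem_nhds one_lt_two))
  have hdiff : Tendsto (fun x => (deriv u (rs (rPlus a Q M + x))
      - Complex.I * ω * u (rs (rPlus a Q M + x))) * outgoingFactor a Q M ω rs x) atTop
      (𝓝 (L - 2 * Complex.I * ω * A)) :=
    (hL.sub (hA.const_mul (2 * Complex.I * ω))).congr fun x => by ring
  have hderiv : ∀ᶠ x in atTop,
      HasDerivAt (fun x => u (rs (rPlus a Q M + x)) * outgoingFactor a Q M ω rs x)
        (tortoiseDeriv a Q M x * ((deriv u (rs (rPlus a Q M + x))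
          - Complex.I * ω * u (rs (rPlus a Q M + x))) * outgoingFactor a Q M ω rs x)) x := by
    filter_upwards [eventually_gt_atTop 0] with x hx
    refine ((h.deriv_fst x hx).mul (hasDerivAt_outgoingFactor hs hrs ω hx)).congr_deriv ?_
    ring
  have hzero := eq_zero_of_tendsto_of_tendsto_deriv hderiv hA
    (((Complex.continuous_ofReal.tendsto 1).comp (tendsto_tortoiseDeriv a Q M)).mul hdiff)
  rw [Complex.ofReal_one, one_mul] at hzero
  rw [hzero] at hdiff
  simpa only [norm_zero, norm_mul_outgoingFactor] using hdiff.norm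

end Radiation

/-! ### Regularity at the horizon -/

section Profile

variable {a Q M ω lam x : ℝ} {m : ℤ} {v y : ℝ → ℂ}

/-- The solution of the confluent Heun equation determined by a solution `v` of the Carter ODE. -/
def carterProfile (a Q M ω : ℝ) (m : ℤ) (v : ℝ → ℂ) : ℝ → ℂ :=
  heunProfile (gap a Q M) M ω (horizonExponent a Q M ω m) (radialFunction a Q M v)

/-- `x (x + r₊ - r₋)` times the derivative of `carterProfile`. -/
def carterFlux (a Q M ω : ℝ) (m : ℤ) (v y : ℝ → ℂ) : ℝ → ℂ :=
  heunFlux (gap a Q M) M ω (horizonExponent a Q M ω m) (radialFunction a Q M v)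
    (radialFlux a Q M v y)

/-- The derivative of `carterProfile`. -/
def carterProfileDeriv (a Q M ω : ℝ) (m : ℤ) (v y : ℝ → ℂ) (x : ℝ) : ℂ :=
  carterFlux a Q M ω m v y x / ((x * (x + gap a Q M) : ℝ) : ℂ)

lemma CarterSystem.hasDerivAt_carterProfile (hs : Subextremal a Q M)
    (h : CarterSystem a Q M ω m lam v y) (hx : 0 < x) :
    HasDerivAt (carterProfile a Q M ω m v) (carterProfileDeriv a Q M ω m v y x) x :=
  (h.radialSystem hs).hasDerivAt_heunProfile (gap_pos hs) hx

lemma CarterSystem.hasDerivAt_carterFlux (hs : Subextremal a Q M)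
    (h : CarterSystem a Q M ω m lam v y) (hx : 0 < x) :
    HasDerivAt (fun z : ℝ => ((z * (z + gap a Q M) : ℝ) : ℂ) * carterProfileDeriv a Q M ω m v y z)
      (-(Complex.I * heunDrift (gap a Q M) M ω (horizonExponent a Q M ω m) x
          * carterProfileDeriv a Q M ω m v y x)
        - heunPotential (gap a Q M) M ω (accessory a Q M ω m lam) x
          * carterProfile a Q M ω m v x) x := by
  refine ((h.radialSystem hs).hasDerivAt_heunFlux (gap_pos hs) hx).congr_of_eventuallyEq ?_
  filter_upwards [lt_mem_nhds hx] with z hz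
  have := gap_pos hs
  exact mul_div_cancel₀ _ (Complex.ofReal_ne_zero.2 (by positivity))

end Profile

lemma tendsto_of_contDiffOn_Ici_zero {G f f' : ℝ → ℂ} (hG : ContDiffOn ℝ 1 G (Ici 0))
    (hf : ∀ x, 0 < x → f x = G x) (hd : ∀ x, 0 < x → HasDerivAt f (f' x) x) :
    Tendsto f (𝓝[>] 0) (𝓝 (G 0)) ∧ Tendsto (fun x : ℝ => (x : ℂ) * f' x) (𝓝[>] 0) (𝓝 0) := by
  have hlim : ∀ {k : ℝ → ℂ}, ContinuousOn k (Ici 0) → Tendsto k (𝓝[>] 0) (𝓝 (k 0)) := fun hk =>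
    (hk 0 self_mem_Ici).mono Ioi_subset_Ici_self
  have hderiv : ∀ x, 0 < x → f' x = derivWithin G (Ici 0) x := fun x hx => by
    rw [derivWithin_of_mem_nhds (Ici_mem_nhds hx)]
    exact ((hd x hx).congr_of_eventuallyEq
      (by filter_upwards [lt_mem_nhds hx] with t ht using (hf t ht).symm)).deriv.symm
  constructor
  · exact (hlim hG.continuousOn).congr'
      (by filter_upwards [self_mem_nhdsWithin] with x hx using (hf x hx).symm)
  · have hmul := hlim (Complex.continuous_ofReal.continuousOn.fun_mul
      (hG.continuousOn_derivWithin (uniqueDiffOn_Ici 0) le_rfl))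
    rw [Complex.ofReal_zero, zero_mul] at hmul
    exact hmul.congr' (by filter_upwards [self_mem_nhdsWithin] with x hx using by rw [hderiv x hx])

lemma cpow_neg_xi {a Q M : ℝ} (hs : Subextremal a Q M) (ω : ℝ) (m : ℤ) {x : ℝ} (hx : 0 < x) :
    (x : ℂ) ^ (-xi a Q M ω m) = phase (horizonExponent a Q M ω m / 2 * Real.log x) := by
  rw [Complex.cpow_def_of_ne_zero (by exact_mod_cast hx.ne'), phase, xi_eq hs,
    ← Complex.ofReal_log hx.le]
  congr 1
  push_cast
  ring

/-- The factor relating the Heun profile of an ingoing solution `u` to `(r - r₊)^{-ξ} u`; unlike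
either of these powers of `r - r₊` alone, it is smooth up to the horizon `x = 0`. -/
def horizonFactor (a Q M ω : ℝ) (m : ℤ) (x : ℝ) : ℂ :=
  phase (-(ω * x) + (2 * M * ω - horizonExponent a Q M ω m / 2) * Real.log (x + gap a Q M))
    / areaRadius a Q M x

section Horizon

variable {a Q M ω lam : ℝ} {m : ℤ} {rs : ℝ → ℝ} {u : ℝ → ℂ}

lemma norm_horizonFactor (hs : Subextremal a Q M) {x : ℝ} (hx : 0 ≤ x) :
    ‖horizonFactor a Q M ω m x‖ = 1 / areaRadius a Q M x := by
  rw [horizonFactor, norm_div, norm_phase, norm_ofReal_of_pos (areaRadius_pos hs hx)]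

lemma contDiffOn_horizonFactor (hs : Subextremal a Q M) :
    ContDiffOn ℝ 1 (horizonFactor a Q M ω m) (Ici 0) := by
  have hlog : ContDiffOn ℝ 1 (fun x => Real.log (x + gap a Q M)) (Ici 0) :=
    (contDiffOn_id.add contDiffOn_const).log fun x (hx : 0 ≤ x) => (add_pos_of_nonneg_of_pos hx
      (gap_pos hs)).ne'
  have hradius : ContDiffOn ℝ 1 (areaRadius a Q M) (Ici 0) :=
    ContDiffOn.sqrt (by fun_prop) fun x (hx : 0 ≤ x) => (Real.sqrt_pos.1 (areaRadius_pos hs hx)).ne'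
  have hphase : ContDiffOn ℝ 1 (fun x => phase (-(ω * x)
      + (2 * M * ω - horizonExponent a Q M ω m / 2) * Real.log (x + gap a Q M))) (Ici 0) :=
    (contDiffOn_const.mul (Complex.ofRealCLM.contDiff.comp_contDiffOn
      ((contDiffOn_const.mul contDiffOn_id).neg.add (contDiffOn_const.mul hlog)))).cexp
  have hinv : ContDiffOn ℝ 1 (fun x => (areaRadius a Q M x : ℂ)⁻¹) (Ici 0) :=
    (Complex.ofRealCLM.contDiff.comp_contDiffOn hradius).inv fun x hx =>
      Complex.ofReal_ne_zero.2 (areaRadius_pos hs hx).ne'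
  exact hphase.mul hinv

lemma carterProfile_eq_horizonFactor_mul (hs : Subextremal a Q M) (v : ℝ → ℂ) {x : ℝ}
    (hx : 0 < x) : carterProfile a Q M ω m v x
      = horizonFactor a Q M ω m x * ((x : ℂ) ^ (-xi a Q M ω m) * v x) := by
  rw [cpow_neg_xi hs ω m hx, carterProfile, heunProfile, radialPhase, radialFunction, horizonFactor,
    show -(heunAngle (gap a Q M) M ω (horizonExponent a Q M ω m) x / 2)
      = -(ω * x) + (2 * M * ω - horizonExponent a Q M ω m / 2) * Real.log (x + gap a Q M)
        + horizonExponent a Q M ω m / 2 * Real.log x by rw [heunAngle]; ring, phase_add]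
  ring

lemma IsHor.regularHeunSolution (hs : Subextremal a Q M) (hrs : IsTortoise a Q M rs)
    (hu : IsHor a Q M ω m lam rs u) :
    ∃ f₀ : ℂ, ‖f₀‖ = 1 / areaRadius a Q M 0 ∧
      Tendsto (carterProfile a Q M ω m fun x => u (rs (rPlus a Q M + x))) (𝓝[>] 0) (𝓝 f₀) ∧
      RegularHeunSolution (gap a Q M) M ω (horizonExponent a Q M ω m) (accessory a Q M ω m lam)
        (carterProfile a Q M ω m fun x => u (rs (rPlus a Q M + x)))
        (carterProfileDeriv a Q M ω m (fun x => u (rs (rPlus a Q M + x)))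
          fun x => deriv u (rs (rPlus a Q M + x))) := by
  obtain ⟨h, hsmooth, hh⟩ := hu.asymp
  have hsys := hu.solution.carterSystem hs hrs
  have hunit : ‖h (rPlus a Q M)‖ = 1 := by
    have hlim := ((hsmooth.continuousOn _ self_mem_Ici).mono Ioi_subset_Ici_self).norm.pow 2
    refine (pow_eq_one_iff_of_nonneg (norm_nonneg _) two_ne_zero).1 ?_
    refine tendsto_nhds_unique hlim.tendsto (hu.normalized.congr' ?_)
    filter_upwards [self_mem_nhdsWithin] with r hr using by rw [Pi.pow_apply, hh r hr]
  have hshift : ContDiffOn ℝ 1 (fun x => h (rPlus a Q M + x)) (Ici 0) :=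
    (hsmooth.of_le (by exact_mod_cast le_top)).comp (by fun_prop) fun x (hx : 0 ≤ x) =>
      le_add_of_nonneg_right hx
  obtain ⟨hlim, hlim'⟩ := tendsto_of_contDiffOn_Ici_zero
    ((contDiffOn_horizonFactor (ω := ω) (m := m) hs).mul hshift) (fun x hx => by
      rw [carterProfile_eq_horizonFactor_mul hs _ hx, hh _ (by linarith), add_sub_cancel_left])
    (fun _ hx => hsys.hasDerivAt_carterProfile hs hx)
  refine ⟨_, ?_, hlim, fun _ hx => hsys.hasDerivAt_carterProfile hs hx,
    fun _ hx => hsys.hasDerivAt_carterFlux hs hx, hlim'⟩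
  rw [norm_mul, norm_horizonFactor hs le_rfl, add_zero, hunit, mul_one]

end Horizon

/-! ### Uniformity over bounded frequency ranges -/

/-- The frequencies `ω ≠ 0` and `m`, and the separation constant `lam`, satisfy
`|ω|, |ω|⁻¹, |m|, |lam| ≤ K`. -/
structure FrequencyBound (K ω : ℝ) (m : ℤ) (lam : ℝ) : Prop where
  ne_zero : ω ≠ 0
  freq : |ω| ≤ K
  inv_freq : |ω|⁻¹ ≤ K
  azimuthal : |(m : ℝ)| ≤ K
  separation : |lam| ≤ K

lemma FrequencyBound.pos {K ω lam : ℝ} {m : ℤ} (h : FrequencyBound K ω m lam) : 0 < K :=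
  (abs_pos.2 h.ne_zero).trans_le h.freq

lemma exists_norm_le_of_frequencyBound {E : Type*} [SeminormedAddCommGroup E]
    {g : ℝ × ℤ × ℝ × ℝ → E} (hg : Continuous g) (K L : ℝ) :
    ∃ B, 0 < B ∧ ∀ ω m lam x, FrequencyBound K ω m lam → |x| ≤ L → ‖g (ω, m, lam, x)‖ ≤ B := by
  obtain ⟨B, hB⟩ := (isCompact_closedBall (0 : ℝ × ℤ × ℝ × ℝ)
    (max K L)).exists_bound_of_continuousOn hg.continuousOn
  refine ⟨max B 1, by positivity, fun ω m lam x h hx => (hB (ω, m, lam, x) ?_).trans (by simp)⟩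
  rw [mem_closedBall_zero_iff]
  simp only [norm_prod_le_iff, Real.norm_eq_abs, Int.norm_eq_abs]
  exact ⟨h.freq.trans (le_max_left _ _), h.azimuthal.trans (le_max_left _ _),
    h.separation.trans (le_max_left _ _), hx.trans (le_max_right _ _)⟩

section Continuity

variable (a Q M : ℝ)

lemma continuous_horizonExponent :
    Continuous fun p : ℝ × ℤ × ℝ × ℝ => horizonExponent a Q M p.1 p.2.1 := by
  unfold horizonExponent horizonFreq
  fun_prop

lemma continuous_accessory :
    Continuous fun p : ℝ × ℤ × ℝ × ℝ => accessory a Q M p.1 p.2.1 p.2.2.1 := by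
  unfold accessory horizonFreq
  fun_prop

lemma continuous_heunPotential : Continuous fun p : ℝ × ℤ × ℝ × ℝ =>
    heunPotential (gap a Q M) M p.1 (accessory a Q M p.1 p.2.1 p.2.2.1) p.2.2.2 := by
  have := continuous_accessory a Q M
  unfold heunPotential
  fun_prop

lemma continuous_heunDrift : Continuous fun p : ℝ × ℤ × ℝ × ℝ =>
    heunDrift (gap a Q M) M p.1 (horizonExponent a Q M p.1 p.2.1) p.2.2.2 := by
  have := continuous_horizonExponent a Q M
  unfold heunDrift
  fun_prop

end Continuity

theorem exists_uniform_near_horizon {a Q M : ℝ} (hs : Subextremal a Q M) (K : ℝ) :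
    ∃ x₀ D : ℝ, 0 < x₀ ∧ ∀ (ω : ℝ) (m : ℤ) (lam : ℝ) (rs : ℝ → ℝ) (u : ℝ → ℂ),
      FrequencyBound K ω m lam → IsTortoise a Q M rs → IsHor a Q M ω m lam rs u →
      ∃ f₀ : ℂ, ‖f₀‖ = 1 / areaRadius a Q M 0 ∧ ∀ x, 0 < x → x ≤ x₀ →
        ‖carterProfile a Q M ω m (fun x => u (rs (rPlus a Q M + x))) x - f₀‖
          ≤ 1 / areaRadius a Q M 0 / 8 ∧
        ‖carterProfileDeriv a Q M ω m (fun x => u (rs (rPlus a Q M + x)))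
          (fun x => deriv u (rs (rPlus a Q M + x))) x‖ ≤ D := by
  have hδ := gap_pos hs
  obtain ⟨κ, hκ, hpot⟩ := exists_norm_le_of_frequencyBound (continuous_heunPotential a Q M) K 1
  set x₀ := min 1 (gap a Q M / (16 * κ))
  have hκx : κ * x₀ ≤ gap a Q M / 16 := by
    calc κ * x₀ ≤ κ * (gap a Q M / (16 * κ)) := by
          gcongr
          exact min_le_right _ _
      _ = gap a Q M / 16 := by field_simp
  refine ⟨x₀, 2 * κ / gap a Q M * (1 / areaRadius a Q M 0), by positivity,
    fun ω m lam rs u hK hrs hu => ?_⟩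
  obtain ⟨f₀, hf₀, hlim, hreg⟩ := hu.regularHeunSolution hs hrs
  refine ⟨f₀, hf₀, fun x hx hxx => ?_⟩
  rw [← hf₀]
  refine hreg.near_horizon hδ (by positivity) hlim (fun t ht htx => hpot ω m lam t hK ?_) hκx hx hxx
  rw [abs_of_pos ht]
  exact htx.trans (min_le_left _ _)

section ProfileBounds

variable {a Q M ω K lam x : ℝ} {m : ℤ} {v y : ℝ → ℂ}

lemma le_areaRadius (a Q M x : ℝ) : rPlus a Q M + x ≤ areaRadius a Q M x :=
  Real.le_sqrt_of_sq_le (by nlinarith [sq_nonneg a])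

lemma areaRadius_le (hs : Subextremal a Q M) (hx : 0 ≤ x) :
    areaRadius a Q M x ≤ rPlus a Q M + x + |a| := by
  have hr := rPlus_pos hs
  refine Real.sqrt_le_iff.2 ⟨by positivity, ?_⟩
  have : 0 ≤ (rPlus a Q M + x) * |a| := by positivity
  nlinarith [sq_abs a]

lemma norm_carterProfile (hs : Subextremal a Q M) (ω : ℝ) (m : ℤ) (v : ℝ → ℂ) (hx : 0 ≤ x) :
    ‖carterProfile a Q M ω m v x‖ = ‖v x‖ / areaRadius a Q M x := by
  rw [carterProfile, heunProfile, norm_mul, norm_radialPhase, one_mul, radialFunction, norm_div,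
    norm_ofReal_of_pos (areaRadius_pos hs hx)]

lemma abs_areaRadius_sq_mul_areaRadiusLogDeriv_le (hs : Subextremal a Q M) (hx : 0 < x) :
    |areaRadius a Q M x ^ 2 * areaRadiusLogDeriv a Q M x| ≤ rPlus a Q M + x := by
  have hδ := gap_pos hs
  have hr := rPlus_pos hs
  have hn : 0 < (rPlus a Q M + x) ^ 2 + a ^ 2 := by positivity
  have heq : areaRadius a Q M x ^ 2 * areaRadiusLogDeriv a Q M x
      = x * (x + gap a Q M) / ((rPlus a Q M + x) ^ 2 + a ^ 2) * (rPlus a Q M + x) := by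
    rw [areaRadius_sq, areaRadiusLogDeriv]
    field_simp
  rw [heq, abs_of_nonneg (by positivity)]
  exact mul_le_of_le_one_left (by positivity) ((div_le_one hn).2 (mul_add_gap_le hs hx))

lemma areaRadius_mul_norm_le (hs : Subextremal a Q M) (ω : ℝ) (m : ℤ) (v y : ℝ → ℂ)
    (hx : 0 < x) :
    areaRadius a Q M x * ‖y x‖ ≤ ‖carterFlux a Q M ω m v y x‖
      + (|heunDrift (gap a Q M) M ω (horizonExponent a Q M ω m) x| / 2 + (rPlus a Q M + x))
        * ‖carterProfile a Q M ω m v x‖ := by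
  have hN := areaRadius_pos hs hx.le
  have hN' : (areaRadius a Q M x : ℂ) ≠ 0 := by exact_mod_cast hN.ne'
  set T := heunDrift (gap a Q M) M ω (horizonExponent a Q M ω m) x with hT
  set φ := radialPhase (gap a Q M) M ω (horizonExponent a Q M ω m) x with hφ
  have heq : φ * (areaRadius a Q M x * y x) = carterFlux a Q M ω m v y x
      + (Complex.I * (T / 2 : ℝ) + (areaRadius a Q M x ^ 2 * areaRadiusLogDeriv a Q M x : ℝ))
        * carterProfile a Q M ω m v x := by
    simp only [carterFlux, carterProfile, heunFlux, heunProfile, radialFlux, radialFunction, ← hφ,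
      ← hT]
    push_cast
    field_simp
    ring
  calc areaRadius a Q M x * ‖y x‖ = ‖φ * (areaRadius a Q M x * y x)‖ := by
        rw [norm_mul, norm_mul, hφ, norm_radialPhase, one_mul, norm_ofReal_of_pos hN]
    _ ≤ _ := by
        rw [heq]
        refine (norm_add_le _ _).trans ?_
        rw [norm_mul]
        gcongr
        refine (norm_add_le _ _).trans (add_le_add ?_ ?_)
        · rw [norm_mul, Complex.norm_I, one_mul, Complex.norm_real, Real.norm_eq_abs, abs_div,
            abs_two]
        · rw [Complex.norm_real]
          exact abs_areaRadius_sq_mul_areaRadiusLogDeriv_le hs hx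

lemma norm_carterFlux_le (hs : Subextremal a Q M) (ω : ℝ) (m : ℤ) (v y : ℝ → ℂ) (hx : 0 < x) :
    ‖carterFlux a Q M ω m v y x‖ ≤ areaRadius a Q M x * ‖y x - Complex.I * ω * v x‖
      + ‖v x‖ / areaRadius a Q M x * (|ω * (rPlus a Q M ^ 2 + a ^ 2) + horizonFreq a Q M ω m|
        + 4 * M * |ω| * x + (rPlus a Q M + x)) := by
  have hM := hs.1
  have hN := areaRadius_pos hs hx.le
  have hN' : (areaRadius a Q M x : ℂ) ≠ 0 := by exact_mod_cast hN.ne'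
  set A := ω * (rPlus a Q M ^ 2 + a ^ 2) + horizonFreq a Q M ω m with hA
  have hdrift : heunDrift (gap a Q M) M ω (horizonExponent a Q M ω m) x / 2
      = ω * areaRadius a Q M x ^ 2 - (A + 4 * M * ω * x) := by
    rw [heunDrift_horizonExponent hs, areaRadius_sq, gap_eq, hA]
    ring
  have heq : carterFlux a Q M ω m v y x
      = radialPhase (gap a Q M) M ω (horizonExponent a Q M ω m) x
        * (areaRadius a Q M x * (y x - Complex.I * ω * v x) + v x / areaRadius a Q M x *
          (Complex.I * (A + 4 * M * ω * x : ℝ)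
            - (areaRadius a Q M x ^ 2 * areaRadiusLogDeriv a Q M x : ℝ))) := by
    rw [carterFlux, heunFlux, hdrift, radialFlux, radialFunction]
    push_cast
    field_simp
    ring
  rw [heq, norm_mul, norm_radialPhase, one_mul]
  refine (norm_add_le _ _).trans ?_
  rw [norm_mul, norm_mul, norm_div, norm_ofReal_of_pos hN]
  gcongr
  refine (norm_sub_le _ _).trans (add_le_add ?_ ?_)
  · rw [norm_mul, Complex.norm_I, one_mul, Complex.norm_real]
    refine (norm_add_le _ _).trans_eq ?_
    rw [Real.norm_eq_abs, Real.norm_eq_abs, abs_mul _ x, abs_mul _ ω,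
      abs_of_pos (by positivity : 0 < 4 * M), abs_of_pos hx]
  · rw [Complex.norm_real]
    exact abs_areaRadius_sq_mul_areaRadiusLogDeriv_le hs hx

lemma exists_modeEnergy_le (hs : Subextremal a Q M) {x₀ : ℝ} (hx₀ : 0 < x₀) (K S D : ℝ) :
    ∃ E, ∀ (ω : ℝ) (m : ℤ) (lam : ℝ) (v y : ℝ → ℂ), FrequencyBound K ω m lam →
      ‖carterProfile a Q M ω m v x₀‖ ≤ S → ‖carterProfileDeriv a Q M ω m v y x₀‖ ≤ D →
      modeEnergy ω v y x₀ ≤ E := by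
  have hδ := gap_pos hs
  have hr := rPlus_pos hs
  have hN := areaRadius_pos hs hx₀.le
  obtain ⟨T, hT, hdrift⟩ := exists_norm_le_of_frequencyBound (continuous_heunDrift a Q M) K x₀
  refine ⟨((x₀ * (x₀ + gap a Q M) * D + (T / 2 + (rPlus a Q M + x₀)) * S) / areaRadius a Q M x₀) ^ 2
    + K ^ 2 * (S * areaRadius a Q M x₀) ^ 2, fun ω m lam v y hK hS hD => ?_⟩
  have hv : ‖v x₀‖ ≤ S * areaRadius a Q M x₀ := by
    rwa [norm_carterProfile hs ω m v hx₀.le, div_le_iff₀ hN] at hS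
  have hflux : ‖carterFlux a Q M ω m v y x₀‖ ≤ x₀ * (x₀ + gap a Q M) * D := by
    rwa [carterProfileDeriv, norm_div, norm_ofReal_of_pos (by positivity),
      div_le_iff₀' (by positivity)] at hD
  have hy : ‖y x₀‖ ≤ (x₀ * (x₀ + gap a Q M) * D + (T / 2 + (rPlus a Q M + x₀)) * S)
      / areaRadius a Q M x₀ := by
    rw [le_div_iff₀' hN]
    refine (areaRadius_mul_norm_le hs ω m v y hx₀).trans (add_le_add hflux ?_)
    have : |heunDrift (gap a Q M) M ω (horizonExponent a Q M ω m) x₀| ≤ T :=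
      hdrift ω m lam x₀ hK (abs_of_pos hx₀).le
    gcongr
  rw [modeEnergy, ← sq_abs ω]
  have := hK.freq
  gcongr

lemma CarterSystem.norm_le_of_modeEnergy_le (hs : Subextremal a Q M)
    (h : CarterSystem a Q M ω m lam v y) (hK : FrequencyBound K ω m lam) {x₀ E : ℝ}
    (hx₀ : 0 < x₀) (hx : x₀ ≤ x) (hE : modeEnergy ω v y x₀ ≤ E) :
    ‖v x‖ ≤ K * √(E * Real.exp (potentialBound a Q M K * ((x₀ + gap a Q M) / x₀) * K
      / (x₀ + gap a Q M))) := by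
  have hδ := gap_pos hs
  have hP := potentialBound_nonneg (a := a) (Q := Q) (M := M) hK.pos.le
  have hω : 0 < |ω| := abs_pos.2 hK.ne_zero
  set X := Real.exp (potentialBound a Q M K * ((x₀ + gap a Q M) / x₀) * K / (x₀ + gap a Q M))
  have henergy : ω ^ 2 * ‖v x‖ ^ 2 ≤ E * X := by
    calc ω ^ 2 * ‖v x‖ ^ 2 ≤ modeEnergy ω v y x := le_add_of_nonneg_left (by positivity)
      _ ≤ _ := h.modeEnergy_le hs hK.ne_zero hK.freq hK.azimuthal hK.separation hx₀ hx
      _ ≤ E * X := by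
          refine mul_le_mul hE (Real.exp_le_exp.2 ?_) (Real.exp_pos _).le
            ((modeEnergy_nonneg ω v y x₀).trans hE)
          have := hK.inv_freq
          gcongr
  have hsqrt : |ω| * ‖v x‖ ≤ √(E * X) := Real.le_sqrt_of_sq_le (by rwa [mul_pow, sq_abs])
  calc ‖v x‖ = |ω|⁻¹ * (|ω| * ‖v x‖) := by field_simp
    _ ≤ K * √(E * X) := mul_le_mul hK.inv_freq hsqrt (by positivity) hK.pos.le

lemma norm_carterProfile_le (hs : Subextremal a Q M) {x₀ S V : ℝ}
    (hS0 : 0 ≤ S) (hV0 : 0 ≤ V) (hx₀ : 0 < x₀)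
    (hS : ∀ t, 0 < t → t ≤ x₀ → ‖carterProfile a Q M ω m v t‖ ≤ S)
    (hV : ∀ t, x₀ ≤ t → ‖v t‖ ≤ V) (hx : 0 < x) :
    ‖carterProfile a Q M ω m v x‖ ≤ (V + S * (x₀ + gap a Q M)) / (x + gap a Q M) := by
  have hδ := gap_pos hs
  rw [le_div_iff₀ (by positivity)]
  rcases le_total x x₀ with hxx | hxx
  · calc ‖carterProfile a Q M ω m v x‖ * (x + gap a Q M) ≤ S * (x₀ + gap a Q M) := by
          have := hS x hx hxx
          gcongr
      _ ≤ _ := le_add_of_nonneg_left hV0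
  · have hN := areaRadius_pos hs hx.le
    have hle : x + gap a Q M ≤ areaRadius a Q M x := by
      linarith [le_areaRadius a Q M x, gap_le_rPlus hs]
    calc ‖carterProfile a Q M ω m v x‖ * (x + gap a Q M)
        ≤ ‖v x‖ / areaRadius a Q M x * areaRadius a Q M x := by
          rw [norm_carterProfile hs ω m v hx.le]
          gcongr
      _ = ‖v x‖ := by field_simp
      _ ≤ V := hV x hxx
      _ ≤ _ := le_add_of_nonneg_right (by positivity)

end ProfileBounds

/-! ### The Wronskian controls the incoming part -/

lemma norm_incoming_mul_le (uHor uOut : ℝ → ℂ) (ω t : ℝ) :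
    ‖deriv uHor t - Complex.I * ω * uHor t‖ * ‖uOut t‖
      ≤ ‖wronskian uHor uOut t‖ + ‖uHor t‖ * ‖deriv uOut t - Complex.I * ω * uOut t‖ := by
  have heq : (deriv uHor t - Complex.I * ω * uHor t) * uOut t
      = uHor t * (deriv uOut t - Complex.I * ω * uOut t) - wronskian uHor uOut t := by
    rw [wronskian]
    ring
  rw [← norm_mul, heq, ← norm_mul (uHor t), add_comm]
  exact norm_sub_le _ _

lemma tendsto_add_mul_div_add (p q δ : ℝ) :
    Tendsto (fun x : ℝ => (p + q * x) / (x + δ)) atTop (𝓝 q) := by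
  have hδ : Tendsto (fun x : ℝ => x + δ) atTop atTop :=
    tendsto_atTop_add_const_right _ _ tendsto_id
  have hlim : Tendsto (fun x : ℝ => q + (p - q * δ) / (x + δ)) atTop (𝓝 (q + 0)) :=
    (tendsto_const_nhds.div_atTop hδ).const_add q
  rw [add_zero] at hlim
  refine hlim.congr' ?_
  filter_upwards [hδ.eventually_ne_atTop 0] with x hx
  field_simp
  ring

section Wronskian

variable {a Q M ω K lam : ℝ} {m : ℤ} {rs : ℝ → ℝ} {uHor uOut : ℝ → ℂ}

lemma mul_norm_carterProfileDeriv_le (hs : Subextremal a Q M) (ω : ℝ) (m : ℤ) {v y : ℝ → ℂ}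
    {x V Y : ℝ} (hx : 0 < x) (hV : ‖v x‖ ≤ V) (hY : ‖y x - Complex.I * ω * v x‖ ≤ Y) :
    x * ‖carterProfileDeriv a Q M ω m v y x‖
      ≤ (rPlus a Q M + |a| + 1 * x) / (x + gap a Q M) * Y
        + V * ((|ω * (rPlus a Q M ^ 2 + a ^ 2) + horizonFreq a Q M ω m| + rPlus a Q M
          + (4 * M * |ω| + 1) * x) / (x + gap a Q M) * x⁻¹) := by
  have hδ := gap_pos hs
  have hr := rPlus_pos hs
  have hM := hs.1
  have hxN : x ≤ areaRadius a Q M x := by linarith [le_areaRadius a Q M x]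
  set A := |ω * (rPlus a Q M ^ 2 + a ^ 2) + horizonFreq a Q M ω m|
  have : 0 ≤ A := abs_nonneg _
  have hV0 : 0 ≤ V := (norm_nonneg _).trans hV
  have hflux : ‖carterFlux a Q M ω m v y x‖ ≤ (rPlus a Q M + x + |a|) * Y
      + V / x * (A + 4 * M * |ω| * x + (rPlus a Q M + x)) := by
    refine (norm_carterFlux_le hs ω m v y hx).trans (add_le_add ?_ ?_)
    · exact mul_le_mul (areaRadius_le hs hx.le) hY (norm_nonneg _) (by positivity)
    · exact mul_le_mul_of_nonneg_right (div_le_div₀ hV0 hV hx hxN) (by positivity)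
  calc x * ‖carterProfileDeriv a Q M ω m v y x‖
      = ‖carterFlux a Q M ω m v y x‖ / (x + gap a Q M) := by
        rw [carterProfileDeriv, norm_div, norm_ofReal_of_pos (by positivity)]
        field_simp
    _ ≤ ((rPlus a Q M + x + |a|) * Y + V / x * (A + 4 * M * |ω| * x + (rPlus a Q M + x)))
        / (x + gap a Q M) := by gcongr
    _ = _ := by
        field_simp
        ring

lemma IsOut.eventually_mul_norm_carterProfileDeriv_le (hs : Subextremal a Q M)
    (hrs : IsTortoise a Q M rs) (hHor : IsCarterSolution a Q M ω m lam rs uHor)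
    (hOut : IsOut a Q M ω m lam rs uOut) {V : ℝ}
    (hV : ∀ᶠ x in atTop, ‖uHor (rs (rPlus a Q M + x))‖ ≤ V) (t : ℝ) {e : ℝ} (he : 0 < e) :
    ∀ᶠ x in atTop, x * ‖carterProfileDeriv a Q M ω m (fun x => uHor (rs (rPlus a Q M + x)))
      (fun x => deriv uHor (rs (rPlus a Q M + x))) x‖ ≤ ‖wronskian uHor uOut t‖ + e := by
  set W := ‖wronskian uHor uOut t‖
  set out : ℝ → ℝ := fun x => ‖uOut (rs (rPlus a Q M + x))‖
  set rad : ℝ → ℝ := fun x =>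
    ‖deriv uOut (rs (rPlus a Q M + x)) - Complex.I * ω * uOut (rs (rPlus a Q M + x))‖
  have hout : Tendsto out atTop (𝓝 1) := hOut.tendsto_norm
  have hincoming : Tendsto (fun x => (W + V * rad x) / out x) atTop (𝓝 ((W + V * 0) / 1)) :=
    (((hOut.radiation_condition hs hrs).const_mul V).const_add W).div hout one_ne_zero
  have hlim := ((tendsto_add_mul_div_add (rPlus a Q M + |a|) 1 (gap a Q M)).mul hincoming).add
    (((tendsto_add_mul_div_add (|ω * (rPlus a Q M ^ 2 + a ^ 2) + horizonFreq a Q M ω m|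
      + rPlus a Q M) (4 * M * |ω| + 1) (gap a Q M)).mul tendsto_inv_atTop_zero).const_mul V)
  simp only [mul_zero, add_zero, div_one, one_mul] at hlim
  filter_upwards [hlim.eventually (gt_mem_nhds (lt_add_of_pos_right W he)), hV,
    eventually_gt_atTop 0, hout.eventually (lt_mem_nhds one_pos)] with x hx hVx hx0 hout0
  refine (mul_norm_carterProfileDeriv_le hs ω m hx0 hVx ((le_div_iff₀ hout0).2 ?_)).trans
    (by simpa only [one_mul] using hx.le)
  refine (norm_incoming_mul_le uHor uOut ω _).trans (add_le_add (le_of_eq ?_) ?_)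
  · rw [wronskian_eq hs hrs hHor hOut.solution _ t]
  · exact mul_le_mul_of_nonneg_right hVx (norm_nonneg _)

theorem exists_modeProfile (hs : Subextremal a Q M) (K : ℝ) :
    ∃ B x₀, 0 < x₀ ∧ ∀ (ω : ℝ) (m : ℤ) (lam : ℝ) (rs : ℝ → ℝ) (uHor uOut : ℝ → ℂ) (t : ℝ),
      FrequencyBound K ω m lam → IsTortoise a Q M rs → IsHor a Q M ω m lam rs uHor →
      IsOut a Q M ω m lam rs uOut →
      ∃ (f f' : ℝ → ℂ) (f₀ : ℂ), ModeProfile (gap a Q M) M ω (horizonExponent a Q M ω m)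
          (accessory a Q M ω m lam) f f' B ‖wronskian uHor uOut t‖ ∧
        ‖f₀‖ = 1 / areaRadius a Q M 0 ∧
        ∀ x, 0 < x → x ≤ x₀ → ‖f x - f₀‖ ≤ 1 / areaRadius a Q M 0 / 8 := by
  obtain ⟨x₀, D, hx₀, hnear⟩ := exists_uniform_near_horizon hs K
  have hc := one_div_pos.2 (areaRadius_pos hs le_rfl)
  set c := 1 / areaRadius a Q M 0
  obtain ⟨E, hE⟩ := exists_modeEnergy_le hs hx₀ K (2 * c) D
  set V := K * √(E * Real.exp (potentialBound a Q M K * ((x₀ + gap a Q M) / x₀) * K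
      / (x₀ + gap a Q M)))
  refine ⟨V + 2 * c * (x₀ + gap a Q M), x₀, hx₀, ?_⟩
  intro ω m lam rs uHor uOut t hK hrs hHor hOut
  have hsys := hHor.solution.carterSystem hs hrs
  obtain ⟨-, -, -, hreg⟩ := hHor.regularHeunSolution hs hrs
  obtain ⟨f₀, hf₀, hf⟩ := hnear ω m lam rs uHor hK hrs hHor
  set v : ℝ → ℂ := fun x => uHor (rs (rPlus a Q M + x))
  have hS : ∀ x, 0 < x → x ≤ x₀ → ‖carterProfile a Q M ω m v x‖ ≤ 2 * c := fun x hx hxx => by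
    linarith [(hf x hx hxx).1, norm_sub_norm_le (carterProfile a Q M ω m v x) f₀]
  have hV : ∀ x, x₀ ≤ x → ‖v x‖ ≤ V := fun x hx => hsys.norm_le_of_modeEnergy_le hs hK hx₀ hx
    (hE ω m lam _ _ hK (hS x₀ hx₀ le_rfl) (hf x₀ hx₀ le_rfl).2)
  have hV0 : 0 ≤ V := mul_nonneg hK.pos.le (Real.sqrt_nonneg _)
  exact ⟨_, _, f₀, { toRegularHeunSolution := hreg
                     bound := fun x hx => norm_carterProfile_le hs (by positivity) hV0 hx₀ hS hV hx
                     at_top := fun e he => hOut.eventually_mul_norm_carterProfileDeriv_le hs hrs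
                       hHor.solution (eventually_atTop.2 ⟨x₀, hV⟩) t he },
    hf₀, fun x hx hxx => (hf x hx hxx).1⟩

theorem exists_wronskian_lower_bound (hs : Subextremal a Q M) (K : ℝ) :
    ∃ η, 0 < η ∧ ∀ (ω : ℝ) (m : ℤ) (lam : ℝ) (rs : ℝ → ℝ) (uHor uOut : ℝ → ℂ) (t : ℝ),
      FrequencyBound K ω m lam → IsTortoise a Q M rs → IsHor a Q M ω m lam rs uHor →
      IsOut a Q M ω m lam rs uOut → η < ‖wronskian uHor uOut t‖ := by
  obtain ⟨B, x₀, hx₀, hprofile⟩ := exists_modeProfile hs K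
  obtain ⟨C, hC, hparam⟩ := exists_norm_le_of_frequencyBound
    ((continuous_horizonExponent a Q M).prodMk (continuous_accessory a Q M)) K 0
  obtain ⟨η, hη, hlower⟩ := exists_incoming_lower_bound (gap_pos hs) hs.1
    (lt_max_of_lt_right hC : 0 < max K C) B (one_div_pos.2 (areaRadius_pos hs le_rfl)) hx₀
  refine ⟨η, hη, fun ω m lam rs uHor uOut t hK hrs hHor hOut => ?_⟩
  obtain ⟨f, f', f₀, hmode, hf₀, hf⟩ := hprofile ω m lam rs uHor uOut t hK hrs hHor hOut
  obtain ⟨hc, hb⟩ := norm_prod_le_iff.1 (hparam ω m lam 0 hK (abs_zero.le))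
  exact hlower ω _ _ _ f f' f₀ hK.ne_zero (le_max_of_le_left hK.freq)
    (le_max_of_le_left hK.inv_freq) (le_max_of_le_right hc) (le_max_of_le_right hb) hmode hf₀ hf

end Wronskian

end

end KerrNewman

theorem theorem3p1_general :
    ∃ G : ℝ → ℝ → ℝ → ℝ → ℝ,
      ∀ a Q M : ℝ, KerrNewman.Subextremal a Q M →
      ∀ (K ω : ℝ) (m : ℤ) (lam : ℝ), ω ≠ 0 → |ω| + |ω|⁻¹ + |(m : ℝ)| + |lam| ≤ K →
      ∀ rs : ℝ → ℝ, KerrNewman.IsTortoise a Q M rs →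
      ∀ uHor uOut : ℝ → ℂ, KerrNewman.IsHor a Q M ω m lam rs uHor →
        KerrNewman.IsOut a Q M ω m lam rs uOut →
      ∀ x : ℝ,
        KerrNewman.wronskian uHor uOut x ≠ 0 ∧
          ‖(KerrNewman.wronskian uHor uOut x)⁻¹‖ ≤ G K a Q M := by
  choose! η hη hlower using fun K a Q M (hs : KerrNewman.Subextremal a Q M) =>
    KerrNewman.exists_wronskian_lower_bound hs K
  refine ⟨fun K a Q M => (η K a Q M)⁻¹, ?_⟩
  intro a Q M hs K ω m lam hω hsize rs hrs uHor uOut hHor hOut x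
  have hfreq : KerrNewman.FrequencyBound K ω m lam := by
    have hinv : 0 ≤ |ω|⁻¹ := by positivity
    constructor <;> first | exact hω | linarith [abs_nonneg ω, abs_nonneg (m : ℝ), abs_nonneg lam]
  have hlt := hlower K a Q M hs ω m lam rs uHor uOut x hfreq hrs hHor hOut
  refine ⟨norm_pos_iff.1 ((hη K a Q M hs).trans hlt), ?_⟩
  rw [norm_inv]
  exact inv_anti₀ (hη K a Q M hs) hlt.le

theorem theorem3p1 :
    ∃ G : ℝ → ℝ → ℝ → ℝ → ℝ,
      ∀ a Q M : ℝ, KerrNewman.Subextremal a Q M →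
      ∀ F : Set (ℝ × ℤ × ℤ), F ⊆ KerrNewman.admissibleFreq →
        BddAbove (KerrNewman.freqSize a '' F) →
      ∀ rs : ℝ → ℝ, KerrNewman.IsTortoise a Q M rs →
      ∀ (ω : ℝ) (m ℓ : ℤ), (ω, m, ℓ) ∈ F →
      ∀ uHor uOut : ℝ → ℂ,
        KerrNewman.IsHor a Q M ω m (KerrNewman.angularEigenvalue a ω m ℓ) rs uHor →
        KerrNewman.IsOut a Q M ω m (KerrNewman.angularEigenvalue a ω m ℓ) rs uOut →
      ∀ x : ℝ,
        KerrNewman.wronskian uHor uOut x ≠ 0 ∧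
          ‖(KerrNewman.wronskian uHor uOut x)⁻¹‖ ≤ G (KerrNewman.freqBound a F) a Q M :=
  let ⟨G, hG⟩ := theorem3p1_general
  ⟨G, fun a Q M hs _ hF hbdd rs hrs ω m _ hmem => hG a Q M hs _ ω m _ (hF hmem).1
    (le_csSup hbdd (Set.mem_image_of_mem (KerrNewman.freqSize a) hmem)) rs hrs⟩
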